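/- Let $m>1$ and let $(\mathcal M,\mathbf c)$ be a time-oriented smooth conformal manifold of Lorentzian signature $(+,\dots,+,-)$ and dimension $2m+2$ (no orientation of $\mathcal M$ is needed). Let $K\subset T\mathcal M$ be a smooth null line distribution, $K^\perp\supset K$ its orthogonal complement and $H_K=K^\perp/K$ the screen bundle, with the conformal structure $h(v+K,w+K)=g(v,w)$, $g\in\mathbf c$. An optical vector field is a non-vanishing smooth section $k$ of $K$; for $g\in\mathbf c$ put $\kappa=g(k,\cdot)$. Let $\mathcal K$ be the congruence of curves tangent to $K$. Suppose that for all local optical vector fields $k$ (and all $g\in\mathbf c$): - $\mathcal K$ is geodesic: $(\mathcal L_k\kappa)(v)=0$ for $v\in K^\perp$; - $\mathcal K$ is non-shearing: at each point $(\mathcal L_k g)(v,w)$ is proportional to $g(v,w)$ for $v,w\in K^\perp$; - $\mathcal K$ is twisting: the twist of $k$, i.e. the $2$-form $\tau(v+K,w+K)=(d\kappa)(v,w)$ on $H_K$, where $(d\kappa)_{ab}=\nabla_{[a}\kappa_{b]}$, vanishes at no point (equivalently $\kappa\wedge d\kappa\neq 0$ everywhere). The endomorphism $F_k$ of $H_K$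 defined by $h(F_kv,w)=\tau(v,w)$ does not depend on $g\in\mathbf c$. The following statements are equivalent. 1. The Weyl tensor satisfies $W(k,v,k,v)=0$ for all sections $k$ of $K$ and $v$ of $K^\perp$. 2. The twist of $\mathcal K$ induces an almost Robinson structure $(N,K)$ on $\mathcal M$: for some optical vector field $k$ on $\mathcal M$ the endomorphism $J=F_k$ is a bundle complex structure on $H_K$, and the preimage $N\subset{}^{\mathbb C}K^\perp$ of its $-i$-eigenbundle is a totally null complex distribution of rank $m+1$ with $N\cap\overline N={}^{\mathbb C}K$. 3. The twist of $\mathcal K$ induces a partially integrable contact almost CR structure $(\underline H,\underline J)$ of positive definite signature on the (local) leaf space $\underline{\mathcal M}$ of $\mathcal K$. That is: every point of $\mathcal M$ has an open neighbourhood $U$ with a leaf space $\pi\colon U\to\underline{\mathcal M}$ (a smooth surjective submersion onto a $(2m+1)$-dimensional manifold, with connected fibres and $\ker d\pi=K$), and for every leaf space of an open set $U$ there is an optical vector field $k$ on $U$ such that $\underline H=d\pi(K^\perp)$ is a well-defined contact distribution of rank $2m$ and $F_k$ descends to a smooth bundle complex structure $\underline J$ on $\underline H\cong H_K$, such that $[\Gamma(\underline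 H^{(1,0)}),\Gamma(\underline H^{(1,0)})]\subset\Gamma({}^{\mathbb C}\underline H)$, where $\underline H^{(1,0)}$ is the $i$-eigenbundle of $\underline J$, and such that around each point some contact form $\theta$ with kernel $\underline H$ has positive definite Levi form $X\mapsto d\theta(X,\underline JX)$ on $\underline H$. -/

import Mathlib

open scoped Manifold ContDiff TensorProduct

noncomputable section

namespace OpticalGeom

/-- The model space `ℝ^d`. -/
abbrev Euc (d : ℕ) : Type := EuclideanSpace ℝ (Fin d)

/-- The (real) tangent space at `x` of a manifold modelled on `ℝ^d`. -/
abbrev Tan (d : ℕ) {M : Type*} [TopologicalSpace M] [ChartedSpace (Euc d) M] (x : M) : Type :=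
  TangentSpace 𝓘(ℝ, Euc d) x

/-- The complexified tangent space. -/
abbrev CTan (d : ℕ) {M : Type*} [TopologicalSpace M] [ChartedSpace (Euc d) M] (x : M) : Type :=
  ℂ ⊗[ℝ] Tan d x

section Basic

variable {d : ℕ} {M : Type*} [TopologicalSpace M] [ChartedSpace (Euc d) M]
  [IsManifold 𝓘(ℝ, Euc d) ∞ M]

/-- The complex tangent vector `u + i v`. -/
def cvec {x : M} (u v : Tan d x) : CTan d x := (1 : ℂ) ⊗ₜ[ℝ] u + Complex.I ⊗ₜ[ℝ] v

/-- Complex conjugation on the complexified tangent space. -/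
def conjTan (x : M) : CTan d x →ₗ[ℝ] CTan d x :=
  TensorProduct.map Complex.conjAe.toLinearMap LinearMap.id

/-- `X` is a smooth vector field on `V`. -/
def SmoothVF (X : ∀ x : M, Tan d x) (V : Set M) : Prop :=
  ContMDiffOn 𝓘(ℝ, Euc d) 𝓘(ℝ, Euc d).tangent ∞
    (fun x => (⟨x, X x⟩ : TangentBundle 𝓘(ℝ, Euc d) M)) V

/-- `α` is a smooth `1`-form on `V`. -/
def SmoothOneForm (α : ∀ x : M, Tan d x →L[ℝ] ℝ) (V : Set M) : Prop :=
  ContMDiffOn 𝓘(ℝ, Euc d) (𝓘(ℝ, Euc d).prod 𝓘(ℝ, Euc d →L[ℝ] ℝ)) ∞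
    (fun x => Bundle.TotalSpace.mk' (Euc d →L[ℝ] ℝ)
      (E := fun x : M => Tan d x →L[ℝ] Bundle.Trivial M ℝ x) x (α x)) V

/-- A smooth real distribution of rank `r`: a family of subspaces of the tangent spaces that is
locally spanned by a smooth frame of `r` vector fields. -/
def IsDistribution (r : ℕ) (H : ∀ x : M, Submodule ℝ (Tan d x)) : Prop :=
  ∀ x₀ : M, ∃ V : Set M, IsOpen V ∧ x₀ ∈ V ∧ ∃ X : Fin r → ∀ x : M, Tan d x,
    (∀ i, SmoothVF (X i) V) ∧
    ∀ x ∈ V, LinearIndependent ℝ (fun i => X i x) ∧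
      H x = Submodule.span ℝ (Set.range fun i => X i x)

/-- A smooth complex distribution of (complex) rank `r`: a family of complex subspaces of the
complexified tangent spaces that is locally spanned by a smooth frame of `r` complex vector
fields. -/
def IsComplexDistribution (r : ℕ) (N : ∀ x : M, Submodule ℂ (CTan d x)) : Prop :=
  ∀ x₀ : M, ∃ V : Set M, IsOpen V ∧ x₀ ∈ V ∧ ∃ X Y : Fin r → ∀ x : M, Tan d x,
    (∀ i, SmoothVF (X i) V ∧ SmoothVF (Y i) V) ∧
    ∀ x ∈ V, LinearIndependent ℂ (fun i => cvec (X i x) (Y i x)) ∧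
      N x = Submodule.span ℂ (Set.range fun i => cvec (X i x) (Y i x))

/-! ### Tensor calculus

At the point `x` the tangent space `Tan d x` is the model space, the identification being the
differential of the preferred chart at `x`.  The exterior derivative, the Lie derivatives and the
curvature at `x` are therefore computed by their coordinate formulas in that chart; being tensorial,
they do not depend on it. -/

/-- The coordinates of `x` in the preferred chart at `x`. -/
def coord (x : M) : Euc d := extChartAt 𝓘(ℝ, Euc d) x x

/-- The differential of the inverse of the preferred chart at `x`. -/
def chartInvDeriv (x : M) (y : Euc d) :
    Euc d →L[ℝ] Tan d ((extChartAt 𝓘(ℝ, Euc d) x).symm y) :=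
  mfderiv 𝓘(ℝ, Euc d) 𝓘(ℝ, Euc d) (extChartAt 𝓘(ℝ, Euc d) x).symm y

/-- A vector field in the preferred chart at `x`. -/
def vfInChart (X : ∀ x : M, Tan d x) (x : M) (y : Euc d) : Euc d :=
  (chartInvDeriv x y).inverse (X ((extChartAt 𝓘(ℝ, Euc d) x).symm y))

/-- A `1`-form in the preferred chart at `x`. -/
def formInChart (α : ∀ x : M, Tan d x →L[ℝ] ℝ) (x : M) (y : Euc d) : Euc d →L[ℝ] ℝ :=
  (α ((extChartAt 𝓘(ℝ, Euc d) x).symm y)).comp (chartInvDeriv x y)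

/-- A covariant `2`-tensor in the preferred chart at `x`. -/
def tensorInChart (g : ∀ x : M, Tan d x →L[ℝ] Tan d x →L[ℝ] ℝ) (x : M) (y : Euc d) :
    Euc d →L[ℝ] Euc d →L[ℝ] ℝ :=
  let b : Euc d →L[ℝ] Euc d →L[ℝ] ℝ := g ((extChartAt 𝓘(ℝ, Euc d) x).symm y)
  let D : Euc d →L[ℝ] Euc d := chartInvDeriv x y
  b.bilinearComp D D

/-- The exterior derivative of a `1`-form at `x`, i.e. `∂_a α_b - ∂_b α_a`. -/
def extDer (α : ∀ x : M, Tan d x →L[ℝ] ℝ) (x : M) (u v : Tan d x) : ℝ :=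
  fderiv ℝ (formInChart α x) (coord x) u v - fderiv ℝ (formInChart α x) (coord x) v u

/-- The Lie derivative of the `1`-form `α` along `k`, at `x`, i.e. `k^a ∂_a α_b + α_a ∂_b k^a`. -/
def lieForm (k : ∀ x : M, Tan d x) (α : ∀ x : M, Tan d x →L[ℝ] ℝ) (x : M) (v : Tan d x) : ℝ :=
  fderiv ℝ (formInChart α x) (coord x) (vfInChart k x (coord x)) v
    + formInChart α x (coord x) (fderiv ℝ (vfInChart k x) (coord x) v)

/-- The Lie derivative of the covariant `2`-tensor `g` along `k`, at `x`, i.e.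
`k^c ∂_c g_{ab} + g_{cb} ∂_a k^c + g_{ac} ∂_b k^c`. -/
def lieTensor (k : ∀ x : M, Tan d x) (g : ∀ x : M, Tan d x →L[ℝ] Tan d x →L[ℝ] ℝ) (x : M)
    (u v : Tan d x) : ℝ :=
  fderiv ℝ (tensorInChart g x) (coord x) (vfInChart k x (coord x)) u v
    + tensorInChart g x (coord x) (fderiv ℝ (vfInChart k x) (coord x) u) v
    + tensorInChart g x (coord x) u (fderiv ℝ (vfInChart k x) (coord x) v)

end Basic

/-! ### Curvature of a metric on `ℝ^d` -/

section Curvature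

variable {d : ℕ} (G : Euc d → Euc d →L[ℝ] Euc d →L[ℝ] ℝ)

/-- The Christoffel symbols: `G (Γ(u,v), w) = ½ (∂_u G(v,w) + ∂_v G(u,w) - ∂_w G(u,v))`. -/
def christoffel (y u v : Euc d) : Euc d :=
  (G y).inverse ((1 / 2 : ℝ) •
    (fderiv ℝ G y u v + fderiv ℝ G y v u - ((fderiv ℝ G y).flip u).flip v))

/-- The curvature `R(a,b)w`, i.e. `R_{ab}{}^c{}_d a^a b^b w^d`, with `2 ∇_[a ∇_b] V^c =
R_{ab}{}^c{}_d V^d`. -/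
def riemann (y a b w : Euc d) : Euc d :=
  fderiv ℝ (fun z => christoffel G z b w) y a - fderiv ℝ (fun z => christoffel G z a w) y b
    + christoffel G y a (christoffel G y b w) - christoffel G y b (christoffel G y a w)

/-- The Ricci tensor `Ric_{ab} = R_{ca}{}^c{}_b`. -/
def ricci (y a b : Euc d) : ℝ :=
  ∑ c : Fin d, riemann G y (EuclideanSpace.single c 1) a b c

/-- The components `G^{ij}` of the inverse metric. -/
def invMetric (y : Euc d) (i j : Fin d) : ℝ :=
  (Matrix.of fun p q : Fin d =>
    G y (EuclideanSpace.single p 1) (EuclideanSpace.single q 1))⁻¹ i j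

/-- The scalar curvature. -/
def scalarCurv (y : Euc d) : ℝ :=
  ∑ i : Fin d, ∑ j : Fin d,
    invMetric G y i j * ricci G y (EuclideanSpace.single i 1) (EuclideanSpace.single j 1)

/-- The Schouten tensor `P = (Ric - Sc / (2 (d - 1)) G) / (d - 2)`. -/
def schouten (y a b : Euc d) : ℝ :=
  (1 / ((d : ℝ) - 2)) * (ricci G y a b - scalarCurv G y / (2 * ((d : ℝ) - 1)) * G y a b)

/-- The Weyl tensor `W_{abcd} = R_{abcd} - g_{ac} P_{bd} + g_{bc} P_{ad} + g_{ad} P_{bc} -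
g_{bd} P_{ac}`, where `R_{abcd} = g_{ce} R_{ab}{}^e{}_d`. -/
def weylFlat (y a b c e : Euc d) : ℝ :=
  G y c (riemann G y a b e)
    - G y a c * schouten G y b e + G y b c * schouten G y a e
    + G y a e * schouten G y b c - G y b e * schouten G y a c

end Curvature

section Lorentz

variable (d : ℕ) (M : Type*) [TopologicalSpace M] [ChartedSpace (Euc d) M]
  [IsManifold 𝓘(ℝ, Euc d) ∞ M]

/-- A smooth metric of Lorentzian signature `(+,…,+,-)`. -/
structure LorentzMetric where
  /-- the scalar product on each tangent space -/
  val : ∀ x : M, Tan d x →L[ℝ] Tan d x →L[ℝ] ℝ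
  symm : ∀ (x : M) (u v : Tan d x), val x u v = val x v u
  lorentzian : ∀ x : M, ∃ t : Tan d x, val x t t < 0 ∧
    ∀ v : Tan d x, val x t v = 0 → v ≠ 0 → 0 < val x v v
  smooth : ContMDiff 𝓘(ℝ, Euc d) (𝓘(ℝ, Euc d).prod 𝓘(ℝ, Euc d →L[ℝ] Euc d →L[ℝ] ℝ)) ∞
    (fun x => Bundle.TotalSpace.mk' (Euc d →L[ℝ] Euc d →L[ℝ] ℝ)
      (E := fun x : M => Tan d x →L[ℝ] Tan d x →L[ℝ] ℝ) x (val x))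

/-- A Lorentzian conformal structure: an equivalence class of Lorentzian metrics for the relation
`ĝ = e^{2φ} g`, `φ` a smooth function. -/
structure ConformalStructure where
  /-- the metrics in the conformal class -/
  metrics : Set (LorentzMetric d M)
  nonempty : metrics.Nonempty
  mem_iff : ∀ g ∈ metrics, ∀ g' : LorentzMetric d M, g' ∈ metrics ↔
    ∃ φ : M → ℝ, ContMDiff 𝓘(ℝ, Euc d) 𝓘(ℝ, ℝ) ∞ φ ∧
      ∀ x, g'.val x = Real.exp (2 * φ x) • g.val x

end Lorentz

section Optical

variable {d : ℕ} {M : Type*} [TopologicalSpace M] [ChartedSpace (Euc d) M]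
  [IsManifold 𝓘(ℝ, Euc d) ∞ M]

/-- The Weyl tensor of a metric at a point. -/
def LorentzMetric.weyl (g : LorentzMetric d M) (x : M) (a b c e : Tan d x) : ℝ :=
  weylFlat (tensorInChart g.val x) (coord x) a b c e

/-- The scalar product as a bilinear form. -/
def LorentzMetric.bilin (g : LorentzMetric d M) (x : M) : LinearMap.BilinForm ℝ (Tan d x) :=
  LinearMap.mk₂ ℝ (fun u v => g.val x u v) (by intros; simp) (by intros; simp) (by intros; simp)
    (by intros; simp)

/-- The conformal structure is time-orientable: there is a global smooth timelike vector field. -/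
def ConformalStructure.TimeOrientable (c : ConformalStructure d M) : Prop :=
  ∃ T : ∀ x : M, Tan d x, SmoothVF T Set.univ ∧ ∀ g ∈ c.metrics, ∀ x, g.val x (T x) (T x) < 0

variable (c : ConformalStructure d M) (K : ∀ x : M, Submodule ℝ (Tan d x))

/-- `K` is a null line distribution: `(M, c, K)` is an optical geometry. -/
def IsOptical : Prop :=
  IsDistribution 1 K ∧ ∀ g ∈ c.metrics, ∀ x, ∀ u ∈ K x, ∀ v ∈ K x, g.val x u v = 0

/-- The orthogonal complement `K^⊥` (the same for all metrics of the conformal class). -/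
def perp (x : M) : Submodule ℝ (Tan d x) where
  carrier := {v | ∀ g ∈ c.metrics, ∀ u ∈ K x, g.val x u v = 0}
  add_mem' := by
    intro a b ha hb g hg u hu
    rw [map_add, ha g hg u hu, hb g hg u hu, add_zero]
  zero_mem' := by
    intro g _ u _
    rw [map_zero]
  smul_mem' := by
    intro r a ha g hg u hu
    rw [map_smul, ha g hg u hu, smul_zero]

/-- The screen bundle `H_K = K^⊥ / K`. -/
abbrev Screen (x : M) : Type := perp c K x ⧸ (K x).submoduleOf (perp c K x)

/-- An optical vector field on the open set `V`: a non-vanishing smooth section of `K` there. -/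
def IsOpticalField (k : ∀ x : M, Tan d x) (V : Set M) : Prop :=
  SmoothVF k V ∧ ∀ x ∈ V, k x ∈ K x ∧ k x ≠ 0

/-- The `1`-form `κ = g(k, ·)`. -/
def lowerVF (g : LorentzMetric d M) (k : ∀ x : M, Tan d x) (x : M) : Tan d x →L[ℝ] ℝ :=
  g.val x (k x)

/-- The twist `τ` of `k` with respect to a metric of the conformal class, i.e. the restriction of
`(dκ)_{ab} = ∇_[a κ_b]`, `κ = g(k, ·)`, to be evaluated on vectors of `K^⊥`. -/
def twist (g : LorentzMetric d M) (k : ∀ x : M, Tan d x) (x : M) (u v : Tan d x) : ℝ :=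
  (1 / 2) * extDer (lowerVF g k) x u v

/-- The congruence of curves tangent to `K` is geodesic: `ℒ_k κ (v) = 0` for `v` in `K^⊥`. -/
def IsGeodesic : Prop :=
  ∀ g ∈ c.metrics, ∀ (V : Set M) (k : ∀ x : M, Tan d x), IsOpen V → IsOpticalField K k V →
    ∀ x ∈ V, ∀ v ∈ perp c K x, lieForm k (lowerVF g k) x v = 0

/-- The congruence is non-shearing: `ℒ_k g (u, v)` is proportional to `g (u, v)` for `u`, `v` in
`K^⊥`. -/
def IsNonShearing : Prop :=
  ∀ g ∈ c.metrics, ∀ (V : Set M) (k : ∀ x : M, Tan d x), IsOpen V → IsOpticalField K k V →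
    ∀ x ∈ V, ∃ μ : ℝ, ∀ u ∈ perp c K x, ∀ v ∈ perp c K x,
      lieTensor k g.val x u v = μ * g.val x u v

/-- The congruence is twisting: its twist vanishes at no point (equivalently, `κ ∧ dκ ≠ 0`
everywhere). -/
def IsTwisting : Prop :=
  ∀ g ∈ c.metrics, ∀ (V : Set M) (k : ∀ x : M, Tan d x), IsOpen V → IsOpticalField K k V →
    ∀ x ∈ V, ∃ u ∈ perp c K x, ∃ v ∈ perp c K x, twist g k x u v ≠ 0

/-- `W (k, v, k, v) = 0` for all `k` in `K` and `v` in `K^⊥`. -/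
def WeylCondition : Prop :=
  ∀ g ∈ c.metrics, ∀ x, ∀ k ∈ K x, ∀ v ∈ perp c K x, g.weyl x k v k v = 0

/-- `(N, K)` is an almost Robinson structure on a manifold of dimension `2m+2`: `N` is a totally
null complex distribution of rank `m+1`, and `K` a real null line distribution whose
complexification is `N ∩ N̄`. -/
def IsAlmostRobinson (m : ℕ) (N : ∀ x : M, Submodule ℂ (CTan d x)) : Prop :=
  IsOptical c K ∧ IsComplexDistribution (m + 1) N ∧
  (∀ g ∈ c.metrics, ∀ x, ∀ z ∈ N x, ∀ w ∈ N x,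
    LinearMap.BilinForm.baseChange ℂ (g.bilin x) z w = 0) ∧
  ∀ x (z : CTan d x), (z ∈ N x ∧ conjTan x z ∈ N x) ↔ z ∈ (K x).baseChange ℂ

/-- `J` is the endomorphism of the screen space at `x` that the twist of `k` defines through the
screen metric: `h (J v, u) = τ (v, u)`. -/
def IsTwistEndo (k : ∀ x : M, Tan d x) (x : M) (J : Screen c K x →ₗ[ℝ] Screen c K x) : Prop :=
  ∀ g ∈ c.metrics, ∀ v w u : perp c K x,
    J (Submodule.Quotient.mk v) = Submodule.Quotient.mk w →
      g.val x (w : Tan d x) u = twist g k x v u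

/-- The twist of the congruence induces an almost Robinson structure `(N, K)`: the twist of some
optical vector field is a bundle complex structure `J` on the screen bundle, and `N / ℂK` is the
`-i`-eigenbundle of `J`, that is, `N` consists of the `v + i w` with `v`, `w` in `K^⊥` and
`w = J v` modulo `K`. -/
def TwistInducesAlmostRobinson (m : ℕ) : Prop :=
  ∃ (k : ∀ x : M, Tan d x) (J : ∀ x : M, Screen c K x →ₗ[ℝ] Screen c K x)
    (N : ∀ x : M, Submodule ℂ (CTan d x)),
    IsOpticalField K k Set.univ ∧
    (∀ x, IsTwistEndo c K k x (J x) ∧ ∀ s, J x (J x s) = -s) ∧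
    IsAlmostRobinson c K m N ∧
    ∀ x (z : CTan d x), z ∈ N x ↔ ∃ v w : perp c K x, z = cvec (v : Tan d x) (w : Tan d x) ∧
      J x (Submodule.Quotient.mk v) = Submodule.Quotient.mk w

end Optical

/-! ### Almost CR structures -/

section CR

/-- An almost CR structure on a manifold of dimension `2m+1`: a distribution `H` of rank `2m` with
a smooth bundle complex structure `J`. -/
structure AlmostCR (m : ℕ) (B : Type*) [TopologicalSpace B] [ChartedSpace (Euc (2 * m + 1)) B]
    [IsManifold 𝓘(ℝ, Euc (2 * m + 1)) ∞ B] where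
  /-- the distribution -/
  H : ∀ p : B, Submodule ℝ (Tan (2 * m + 1) p)
  /-- the complex structure -/
  J : ∀ p : B, H p →ₗ[ℝ] H p
  distribution : IsDistribution (2 * m) H
  sq : ∀ (p : B) (X : H p), J p (J p X) = -X
  smooth : ∀ (V : Set B) (X Y : ∀ p : B, Tan (2 * m + 1) p), IsOpen V → SmoothVF X V →
    (∀ p ∈ V, ∃ h : X p ∈ H p, Y p = (J p ⟨X p, h⟩ : Tan (2 * m + 1) p)) → SmoothVF Y V

variable {m : ℕ} {B : Type*} [TopologicalSpace B] [ChartedSpace (Euc (2 * m + 1)) B]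
  [IsManifold 𝓘(ℝ, Euc (2 * m + 1)) ∞ B]

/-- `θ` is a contact form for the distribution `H` on `V`: its kernel is `H` and `dθ` is
non-degenerate on `H`, that is, `θ ∧ (dθ)^m ≠ 0`. -/
def IsContactForm (H : ∀ p : B, Submodule ℝ (Tan (2 * m + 1) p))
    (θ : ∀ p : B, Tan (2 * m + 1) p →L[ℝ] ℝ) (V : Set B) : Prop :=
  SmoothOneForm θ V ∧ ∀ p ∈ V, (∀ X, X ∈ H p ↔ θ p X = 0) ∧
    ∀ X ∈ H p, (∀ Y ∈ H p, extDer θ p X Y = 0) → X = 0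

/-- The `i`-eigenspace `H^{(1,0)} = {X - i J X}` of `J` at `p`. -/
def AlmostCR.holo (S : AlmostCR m B) (p : B) : Set (CTan (2 * m + 1) p) :=
  {z | ∃ X : S.H p, z = cvec (X : Tan (2 * m + 1) p) (-(S.J p X : Tan (2 * m + 1) p))}

/-- `H` is a contact distribution. -/
def AlmostCR.IsContact (S : AlmostCR m B) : Prop :=
  ∀ p₀ : B, ∃ V : Set B, IsOpen V ∧ p₀ ∈ V ∧ ∃ θ, IsContactForm S.H θ V

/-- Partial integrability: the bracket of two sections `X + iY`, `X' + iY'` of `H^{(1,0)}` is a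
section of the complexification of `H`. -/
def AlmostCR.IsPartiallyIntegrable (S : AlmostCR m B) : Prop :=
  ∀ (V : Set B) (X Y X' Y' : ∀ p : B, Tan (2 * m + 1) p), IsOpen V →
    SmoothVF X V → SmoothVF Y V → SmoothVF X' V → SmoothVF Y' V →
    (∀ p ∈ V, cvec (X p) (Y p) ∈ S.holo p) → (∀ p ∈ V, cvec (X' p) (Y' p) ∈ S.holo p) →
    ∀ p ∈ V,
      cvec
        (VectorField.mlieBracket 𝓘(ℝ, Euc (2 * m + 1)) X X' p
          - VectorField.mlieBracket 𝓘(ℝ, Euc (2 * m + 1)) Y Y' p)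
        (VectorField.mlieBracket 𝓘(ℝ, Euc (2 * m + 1)) X Y' p
          + VectorField.mlieBracket 𝓘(ℝ, Euc (2 * m + 1)) Y X' p)
      ∈ (S.H p).baseChange ℂ

/-- Positive definite signature: around every point there is a contact form `θ` whose Levi form
`X ↦ dθ (X, J X)` is positive definite. -/
def AlmostCR.IsPositive (S : AlmostCR m B) : Prop :=
  ∀ p₀ : B, ∃ V : Set B, IsOpen V ∧ p₀ ∈ V ∧ ∃ θ, IsContactForm S.H θ V ∧
    ∀ p ∈ V, ∀ X : S.H p, X ≠ 0 → 0 < extDer θ p X (S.J p X)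

end CR

/-! ### Leaf spaces -/

section Leaf

variable {m : ℕ} {M : Type*} [TopologicalSpace M] [ChartedSpace (Euc (2 * m + 2)) M]
  [IsManifold 𝓘(ℝ, Euc (2 * m + 2)) ∞ M]
  (c : ConformalStructure (2 * m + 2) M) (K : ∀ x : M, Submodule ℝ (Tan (2 * m + 2) x))
  {B : Type*} [TopologicalSpace B] [ChartedSpace (Euc (2 * m + 1)) B]
  [IsManifold 𝓘(ℝ, Euc (2 * m + 1)) ∞ B]

/-- The differential of a map from `M` to the leaf space. -/
def leafDeriv (π : M → B) (x : M) : Tan (2 * m + 2) x →L[ℝ] Tan (2 * m + 1) (π x) :=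
  mfderiv 𝓘(ℝ, Euc (2 * m + 2)) 𝓘(ℝ, Euc (2 * m + 1)) π x

/-- `π : U → B` exhibits the manifold `B` as the leaf space of the curves tangent to `K` in the open
set `U`: it is a smooth surjective submersion whose fibres are connected and tangent to `K`, hence
are the leaves of `K` in `U`. -/
structure IsLeafSpace (U : Set M) (π : M → B) : Prop where
  isOpen : IsOpen U
  smooth : ContMDiffOn 𝓘(ℝ, Euc (2 * m + 2)) 𝓘(ℝ, Euc (2 * m + 1)) ∞ π U
  surjective_deriv : ∀ x ∈ U, Function.Surjective (leafDeriv (m := m) π x)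
  ker_deriv : ∀ x ∈ U, ∀ v : Tan (2 * m + 2) x, leafDeriv (m := m) π x v = 0 ↔ v ∈ K x
  fibres : ∀ p : B, IsConnected (U ∩ π ⁻¹' {p})

/-- The almost CR structure `S` on the leaf space is induced by the twist: `H` is the image of
`K^⊥`, and the twist of some optical vector field, turned into an endomorphism of `K^⊥ / K` by the
screen metric, descends to `J` under the isomorphism of `K^⊥ / K` with `H`. -/
def IsTwistInduced (U : Set M) (π : M → B) (S : AlmostCR m B) : Prop :=
  ∃ k : ∀ x : M, Tan (2 * m + 2) x, IsOpticalField K k U ∧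
    ∀ x ∈ U, (∀ Y, Y ∈ S.H (π x) ↔ ∃ v ∈ perp c K x, leafDeriv (m := m) π x v = Y) ∧
      ∃ J : Screen c K x →ₗ[ℝ] Screen c K x, IsTwistEndo c K k x J ∧
        ∀ v w : perp c K x, J (Submodule.Quotient.mk v) = Submodule.Quotient.mk w →
          ∃ h : leafDeriv (m := m) π x v ∈ S.H (π x),
            (S.J (π x) ⟨leafDeriv (m := m) π x v, h⟩ : Tan (2 * m + 1) (π x)) = leafDeriv (m := m) π x w

/-- The twist induces a partially integrable contact almost CR structure of positive definite
signature on the (local) leaf space of the congruence: every point has a neighbourhood `U` with a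
leaf space, and every leaf space of an open set `U` carries such an induced structure.  (A leaf
space is a second-countable manifold, so it has a copy in `Type`.) -/
def TwistInducesCR : Prop :=
  (∀ x : M, ∃ (B : Type) (_ : TopologicalSpace B) (_ : T2Space B)
    (_ : ChartedSpace (Euc (2 * m + 1)) B) (_ : IsManifold 𝓘(ℝ, Euc (2 * m + 1)) ∞ B)
    (U : Set M) (π : M → B), x ∈ U ∧ IsLeafSpace (m := m) K U π) ∧
  ∀ (B : Type) [TopologicalSpace B] [T2Space B] [ChartedSpace (Euc (2 * m + 1)) B]
    [IsManifold 𝓘(ℝ, Euc (2 * m + 1)) ∞ B] (U : Set M) (π : M → B),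
    IsLeafSpace (m := m) K U π →
      ∃ S : AlmostCR m B, IsTwistInduced c K U π S ∧
        S.IsContact ∧ S.IsPartiallyIntegrable ∧ S.IsPositive

end Leaf

end OpticalGeom

end

/-! Put `B u = ∇_u k`. Nullity gives `B u ⟂ k`, the geodesic property gives `∇_k k = l k`, and
without shear `B = φ + F` on the screen `K^⊥/K`, where `φ` is the expansion and `F` the skew
endomorphism of the twist. Differentiating along `k` gives `R(k,v)k = (∇_k B)v + B²v - l Bv` modulo
`K`, and pairing with `v` yields `g(k, R(k,v)v) = ρ g(v,v) + g(Fv,Fv)` with `ρ = -(k(φ) - lφ + φ²)`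
(`IsShearFreeNull.sachs`).

For null `k` and `v ⟂ k`, the component `W(k,v,k,v)` is the left side minus its pure trace part
(`weylFlat_null`, `ricci_null`). It therefore vanishes for all `v` exactly when `g(Fv,Fv) = a
g(v,v)` (`weylFlat_eq_zero_iff`), that is, when `F² = -a` on the screen. Twisting forces `a > 0`,
and `a` is smooth, so the global optical field given by the time orientation can be rescaled by
`a^(-1/2)` to reach `J² = -1` (`IsTwistingOptical.exists_unit_twist`). Conversely, a skew `J` with
`J² = -1` is an isometry, which returns the Weyl condition
(`IsTwistingOptical.weylCondition_of_endo`). Orthogonality of `J` makes the space of vectors `v +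
iJv` totally null, and a count of real dimensions gives its rank.

On the leaf space, geodesy says that `κ` is preserved along `k` up to a factor, and shear-freeness
says the same of `g` on `K^⊥`. Then `dκ` on `ker κ` scales like `κ`, so `F` changes along a leaf
only by a positive factor. Once `F` is an isometry this factor is 1 and `J` descends
(`IsTransported.baseRel_iff`, `IsUnitLeafSpace.leafRel_iff`). A local section `s` of the projection
gives the contact form `θ = s^*κ`, whose differential is twice the twist. Its Levi form is positive
because `g` is positive on the screen, and invariance of `dθ` under `J` is partial integrability,
since `θ([X,Y]) = -dθ(X,Y)` on `ker θ`. In the other direction, `J² = -1` lifts from the leaf space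
to the screen because the differential of the projection is injective there.

Leaf spaces come from flow boxes, hence from the smooth dependence of integral curves on their
initial points (`exists_smooth_flow`). -/

noncomputable section

namespace OpticalGeom

open Set Filter Topology

/-! ### Smooth local flows, by the inverse function theorem on a space of curves. -/

section Flow

universe u

/-- The inverse function theorem for smooth maps: a smooth map with invertible differential at a
point is a local diffeomorphism there. -/
theorem exists_smooth_localInverse {E F : Type*} [NormedAddCommGroup E] [NormedSpace ℝ E]
    [CompleteSpace E] [NormedAddCommGroup F] [NormedSpace ℝ F] {f : E → F} {s : Set E}
    (hs : IsOpen s) (hf : ContDiffOn ℝ ∞ f s) {a : E} (ha : a ∈ s) (f' : E ≃L[ℝ] F)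
    (hf' : HasFDerivAt f (f' : E →L[ℝ] F) a) :
    ∃ e : OpenPartialHomeomorph E F, a ∈ e.source ∧ e.source ⊆ s ∧ (∀ x, e x = f x) ∧
      ContDiffOn ℝ ∞ e.symm e.target ∧ ∀ x ∈ e.source, (fderiv ℝ f x).IsInvertible := by
  have hn : (∞ : WithTop ℕ∞) ≠ 0 := by simp
  have hfa : ContDiffAt ℝ ∞ f a := hf.contDiffAt (hs.mem_nhds ha)
  -- Invertibility of the differential is an open condition, so the source can be shrunk to points
  -- where it holds; smoothness of the inverse then follows point by point.
  set t : Set E := s ∩ fderiv ℝ f ⁻¹' range ((↑) : (E ≃L[ℝ] F) → E →L[ℝ] F)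
  have ht : IsOpen t :=
    (hf.continuousOn_fderiv_of_isOpen hs (by simp)).isOpen_inter_preimage hs
      ContinuousLinearEquiv.isOpen
  let e := (hfa.toOpenPartialHomeomorph f hf' hn).restrOpen t ht
  have hsrc : ∀ x ∈ e.source, x ∈ t := by
    intro x hx
    rw [OpenPartialHomeomorph.restrOpen_source] at hx
    exact hx.2
  refine ⟨e, ?_, fun x hx => (hsrc x hx).1, fun x => rfl, ?_, fun x hx => ?_⟩
  · rw [OpenPartialHomeomorph.restrOpen_source]
    exact ⟨hfa.mem_toOpenPartialHomeomorph_source hf' hn, ha, f', by rw [hf'.fderiv]⟩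
  · intro y hy
    obtain ⟨h1, g, hg⟩ := hsrc _ (e.map_target hy)
    have h2 : ContDiffAt ℝ ∞ f (e.symm y) := hf.contDiffAt (hs.mem_nhds h1)
    have h3 : HasFDerivAt f (g : E →L[ℝ] F) (e.symm y) := by
      rw [hg]; exact (h2.differentiableAt hn).hasFDerivAt
    exact (e.contDiffAt_symm hy h3 h2).contDiffWithinAt
  · obtain ⟨-, g, hg⟩ := hsrc x hx
    exact ⟨g, hg⟩

variable {X : Type*} [TopologicalSpace X] [CompactSpace X]

/-- The pointwise application of a continuous family of operators to a continuous map. -/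
def pointwiseApply (X : Type*) [TopologicalSpace X] [CompactSpace X]
    (E F : Type*) [NormedAddCommGroup E] [NormedSpace ℝ E]
    [NormedAddCommGroup F] [NormedSpace ℝ F] :
    C(X, E →L[ℝ] F) →L[ℝ] C(X, E) →L[ℝ] C(X, F) :=
  LinearMap.mkContinuous₂
    (LinearMap.mk₂ ℝ (fun (A : C(X, E →L[ℝ] F)) (γ : C(X, E)) =>
        (⟨fun t => A t (γ t), by fun_prop⟩ : C(X, F)))
      (fun _ _ _ => by ext; simp) (fun _ _ _ => by ext; simp)
      (fun _ _ _ => by ext; simp) (fun _ _ _ => by ext; simp)) 1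
    (fun A γ => by
      rw [one_mul]
      refine (ContinuousMap.norm_le _ (by positivity)).2 fun t => ?_
      exact ((A t).le_opNorm _).trans
        (mul_le_mul (A.norm_coe_le_norm t) (γ.norm_coe_le_norm t) (norm_nonneg (γ t)) (norm_nonneg A)))

/-- The mean value inequality is applied on the segment from `γ t` to `γ t + δ t` for each `t`.
Since `γ ↦ f' ∘ γ` is continuous for the sup norm, `X` being compact, one radius serves all `t`. -/
theorem hasFDerivAt_postcomp {E F : Type*} [NormedAddCommGroup E] [NormedSpace ℝ E]
    [NormedAddCommGroup F] [NormedSpace ℝ F] (f : C(E, F)) (f' : C(E, E →L[ℝ] F))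
    (hf : ∀ x, HasFDerivAt f (f' x) x) (γ : C(X, E)) :
    HasFDerivAt (fun γ : C(X, E) => f.comp γ) (pointwiseApply X E F (f'.comp γ)) γ := by
  rw [hasFDerivAt_iff_isLittleO_nhds_zero, Asymptotics.isLittleO_iff]
  intro ε hε
  have hcont : Continuous fun γ : C(X, E) => f'.comp γ := ContinuousMap.continuous_postcomp f'
  obtain ⟨r, hr, hball⟩ := Metric.continuousAt_iff (α := C(X, E)) (β := C(X, E →L[ℝ] F)) |>.1
    (hcont.continuousAt (x := γ)) ε hε
  filter_upwards [Metric.ball_mem_nhds (0 : C(X, E)) hr] with δ hδ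
  rw [ContinuousMap.norm_le _ (by positivity)]
  intro t
  have hδ' : ‖δ‖ < r := by simpa using hδ
  have key := Convex.norm_image_sub_le_of_norm_hasFDerivWithin_le'
    (f := f) (f' := f') (φ := f' (γ t)) (C := ε) (s := segment ℝ (γ t) (γ t + δ t))
    (x := γ t) (y := γ t + δ t)
    (fun x _ => (hf x).hasFDerivWithinAt)
    (by
      intro z hz
      rw [segment_eq_image'] at hz
      obtain ⟨θ, ⟨h0, h1⟩, rfl⟩ := hz
      have h2 : dist (γ + θ • δ) γ < r := by
        rw [dist_eq_norm, add_sub_cancel_left, norm_smul, Real.norm_of_nonneg h0]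
        exact (mul_le_of_le_one_left (norm_nonneg _) h1).trans_lt hδ'
      have h3 := (ContinuousMap.dist_apply_le_dist t).trans (hball h2).le
      rw [dist_eq_norm] at h3
      simpa using h3)
    (convex_segment _ _) (left_mem_segment _ _ _) (right_mem_segment _ _ _)
  have h5 : ‖δ t‖ ≤ ‖δ‖ := δ.norm_coe_le_norm t
  have h6 : ε * ‖δ t‖ ≤ ε * ‖δ‖ := by gcongr
  simp only [add_sub_cancel_left] at key
  exact key.trans h6

/-- Postcomposition with a smooth map is a smooth map between spaces of continuous maps. -/
theorem contDiff_postcomp {E : Type u} [NormedAddCommGroup E] [NormedSpace ℝ E] (n : ℕ) :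
    ∀ {F : Type u} [NormedAddCommGroup F] [NormedSpace ℝ F] (f : C(E, F)),
      ContDiff ℝ n f → ContDiff ℝ n (fun γ : C(X, E) => f.comp γ) := by
  induction n with
  | zero =>
    intro F _ _ f _
    exact contDiff_zero.2 (ContinuousMap.continuous_postcomp f)
  | succ n ih =>
    intro F _ _ f hf
    have hf1 : ContDiff ℝ ((n : WithTop ℕ∞) + 1) f := by exact_mod_cast hf
    rw [contDiff_succ_iff_fderiv] at hf1
    obtain ⟨hd, -, hf'⟩ := hf1
    -- The derivative of postcomposition with `f` is postcomposition with `f'` followed by the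
    -- continuous linear map `pointwiseApply`. The induction thus passes from `F` to `E →L[ℝ] F`,
    -- which is why `F` is quantified inside it and shares the universe of `E`.
    let f' : C(E, E →L[ℝ] F) := ⟨fderiv ℝ f, hf'.continuous⟩
    have hder : ∀ γ : C(X, E), HasFDerivAt (fun γ : C(X, E) => f.comp γ)
        (pointwiseApply X E F (f'.comp γ)) γ :=
      fun γ => hasFDerivAt_postcomp f f' (fun x => (hd x).hasFDerivAt) γ
    have : ContDiff ℝ ((n : WithTop ℕ∞) + 1) (fun γ : C(X, E) => f.comp γ) := by
      rw [contDiff_succ_iff_fderiv]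
      refine ⟨fun γ => (hder γ).differentiableAt, by simp, ?_⟩
      have h2 : fderiv ℝ (fun γ : C(X, E) => f.comp γ) =
          fun γ => pointwiseApply X E F (f'.comp γ) := funext fun γ => (hder γ).fderiv
      rw [h2]
      exact (pointwiseApply X E F).contDiff.comp (ih f' hf')
    exact_mod_cast this

/-- The primitive of a continuous curve on the unit interval. -/
def primitiveCLM (E : Type*) [NormedAddCommGroup E] [NormedSpace ℝ E] [CompleteSpace E] :
    C(Icc (0 : ℝ) 1, E) →L[ℝ] C(Icc (0 : ℝ) 1, E) :=
  LinearMap.mkContinuous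
    { toFun := fun γ => ⟨fun t => ∫ s in (0 : ℝ)..t, IccExtend zero_le_one γ s, by
        have h : Continuous (IccExtend (zero_le_one (α := ℝ)) γ) := γ.continuous.Icc_extend'
        exact (intervalIntegral.continuous_primitive (fun a b => h.intervalIntegrable a b) 0).comp
          continuous_subtype_val⟩
      map_add' := fun γ δ => by
        ext t
        have h1 : Continuous (IccExtend (zero_le_one (α := ℝ)) γ) := γ.continuous.Icc_extend'
        have h2 : Continuous (IccExtend (zero_le_one (α := ℝ)) δ) := δ.continuous.Icc_extend'
        exact intervalIntegral.integral_add (h1.intervalIntegrable _ _) (h2.intervalIntegrable _ _)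
      map_smul' := fun c γ => by
        ext t
        exact intervalIntegral.integral_smul c _ } 1
    (fun γ => by
      rw [one_mul, ContinuousMap.norm_le _ (norm_nonneg _)]
      intro t
      have := intervalIntegral.norm_integral_le_of_norm_le_const (a := (0 : ℝ)) (b := t)
        (C := ‖γ‖) (f := IccExtend zero_le_one γ) (fun s _ => γ.norm_coe_le_norm _)
      refine this.trans (mul_le_of_le_one_right (norm_nonneg _) ?_)
      rw [sub_zero, abs_of_nonneg t.2.1]
      exact t.2.2)

/-- Constant maps, as a continuous linear map. -/
def constCLM (X : Type*) [TopologicalSpace X] [CompactSpace X] (E : Type*) [NormedAddCommGroup E]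
    [NormedSpace ℝ E] : E →L[ℝ] C(X, E) :=
  LinearMap.mkContinuous
    { toFun := ContinuousMap.const X
      map_add' := fun _ _ => rfl
      map_smul' := fun _ _ => rfl } 1
    (fun x => by
      rw [one_mul, ContinuousMap.norm_le _ (norm_nonneg _)]
      exact fun _ => le_rfl)

/-- A smooth vector field has a smooth local flow. -/
theorem exists_smooth_flow {E : Type u} [NormedAddCommGroup E] [NormedSpace ℝ E] [CompleteSpace E]
    {f : E → E} (hf : ContDiff ℝ ∞ f) (x₀ : E) :
    ∃ (W : Set (E × ℝ)) (Φ : E × ℝ → E), IsOpen W ∧ (x₀, (0 : ℝ)) ∈ W ∧ ContDiffOn ℝ ∞ Φ W ∧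
      (∀ x, (x, (0 : ℝ)) ∈ W → Φ (x, 0) = x) ∧
      ∀ p ∈ W, HasDerivAt (fun t => Φ (p.1, t)) (f (Φ p)) p.2 := by
  let I := Icc (0 : ℝ) 1
  let fC : C(E, E) := ⟨f, hf.continuous⟩
  let J := primitiveCLM E
  let c := constCLM I E
  let Nf : C(I, E) → C(I, E) := fun γ => fC.comp γ
  have hN : ContDiff ℝ ∞ Nf := contDiff_infty.2 fun n =>
    contDiff_postcomp n fC (contDiff_infty.1 hf n)
  -- With time rescaled to the unit interval, the integral curve from `x` up to time `t` solves `γ =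
  -- x + t ∫ f ∘ γ`: it is the zero in `γ` of the last component of `Ξ`.
  let Ξ : (E × ℝ) × C(I, E) → (E × ℝ) × C(I, E) := fun p =>
    (p.1, p.2 - c p.1.1 - p.1.2 • J (Nf p.2))
  have hΞ : ContDiff ℝ ∞ Ξ := by
    have h1 : ContDiff ℝ ∞ fun p : (E × ℝ) × C(I, E) => J (Nf p.2) :=
      J.contDiff.comp (hN.comp contDiff_snd)
    have h2 : ContDiff ℝ ∞ fun p : (E × ℝ) × C(I, E) => c p.1.1 :=
      c.contDiff.comp (contDiff_fst.comp contDiff_fst)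
    exact contDiff_fst.prodMk ((contDiff_snd.sub h2).sub
      ((contDiff_snd.comp contDiff_fst).smul h1))
  -- At `t = 0` the integral term only contributes its value `v₀` through the derivative in `t`, so
  -- the differential of `Ξ` is the shear `(p, δ) ↦ (p, δ - S p)`, visibly invertible.
  let v₀ : C(I, E) := J (Nf (c x₀))
  let S : (E × ℝ) →L[ℝ] C(I, E) :=
    c.comp (ContinuousLinearMap.fst ℝ E ℝ) +
      (ContinuousLinearMap.snd ℝ E ℝ).smulRight v₀
  let D : ((E × ℝ) × C(I, E)) ≃L[ℝ] ((E × ℝ) × C(I, E)) :=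
    ContinuousLinearEquiv.equivOfInverse
      ((ContinuousLinearMap.fst ℝ (E × ℝ) C(I, E)).prod
        (ContinuousLinearMap.snd ℝ (E × ℝ) C(I, E) -
          S.comp (ContinuousLinearMap.fst ℝ (E × ℝ) C(I, E))))
      ((ContinuousLinearMap.fst ℝ (E × ℝ) C(I, E)).prod
        (ContinuousLinearMap.snd ℝ (E × ℝ) C(I, E) +
          S.comp (ContinuousLinearMap.fst ℝ (E × ℝ) C(I, E))))
      (fun p => by simp) (fun p => by simp)
  have hD : HasFDerivAt Ξ (D : _ →L[ℝ] _) ((x₀, (0 : ℝ)), c x₀) := by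
    have h1 : HasFDerivAt (fun p : (E × ℝ) × C(I, E) => J (Nf p.2))
        (fderiv ℝ (fun p : (E × ℝ) × C(I, E) => J (Nf p.2)) ((x₀, (0 : ℝ)), c x₀))
        ((x₀, (0 : ℝ)), c x₀) :=
      ((J.contDiff.comp (hN.comp contDiff_snd)).differentiable (by simp)).differentiableAt.hasFDerivAt
    have h2 : HasFDerivAt (fun p : (E × ℝ) × C(I, E) => p.1.2)
        ((ContinuousLinearMap.snd ℝ E ℝ).comp (ContinuousLinearMap.fst ℝ (E × ℝ) C(I, E)))
        ((x₀, (0 : ℝ)), c x₀) :=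
      ((ContinuousLinearMap.snd ℝ E ℝ).comp
        (ContinuousLinearMap.fst ℝ (E × ℝ) C(I, E))).hasFDerivAt
    have h3 : HasFDerivAt (fun p : (E × ℝ) × C(I, E) => c p.1.1)
        (c.comp ((ContinuousLinearMap.fst ℝ E ℝ).comp (ContinuousLinearMap.fst ℝ (E × ℝ) C(I, E))))
        ((x₀, (0 : ℝ)), c x₀) :=
      (c.comp ((ContinuousLinearMap.fst ℝ E ℝ).comp
        (ContinuousLinearMap.fst ℝ (E × ℝ) C(I, E)))).hasFDerivAt
    have h4 := (hasFDerivAt_fst (𝕜 := ℝ) (p := (((x₀, (0 : ℝ)), c x₀) : (E × ℝ) × C(I, E)))).prodMk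
      ((hasFDerivAt_snd.sub h3).sub (h2.smul h1))
    refine h4.congr_fderiv ?_
    ext p <;> simp [D, S, v₀]
  obtain ⟨e, ha, -, he, hsymm, -⟩ :=
    exists_smooth_localInverse isOpen_univ hΞ.contDiffOn (mem_univ _) D hD
  have h0 : Ξ ((x₀, (0 : ℝ)), c x₀) = ((x₀, (0 : ℝ)), 0) := by simp [Ξ]
  have ht0 : (((x₀, (0 : ℝ)), (0 : C(I, E)))) ∈ e.target := by
    rw [← h0, ← he]; exact e.map_source ha
  have hs0 : e.symm ((x₀, (0 : ℝ)), 0) = ((x₀, (0 : ℝ)), c x₀) := by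
    rw [← h0, ← he]; exact e.left_inv ha
  let γ : E × ℝ → C(I, E) := fun q => (e.symm (q, 0)).2
  let W₀ : Set (E × ℝ) := {q | (q, (0 : C(I, E))) ∈ e.target}
  have hW₀ : IsOpen W₀ := e.open_target.preimage (by fun_prop)
  have hγ : ContDiffOn ℝ ∞ γ W₀ :=
    contDiff_snd.comp_contDiffOn (hsymm.comp (by fun_prop : ContDiffOn ℝ ∞
      (fun q : E × ℝ => (q, (0 : C(I, E)))) W₀) fun q hq => hq)
  obtain ⟨r, hr, hball⟩ := Metric.isOpen_iff.1 e.open_source _ ha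
  have hγ0 : γ (x₀, 0) = c x₀ := by simp only [γ, hs0]
  have hcont : ContinuousAt γ (x₀, 0) := (hγ.continuousOn).continuousAt (hW₀.mem_nhds ht0)
  obtain ⟨ρ₁, hρ₁, hb₁⟩ := Metric.continuousAt_iff.1 hcont r hr
  obtain ⟨ρ₂, hρ₂, hb₂⟩ := Metric.isOpen_iff.1 hW₀ _ ht0
  -- The three bounds keep the parameters inside the source of `e`, keep the solution curve
  -- `r`-close to the constant curve `x₀`, and keep the parameters where the solution is defined.
  let ρ := min r (min ρ₁ ρ₂)
  have hρ : 0 < ρ := lt_min hr (lt_min hρ₁ hρ₂)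
  let W : Set (E × ℝ) := Metric.ball (x₀, 0) ρ
  have hWW₀ : W ⊆ W₀ := (Metric.ball_subset_ball ((min_le_right _ _).trans (min_le_right _ _))).trans hb₂
  have hWγ : ∀ q ∈ W, dist (γ q) (c x₀) < r := fun q hq => by
    rw [← hγ0]
    exact hb₁ ((Metric.mem_ball.1 hq).trans_le ((min_le_right _ _).trans (min_le_left _ _)))
  have hmem : ∀ x t, (x, t) ∈ W ↔ dist x x₀ < ρ ∧ |t| < ρ := by
    intro x t
    simp [W, Prod.dist_eq]
  have heq : ∀ q ∈ W, γ q = c q.1 + q.2 • J (Nf (γ q)) := by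
    intro q hq
    have h1 := e.right_inv (hWW₀ hq : (q, (0 : C(I, E))) ∈ e.target)
    rw [he] at h1
    have h2 : (e.symm (q, 0)).1 = q := congrArg Prod.fst h1
    have h3 : γ q - c (e.symm (q, 0)).1.1 - (e.symm (q, 0)).1.2 • J (Nf (γ q)) = 0 :=
      congrArg Prod.snd h1
    rw [h2, sub_sub, sub_eq_zero] at h3
    exact h3
  let one : I := ⟨1, by simp [I]⟩
  have heqt : ∀ q ∈ W, ∀ s : I, γ q s = q.1 + q.2 • ∫ u in (0 : ℝ)..s,
      f (IccExtend zero_le_one (γ q) u) := by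
    intro q hq s
    conv_lhs => rw [heq q hq]
    rfl
  -- Uniqueness, from injectivity of `Ξ` on the source of `e`: the curve `s ↦ γ (x, t) (σ s)` solves
  -- the equation for time `σ t`, so it is `γ (x, σ t)`. Hence the endpoints `γ (x, t) 1` trace out
  -- the integral curve as `t` varies.
  have hscale : ∀ x t, (x, t) ∈ W → ∀ σ : I, γ (x, σ * t) one = γ (x, t) σ := by
    intro x t hq σ
    have hσ0 := σ.2.1
    have hσ1 := σ.2.2
    let δ : C(I, E) := ⟨fun s => γ (x, t) ⟨σ * s, mul_nonneg hσ0 s.2.1, mul_le_one₀ hσ1 s.2.1 s.2.2⟩,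
      by fun_prop⟩
    have hq' : (x, (σ : ℝ) * t) ∈ W := by
      rw [hmem] at hq ⊢
      refine ⟨hq.1, ?_⟩
      rw [abs_mul, abs_of_nonneg hσ0]
      exact (mul_le_of_le_one_left (abs_nonneg _) hσ1).trans_lt hq.2
    have hδ : dist δ (c x₀) < r := by
      refine lt_of_le_of_lt ((ContinuousMap.dist_le dist_nonneg).2 fun s => ?_) (hWγ _ hq)
      exact ContinuousMap.dist_apply_le_dist (f := γ (x, t)) (g := c x₀) _
    have hsrc : ((x, (σ : ℝ) * t), δ) ∈ e.source := by
      apply hball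
      rw [Metric.mem_ball, Prod.dist_eq]
      exact max_lt ((Metric.mem_ball.1 hq').trans_le (min_le_left _ _)) hδ
    have hδeq : Ξ ((x, (σ : ℝ) * t), δ) = ((x, (σ : ℝ) * t), 0) := by
      refine Prod.ext rfl ?_
      change δ - c x - ((σ : ℝ) * t) • J (Nf δ) = 0
      rw [sub_sub, sub_eq_zero]
      ext s
      have h1 := heqt _ hq ⟨σ * s, mul_nonneg hσ0 s.2.1, mul_le_one₀ hσ1 s.2.1 s.2.2⟩
      change γ (x, t) _ = x + ((σ : ℝ) * t) • ∫ u in (0 : ℝ)..s, f (IccExtend zero_le_one δ u)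
      rw [h1]
      congr 1
      rw [mul_comm (σ : ℝ) t, mul_smul]
      congr 1
      have h2 := intervalIntegral.smul_integral_comp_mul_left (a := 0) (b := (s : ℝ))
        (fun u => f (IccExtend zero_le_one (γ (x, t)) u)) (σ : ℝ)
      rw [mul_zero] at h2
      rw [← h2]
      congr 1
      refine intervalIntegral.integral_congr fun u hu => ?_
      rw [uIcc_of_le s.2.1] at hu
      have hu1 : u ∈ Icc (0 : ℝ) 1 := ⟨hu.1, hu.2.trans s.2.2⟩
      have hu2 : (σ : ℝ) * u ∈ Icc (0 : ℝ) 1 :=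
        ⟨mul_nonneg hσ0 hu1.1, mul_le_one₀ hσ1 hu1.1 hu1.2⟩
      simp only [IccExtend_of_mem _ _ hu1, IccExtend_of_mem _ _ hu2]
      rfl
    have h5 : e.symm ((x, (σ : ℝ) * t), 0) = ((x, (σ : ℝ) * t), δ) := by
      rw [← hδeq, ← he]; exact e.left_inv hsrc
    have h6 : γ (x, (σ : ℝ) * t) = δ := congrArg Prod.snd h5
    rw [h6]
    change γ (x, t) _ = _
    congr 1
    exact Subtype.ext (mul_one _)
  let Φ : E × ℝ → E := fun q => γ q one
  have hΦ : ContDiffOn ℝ ∞ Φ W :=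
    (ContinuousMap.evalCLM ℝ one : C(I, E) →L[ℝ] E).contDiff.comp_contDiffOn (hγ.mono hWW₀)
  have hint : ∀ x t, (x, t) ∈ W → Φ (x, t) = x + ∫ u in (0 : ℝ)..t, f (Φ (x, u)) := by
    intro x t hq
    have h1 := heqt _ hq one
    have h2 := intervalIntegral.smul_integral_comp_mul_left (a := 0) (b := 1)
      (fun u => f (Φ (x, u))) t
    rw [mul_zero, mul_one] at h2
    rw [← h2]
    change γ (x, t) one = _
    rw [h1]
    congr 2
    refine intervalIntegral.integral_congr fun u hu => ?_
    rw [uIcc_of_le zero_le_one] at hu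
    change f (IccExtend zero_le_one (γ (x, t)) u) = f (γ (x, t * u) one)
    rw [IccExtend_of_mem _ _ hu, mul_comm, ← hscale x t hq ⟨u, hu⟩]
  have hW : IsOpen W := Metric.isOpen_ball
  refine ⟨W, Φ, hW, Metric.mem_ball_self hρ, hΦ, fun x hx => ?_, ?_⟩
  · rw [hint x 0 hx]; simp
  · rintro ⟨x, t⟩ hq
    have hx : dist x x₀ < ρ := ((hmem x t).1 hq).1
    have ht : |t| < ρ := ((hmem x t).1 hq).2
    have hcx : ContinuousOn (fun u => f (Φ (x, u))) (Ioo (-ρ) ρ) :=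
      hf.continuous.comp_continuousOn (hΦ.continuousOn.comp (by fun_prop)
        fun u hu => (hmem x u).2 ⟨hx, abs_lt.2 hu⟩)
    have htm : t ∈ Ioo (-ρ) ρ := abs_lt.1 ht
    have hnhds : Ioo (-ρ) ρ ∈ 𝓝 t := isOpen_Ioo.mem_nhds htm
    have h0m : (0 : ℝ) ∈ Ioo (-ρ) ρ := ⟨by linarith, hρ⟩
    have hsub : uIcc 0 t ⊆ Ioo (-ρ) ρ := (ordConnected_Ioo).uIcc_subset h0m htm
    have h1 : HasDerivAt (fun t => x + ∫ u in (0 : ℝ)..t, f (Φ (x, u))) (f (Φ (x, t))) t :=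
      (intervalIntegral.integral_hasDerivAt_right ((hcx.mono hsub).intervalIntegrable)
        (hcx.stronglyMeasurableAtFilter isOpen_Ioo t htm) (hcx.continuousAt hnhds)).const_add x
    refine h1.congr_of_eventuallyEq ?_
    filter_upwards [hnhds] with u hu
    exact hint x u ((hmem x u).2 ⟨hx, abs_lt.2 hu⟩)

end Flow

/-! ### Exterior derivative on a normed space. -/

section FlatForms

variable {E F : Type*} [NormedAddCommGroup E] [NormedSpace ℝ E] [NormedAddCommGroup F]
  [NormedSpace ℝ F]

/-- The exterior derivative of a `1`-form on a normed space. -/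
def extDerFlat (α : E → E →L[ℝ] ℝ) (y u v : E) : ℝ :=
  fderiv ℝ α y u v - fderiv ℝ α y v u

/-- The pullback of a `1`-form on a normed space. -/
def pullForm (f : E → F) (α : F → F →L[ℝ] ℝ) (y : E) : E →L[ℝ] ℝ :=
  (α (f y)).comp (fderiv ℝ f y)

/-- Differentiating the factor `Df` of the pullback contributes `α(D²f(u,v)) - α(D²f(v,u))`, zero by
symmetry of the second derivative. -/
theorem extDerFlat_pullForm {f : E → F} {α : F → F →L[ℝ] ℝ} {y : E} (hf : ContDiffAt ℝ 2 f y)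
    (hα : DifferentiableAt ℝ α (f y)) (u v : E) :
    extDerFlat (pullForm f α) y u v = extDerFlat α (f y) (fderiv ℝ f y u) (fderiv ℝ f y v) := by
  have hf1 : DifferentiableAt ℝ f y := hf.differentiableAt (by simp)
  have hf2 : DifferentiableAt ℝ (fderiv ℝ f) y :=
    (hf.fderiv_right (m := 1) (by norm_num)).differentiableAt (by simp)
  have h := (hα.hasFDerivAt.comp y hf1.hasFDerivAt).clm_comp hf2.hasFDerivAt
  have h' : HasFDerivAt (pullForm f α) _ y := h
  have hsymm : fderiv ℝ (fderiv ℝ f) y u v = fderiv ℝ (fderiv ℝ f) y v u :=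
    (hf.isSymmSndFDerivAt (by simp)).eq u v
  rw [extDerFlat, extDerFlat, h'.fderiv]
  simp [hsymm]

theorem extDerFlat_congr {α β : E → E →L[ℝ] ℝ} {y : E} (h : α =ᶠ[𝓝 y] β) (u v : E) :
    extDerFlat α y u v = extDerFlat β y u v := by
  rw [extDerFlat, extDerFlat, h.fderiv_eq]

/-- In `d(fα) = df ∧ α + f dα` the first term vanishes on the kernel of `α`. This is the reason why
the twist on `K^⊥` is merely rescaled when `k` or the metric is. -/
theorem extDerFlat_smul {α : E → E →L[ℝ] ℝ} {f : E → ℝ} {y : E} (hf : DifferentiableAt ℝ f y)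
    (hα : DifferentiableAt ℝ α y) {u v : E} (hu : α y u = 0) (hv : α y v = 0) :
    extDerFlat (fun z => f z • α z) y u v = f y * extDerFlat α y u v := by
  have h := (hf.hasFDerivAt.smul hα.hasFDerivAt).fderiv
  have h' : fderiv ℝ (fun z => f z • α z) y = _ := h
  rw [extDerFlat, extDerFlat, h']
  simp [hu, hv]
  ring

theorem extDerFlat_swap (α : E → E →L[ℝ] ℝ) (y u v : E) :
    extDerFlat α y u v = - extDerFlat α y v u := by
  rw [extDerFlat, extDerFlat]; ring

theorem self_apply_inverse {A : E →L[ℝ] F} (hA : A.IsInvertible) (w : F) :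
    A (A.inverse w) = w := by
  obtain ⟨e, rfl⟩ := hA
  simp

theorem inverse_apply_eq_iff {A : E →L[ℝ] F} (hA : A.IsInvertible) (w : F) (u : E) :
    A.inverse w = u ↔ w = A u := by
  obtain ⟨e, rfl⟩ := hA
  simp [ContinuousLinearEquiv.symm_apply_eq]

end FlatForms

/-! ### Vector fields, forms and metrics in charts. -/

section Charts

variable {d : ℕ} {M : Type*} [TopologicalSpace M] [ChartedSpace (Euc d) M]

/-- The chart at `x₀`. -/
abbrev chrt (x₀ : M) : PartialEquiv M (Euc d) := extChartAt 𝓘(ℝ, Euc d) x₀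

/-- The part of the image of the chart at `x₀` that lies over `V`. -/
def chartDom (x₀ : M) (V : Set M) : Set (Euc d) := (chrt x₀).target ∩ (chrt x₀).symm ⁻¹' V

theorem isOpen_chartDom (x₀ : M) {V : Set M} (hV : IsOpen V) : IsOpen (chartDom (d := d) x₀ V) :=
  (continuousOn_extChartAt_symm x₀).isOpen_inter_preimage (isOpen_extChartAt_target x₀) hV

theorem chrt_mem_chartDom {x₀ x : M} {V : Set M} (hx : x ∈ (chrt (d := d) x₀).source)
    (hxV : x ∈ V) : chrt (d := d) x₀ x ∈ chartDom (d := d) x₀ V :=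
  ⟨(chrt x₀).map_source hx, by rwa [mem_preimage, (chrt x₀).left_inv hx]⟩

theorem coord_mem_chartDom {x : M} {V : Set M} (hxV : x ∈ V) :
    coord x ∈ chartDom (d := d) x V :=
  chrt_mem_chartDom (mem_extChartAt_source x) hxV

theorem chartDom_mono (x₀ : M) {V V' : Set M} (h : V ⊆ V') :
    chartDom (d := d) x₀ V ⊆ chartDom x₀ V' :=
  inter_subset_inter_right _ (preimage_mono h)

theorem symm_coord (x : M) : (chrt (d := d) x).symm (coord x) = x := extChartAt_to_inv x

theorem tensorInChart_apply (g : ∀ x : M, Tan d x →L[ℝ] Tan d x →L[ℝ] ℝ) (x₀ : M) (y u v : Euc d) :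
    tensorInChart g x₀ y u v = g ((chrt (d := d) x₀).symm y) (chartInvDeriv x₀ y u)
      (chartInvDeriv x₀ y v) := rfl

theorem formInChart_apply (α : ∀ x : M, Tan d x →L[ℝ] ℝ) (x₀ : M) (y u : Euc d) :
    formInChart α x₀ y u = α ((chrt (d := d) x₀).symm y) (chartInvDeriv x₀ y u) := rfl

variable [IsManifold 𝓘(ℝ, Euc d) ∞ M]

theorem isInvertible_chartInvDeriv {x₀ : M} {y : Euc d} (hy : y ∈ (chrt (d := d) x₀).target) :
    (chartInvDeriv x₀ y).IsInvertible := by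
  have h := isInvertible_mfderivWithin_extChartAt_symm (I := 𝓘(ℝ, Euc d)) hy
  rwa [ModelWithCorners.range_eq_univ, mfderivWithin_univ] at h

theorem chartInvDeriv_coord (x : M) (u : Euc d) : chartInvDeriv x (coord (d := d) x) u = u := by
  have h := mfderivWithin_range_extChartAt_symm (I := 𝓘(ℝ, Euc d)) (x := x)
  rw [ModelWithCorners.range_eq_univ, mfderivWithin_univ] at h
  exact congrArg (fun A : Euc d →L[ℝ] Euc d => A u) h

theorem contMDiffAt_chrt_symm {x₀ : M} {y : Euc d} (hy : y ∈ (chrt (d := d) x₀).target) :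
    ContMDiffAt 𝓘(ℝ, Euc d) 𝓘(ℝ, Euc d) ∞ (chrt (d := d) x₀).symm y :=
  (contMDiffOn_extChartAt_symm x₀).contMDiffAt ((isOpen_extChartAt_target x₀).mem_nhds hy)

theorem contMDiffAt_chrt {x₀ x : M} (hx : x ∈ (chrt (d := d) x₀).source) :
    ContMDiffAt 𝓘(ℝ, Euc d) 𝓘(ℝ, Euc d) ∞ (chrt (d := d) x₀) x :=
  contMDiffAt_extChartAt' (by rwa [← extChartAt_source 𝓘(ℝ, Euc d)])

theorem hasMFDerivAt_chrt_symm {x₀ : M} {y : Euc d} (hy : y ∈ (chrt (d := d) x₀).target) :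
    HasMFDerivAt 𝓘(ℝ, Euc d) 𝓘(ℝ, Euc d) (chrt (d := d) x₀).symm y (chartInvDeriv x₀ y) :=
  ((contMDiffAt_chrt_symm hy).mdifferentiableAt (by simp)).hasMFDerivAt

theorem mfderiv_chrt_inverse {x₀ : M} {y : Euc d} (hy : y ∈ (chrt (d := d) x₀).target)
    (u : Euc d) : (mfderiv 𝓘(ℝ, Euc d) 𝓘(ℝ, Euc d) (chrt (d := d) x₀)
      ((chrt (d := d) x₀).symm y)).inverse u = chartInvDeriv x₀ y u := by
  have h1 := mfderiv_extChartAt_comp_mfderivWithin_extChartAt_symm (I := 𝓘(ℝ, Euc d)) hy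
  have h2 := mfderivWithin_extChartAt_symm_comp_mfderiv_extChartAt (I := 𝓘(ℝ, Euc d)) hy
  rw [ModelWithCorners.range_eq_univ, mfderivWithin_univ] at h1 h2
  exact congrArg (fun A : Euc d →L[ℝ] Euc d => A u) (ContinuousLinearMap.inverse_eq h1 h2)

/-- The vector field that a map `Euc d → Euc d` represents in the chart at `x₀`. -/
def chartVF (x₀ : M) (X : Euc d → Euc d) (x : M) : Tan d x :=
  VectorField.mpullback 𝓘(ℝ, Euc d) 𝓘(ℝ, Euc d) (chrt (d := d) x₀) (fun y => X y) x

theorem chartVF_symm {x₀ : M} {y : Euc d} (hy : y ∈ (chrt (d := d) x₀).target)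
    (X : Euc d → Euc d) :
    chartVF x₀ X ((chrt (d := d) x₀).symm y) = chartInvDeriv x₀ y (X y) := by
  let A : Euc d →L[ℝ] Euc d := (mfderiv 𝓘(ℝ, Euc d) 𝓘(ℝ, Euc d) (chrt (d := d) x₀)
    ((chrt (d := d) x₀).symm y)).inverse
  exact (congrArg (fun z => A (X z)) ((chrt x₀).right_inv hy)).trans (mfderiv_chrt_inverse hy (X y))

theorem smoothVF_chartVF {x₀ : M} {X : Euc d → Euc d} {V : Set M} (hV : IsOpen V)
    (hVs : V ⊆ (chrt (d := d) x₀).source) (hX : ContDiffOn ℝ ∞ X (chartDom x₀ V)) :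
    SmoothVF (chartVF x₀ X) V := by
  intro x hx
  have h1 : ContDiffAt ℝ ∞ X (chrt (d := d) x₀ x) :=
    hX.contDiffAt ((isOpen_chartDom x₀ hV).mem_nhds (chrt_mem_chartDom (hVs hx) hx))
  have h2 := contMDiffAt_vectorSpace_iff_contDiffAt (V := fun y : Euc d => X y) |>.2 h1
  exact (ContMDiffAt.mpullback_vectorField_preimage (n := ∞) h2 (contMDiffAt_chrt (hVs hx))
    (isInvertible_mfderiv_extChartAt (hVs hx)) (by simp)).contMDiffWithinAt

theorem contDiffOn_vfInChart {X : ∀ x : M, Tan d x} {V : Set M} (hV : IsOpen V)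
    (hX : SmoothVF X V) (x₀ : M) : ContDiffOn ℝ ∞ (vfInChart X x₀) (chartDom x₀ V) := by
  intro y hy
  have h1 : ContMDiffAt 𝓘(ℝ, Euc d) 𝓘(ℝ, Euc d).tangent ∞
    (fun x => (⟨x, X x⟩ : TangentBundle 𝓘(ℝ, Euc d) M)) ((chrt (d := d) x₀).symm y) :=
    hX.contMDiffAt (hV.mem_nhds hy.2)
  have h2 := ContMDiffAt.mpullback_vectorField_preimage (n := ∞) h1 (contMDiffAt_chrt_symm hy.1)
    (isInvertible_chartInvDeriv hy.1) (by simp)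
  exact (contMDiffAt_vectorSpace_iff_contDiffAt.1 h2).contDiffWithinAt

theorem chartInvDeriv_vfInChart (X : ∀ x : M, Tan d x) {x₀ : M} {y : Euc d}
    (hy : y ∈ (chrt (d := d) x₀).target) :
    chartInvDeriv x₀ y (vfInChart X x₀ y) = X ((chrt (d := d) x₀).symm y) := by
  exact self_apply_inverse (E := Euc d) (F := Euc d) (isInvertible_chartInvDeriv hy) _

theorem vfInChart_eq_iff (X : ∀ x : M, Tan d x) {x₀ : M} {y : Euc d}
    (hy : y ∈ (chrt (d := d) x₀).target) (u : Euc d) :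
    vfInChart X x₀ y = u ↔ X ((chrt (d := d) x₀).symm y) = chartInvDeriv x₀ y u := by
  exact inverse_apply_eq_iff (E := Euc d) (F := Euc d) (isInvertible_chartInvDeriv hy) _ _

theorem vfInChart_chartVF {x₀ : M} {y : Euc d} (hy : y ∈ (chrt (d := d) x₀).target)
    (X : Euc d → Euc d) : vfInChart (chartVF x₀ X) x₀ y = X y :=
  (vfInChart_eq_iff _ hy _).2 (chartVF_symm hy X)

theorem vfInChart_coord (X : ∀ x : M, Tan d x) (x : M) : vfInChart X x (coord x) = X x := by
  have h := chartInvDeriv_vfInChart X (mem_extChartAt_target (I := 𝓘(ℝ, Euc d)) x)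
  rw [show extChartAt 𝓘(ℝ, Euc d) x x = coord x from rfl, chartInvDeriv_coord, symm_coord] at h
  exact h

/-- A vector field is smooth if it is so in suitable charts. -/
theorem smoothVF_of_chart {X : ∀ x : M, Tan d x} {V : Set M}
    (h : ∀ x ∈ V, ∃ x₀ : M, ∃ W : Set M, IsOpen W ∧ x ∈ W ∧ W ⊆ (chrt (d := d) x₀).source ∧
      ContDiffOn ℝ ∞ (vfInChart X x₀) (chartDom x₀ W)) : SmoothVF X V := by
  intro x hx
  obtain ⟨x₀, W, hW, hxW, hWs, hc⟩ := h x hx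
  have h1 := (smoothVF_chartVF hW hWs hc).contMDiffAt (hW.mem_nhds hxW)
  refine (h1.congr_of_eventuallyEq ?_).contMDiffWithinAt
  filter_upwards [hW.mem_nhds hxW] with z hz
  have h2 := chartVF_symm ((chrt x₀).map_source (hWs hz)) (vfInChart X x₀)
  rw [chartInvDeriv_vfInChart X ((chrt x₀).map_source (hWs hz)), (chrt x₀).left_inv (hWs hz)] at h2
  rw [h2]

theorem contDiffOn_of_symm {f : M → ℝ} {V : Set M} {x₀ : M}
    (hf : ContMDiffOn 𝓘(ℝ, Euc d) 𝓘(ℝ, ℝ) ∞ f V) :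
    ContDiffOn ℝ ∞ (fun y => f ((chrt (d := d) x₀).symm y)) (chartDom x₀ V) := by
  rw [← contMDiffOn_iff_contDiffOn]
  exact hf.comp ((contMDiffOn_extChartAt_symm x₀).mono inter_subset_left) fun y hy => hy.2

theorem chartInvDeriv_apply_eq_chartVF {x₀ : M} {y : Euc d} (hy : y ∈ (chrt (d := d) x₀).target)
    (u : Euc d) : chartInvDeriv x₀ y u = chartVF x₀ (fun _ => u) ((chrt (d := d) x₀).symm y) :=
  (chartVF_symm hy fun _ => u).symm

theorem contDiffOn_formInChart {α : ∀ x : M, Tan d x →L[ℝ] ℝ} {V : Set M} (hV : IsOpen V)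
    (hα : SmoothOneForm α V) (x₀ : M) : ContDiffOn ℝ ∞ (formInChart α x₀) (chartDom x₀ V) := by
  -- By finite dimension it suffices to test on fixed vectors `u`, that is, to evaluate `α` on the
  -- coordinate fields `chartVF x₀ (fun _ => u)`.
  rw [contDiffOn_clm_apply]
  intro u
  have hsrc : IsOpen (chrt (d := d) x₀).source := isOpen_extChartAt_source x₀
  have hX : SmoothVF (chartVF x₀ fun _ => u) (V ∩ (chrt (d := d) x₀).source) :=
    smoothVF_chartVF (hV.inter hsrc) inter_subset_right contDiffOn_const
  have h1 : ContMDiffOn 𝓘(ℝ, Euc d) 𝓘(ℝ, ℝ) ∞ (fun x => α x (chartVF x₀ (fun _ => u) x))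
      (V ∩ (chrt (d := d) x₀).source) := by
    intro x hx
    have h2 := ContMDiffAt.clm_bundle_apply
      (hα.contMDiffAt (hV.mem_nhds hx.1)) (hX.contMDiffAt ((hV.inter hsrc).mem_nhds hx))
    simp only [Bundle.contMDiffAt_totalSpace] at h2
    exact h2.2.contMDiffWithinAt
  refine ((contDiffOn_of_symm (x₀ := x₀) h1).mono fun y hy =>
    ⟨hy.1, hy.2, (chrt x₀).map_target hy.1⟩).congr fun y hy => ?_
  change α _ (chartInvDeriv x₀ y u) = _
  rw [chartInvDeriv_apply_eq_chartVF hy.1]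

theorem contDiffOn_tensorInChart (g : LorentzMetric d M) (x₀ : M) :
    ContDiffOn ℝ ∞ (tensorInChart g.val x₀) (chrt (d := d) x₀).target := by
  rw [contDiffOn_clm_apply]
  intro u
  rw [contDiffOn_clm_apply]
  intro v
  have hsrc : IsOpen (chrt (d := d) x₀).source := isOpen_extChartAt_source x₀
  have hX : ∀ u : Euc d, SmoothVF (chartVF x₀ fun _ => u) (chrt (d := d) x₀).source := fun u =>
    smoothVF_chartVF hsrc subset_rfl contDiffOn_const
  have h1 : ContMDiffOn 𝓘(ℝ, Euc d) 𝓘(ℝ, ℝ) ∞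
      (fun x => g.val x (chartVF x₀ (fun _ => u) x) (chartVF x₀ (fun _ => v) x))
      (chrt (d := d) x₀).source := by
    intro x hx
    have h2 := ContMDiffAt.clm_bundle_apply₂ (F₁ := Euc d) (F₂ := Euc d) (F₃ := ℝ)
      (E₃ := fun _ : M => ℝ)
      g.smooth.contMDiffAt ((hX u).contMDiffAt (hsrc.mem_nhds hx))
      ((hX v).contMDiffAt (hsrc.mem_nhds hx))
    simp only [Bundle.contMDiffAt_totalSpace] at h2
    exact h2.2.contMDiffWithinAt
  refine ((contDiffOn_of_symm (x₀ := x₀) h1).mono fun y hy =>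
    ⟨hy, (chrt x₀).map_target hy⟩).congr fun y hy => ?_
  rw [tensorInChart_apply, chartInvDeriv_apply_eq_chartVF hy, chartInvDeriv_apply_eq_chartVF hy]

end Charts

theorem two_le_smooth : (2 : WithTop ℕ∞) ≤ ∞ := by
  exact WithTop.coe_le_coe.2 le_top

/-! ### Lie derivatives on a normed space. -/

section FlatLie

variable {E F : Type*} [NormedAddCommGroup E] [NormedSpace ℝ E] [NormedAddCommGroup F]
  [NormedSpace ℝ F]

/-- The Lie derivative of a covariant `2`-tensor on a normed space. -/
def lieTensorFlat (k : E → E) (G : E → E →L[ℝ] E →L[ℝ] ℝ) (y u v : E) : ℝ :=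
  fderiv ℝ G y (k y) u v + G y (fderiv ℝ k y u) v + G y u (fderiv ℝ k y v)

theorem lieTensorFlat_congr {k k' : E → E} {G G' : E → E →L[ℝ] E →L[ℝ] ℝ} {y : E}
    (hk : k =ᶠ[𝓝 y] k') (hG : G =ᶠ[𝓝 y] G') (u v : E) :
    lieTensorFlat k G y u v = lieTensorFlat k' G' y u v := by
  rw [lieTensorFlat, lieTensorFlat, hk.fderiv_eq, hG.fderiv_eq, hk.eq_of_nhds, hG.eq_of_nhds]

/-- By `hrel` the fields `k` and `k'` are `f`-related. Differentiating this relation gives `Df ∘ Dk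
= Dk' ∘ Df - D²f(·, k)`, and the correction cancels the second derivatives coming from the two
factors `Df` of the pullback. -/
theorem lieTensorFlat_pullback {f : E → F} {k : E → E} {k' : F → F}
    {G' : F → F →L[ℝ] F →L[ℝ] ℝ} {y : E} (hf : ContDiffAt ℝ 2 f y)
    (hk : DifferentiableAt ℝ k y) (hk' : DifferentiableAt ℝ k' (f y))
    (hG : DifferentiableAt ℝ G' (f y)) (hrel : ∀ᶠ z in 𝓝 y, fderiv ℝ f z (k z) = k' (f z))
    (u v : E) :
    lieTensorFlat k (fun z => (G' (f z)).bilinearComp (fderiv ℝ f z) (fderiv ℝ f z)) y u v =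
      lieTensorFlat k' G' (f y) (fderiv ℝ f y u) (fderiv ℝ f y v) := by
  have hf1 : DifferentiableAt ℝ f y := hf.differentiableAt (by simp)
  have hf2 : DifferentiableAt ℝ (fderiv ℝ f) y :=
    (hf.fderiv_right (m := 1) (by norm_num)).differentiableAt (by simp)
  have hsymm : ∀ u v, fderiv ℝ (fderiv ℝ f) y u v = fderiv ℝ (fderiv ℝ f) y v u :=
    (hf.isSymmSndFDerivAt (by simp)).eq
  have hG1 := HasFDerivAt.comp (g := G') y hG.hasFDerivAt hf1.hasFDerivAt
  have hGuv : ∀ u v : E, HasFDerivAt (fun z => G' (f z) (fderiv ℝ f z u) (fderiv ℝ f z v)) _ y :=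
    fun u v => (hG1.clm_apply (hf2.hasFDerivAt.clm_apply (hasFDerivAt_const u y))).clm_apply
      (hf2.hasFDerivAt.clm_apply (hasFDerivAt_const v y))
  have hpull : DifferentiableAt ℝ
      (fun z => (G' (f z)).bilinearComp (fderiv ℝ f z) (fderiv ℝ f z)) y := by
    have h1 : DifferentiableAt ℝ (fun z => (G' (f z)).comp (fderiv ℝ f z)) y :=
      (hG.comp y hf1).clm_comp hf2
    have h2 : DifferentiableAt ℝ (fun z =>
        ((ContinuousLinearMap.compL ℝ E F ℝ).flip (fderiv ℝ f z)).comp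
          ((G' (f z)).comp (fderiv ℝ f z))) y :=
      (((ContinuousLinearMap.compL ℝ E F ℝ).flip.differentiableAt).comp y hf2).clm_comp h1
    exact h2
  have hD : fderiv ℝ (fun z => (G' (f z)).bilinearComp (fderiv ℝ f z) (fderiv ℝ f z)) y (k y) u v =
      fderiv ℝ (fun z => G' (f z) (fderiv ℝ f z u) (fderiv ℝ f z v)) y (k y) := by
    have h1 := (hpull.hasFDerivAt.clm_apply (hasFDerivAt_const u y)).clm_apply
      (hasFDerivAt_const v y)
    have h2 : HasFDerivAt (fun z => G' (f z) (fderiv ℝ f z u) (fderiv ℝ f z v)) _ y := h1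
    rw [h2.fderiv]
    simp
  have hrel' : ∀ u, fderiv ℝ (fderiv ℝ f) y u (k y) + fderiv ℝ f y (fderiv ℝ k y u) =
      fderiv ℝ k' (f y) (fderiv ℝ f y u) := by
    intro u
    have h1 := hf2.hasFDerivAt.clm_apply hk.hasFDerivAt
    have h2 := (hk'.hasFDerivAt.comp y hf1.hasFDerivAt).congr_of_eventuallyEq
      (f := k' ∘ f) (f₁ := fun z => fderiv ℝ f z (k z)) hrel
    have h3 := congrArg (fun A : E →L[ℝ] F => A u) (h1.unique h2)
    simp only [_root_.add_apply, ContinuousLinearMap.comp_apply,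
      ContinuousLinearMap.flip_apply] at h3
    rw [add_comm]
    exact h3
  rw [lieTensorFlat, lieTensorFlat, hD, (hGuv u v).fderiv, ← hrel' u, ← hrel' v,
    ← hrel.self_of_nhds]
  simp [hsymm (k y)]
  ring

/-- Cartan's formula `L_k α = i_k dα + d(α(k))`, in which the last term vanishes. -/
theorem lieFlat_eq_extDerFlat {α : E → E →L[ℝ] ℝ} {k : E → E} {y : E}
    (hα : DifferentiableAt ℝ α y) (hk : DifferentiableAt ℝ k y)
    (h0 : (fun z => α z (k z)) =ᶠ[𝓝 y] fun _ => 0) (v : E) :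
    fderiv ℝ α y (k y) v + α y (fderiv ℝ k y v) = extDerFlat α y (k y) v := by
  have h1 := (hα.hasFDerivAt.clm_apply hk.hasFDerivAt).fderiv
  have h2 := h0.fderiv_eq (𝕜 := ℝ)
  rw [h1] at h2
  have h3 := congrArg (fun A : E →L[ℝ] ℝ => A v) h2
  simp at h3
  rw [extDerFlat]
  linarith

end FlatLie

/-! ### Naturality of `extDer` and `lieTensor` under maps and changes of chart. -/

section Naturality

variable {d e : ℕ} {M : Type*} [TopologicalSpace M] [ChartedSpace (Euc d) M]
  {N : Type*} [TopologicalSpace N] [ChartedSpace (Euc e) N]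

/-- The coordinate expression of a map in the charts at `x₀` and `p₀`. -/
def chartRep (f : M → N) (x₀ : M) (p₀ : N) (y : Euc d) : Euc e :=
  chrt p₀ (f ((chrt (d := d) x₀).symm y))

/-- The differential of a map between manifolds. -/
def diffAt (f : M → N) (x : M) : Tan d x →L[ℝ] Tan e (f x) :=
  mfderiv 𝓘(ℝ, Euc d) 𝓘(ℝ, Euc e) f x

/-- The pullback of a `1`-form under a map between manifolds. -/
def pullFormM (f : M → N) (α : ∀ p : N, Tan e p →L[ℝ] ℝ) (x : M) : Tan d x →L[ℝ] ℝ :=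
  (α (f x)).comp (diffAt (d := d) f x)

variable [IsManifold 𝓘(ℝ, Euc d) ∞ M] [IsManifold 𝓘(ℝ, Euc e) ∞ N]

theorem contDiffAt_chartRep {f : M → N} {x₀ : M} {p₀ : N} {y : Euc d}
    (hy : y ∈ (chrt (d := d) x₀).target)
    (hf : ContMDiffAt 𝓘(ℝ, Euc d) 𝓘(ℝ, Euc e) ∞ f ((chrt (d := d) x₀).symm y))
    (hfy : f ((chrt (d := d) x₀).symm y) ∈ (chrt (d := e) p₀).source) :
    ContDiffAt ℝ ∞ (chartRep f x₀ p₀ : Euc d → Euc e) y := by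
  rw [← contMDiffAt_iff_contDiffAt]
  exact (contMDiffAt_chrt hfy).comp y (hf.comp y (contMDiffAt_chrt_symm hy))

theorem diffAt_chartInvDeriv {f : M → N} {x₀ : M} {p₀ : N} {y : Euc d}
    (hy : y ∈ (chrt (d := d) x₀).target)
    (hf : ContMDiffAt 𝓘(ℝ, Euc d) 𝓘(ℝ, Euc e) ∞ f ((chrt (d := d) x₀).symm y))
    (hfy : f ((chrt (d := d) x₀).symm y) ∈ (chrt (d := e) p₀).source) (u : Euc d) :
    (diffAt f ((chrt (d := d) x₀).symm y) (chartInvDeriv x₀ y u) : Euc e) =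
      chartInvDeriv p₀ (chartRep f x₀ p₀ y) (fderiv ℝ (chartRep f x₀ p₀) y u) := by
  have h1 := (hf.mdifferentiableAt (by simp)).hasMFDerivAt.comp y (hasMFDerivAt_chrt_symm hy)
  have h2 := ((contDiffAt_chartRep hy hf hfy).differentiableAt (by simp)).hasFDerivAt
  have h3 := (hasMFDerivAt_chrt_symm ((chrt p₀).map_source hfy)).comp y h2.hasMFDerivAt
  have h4 : (f ∘ (chrt (d := d) x₀).symm) =ᶠ[𝓝 y]
      ((chrt (d := e) p₀).symm ∘ (chartRep f x₀ p₀ : Euc d → Euc e)) := by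
    have h5 : ContinuousAt (f ∘ (chrt (d := d) x₀).symm) y :=
      (hf.continuousAt).comp (contMDiffAt_chrt_symm hy).continuousAt
    filter_upwards [h5.preimage_mem_nhds ((isOpen_extChartAt_source p₀).mem_nhds hfy)] with z hz
    exact ((chrt p₀).left_inv hz).symm
  have h5 := hasMFDerivAt_unique h1 (h3.congr_of_eventuallyEq h4)
  exact congrArg (fun A : Euc d →L[ℝ] Euc e => A u) h5

-- All tangent spaces are the same type `Euc e`, so the vector can stay fixed while the base point
-- is replaced by an equal one.
omit [IsManifold 𝓘(ℝ, Euc e) ∞ N] in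
theorem form_congr (α : ∀ p : N, Tan e p →L[ℝ] ℝ) {p q : N} (h : p = q) (w : Euc e) :
    α p w = α q w := by
  subst h; rfl

theorem formInChart_pullFormM {f : M → N} {x₀ : M} {p₀ : N} {y : Euc d}
    (α : ∀ p : N, Tan e p →L[ℝ] ℝ) (hy : y ∈ (chrt (d := d) x₀).target)
    (hf : ContMDiffAt 𝓘(ℝ, Euc d) 𝓘(ℝ, Euc e) ∞ f ((chrt (d := d) x₀).symm y))
    (hfy : f ((chrt (d := d) x₀).symm y) ∈ (chrt (d := e) p₀).source) :
    formInChart (pullFormM f α) x₀ y = pullForm (chartRep f x₀ p₀) (formInChart α p₀) y := by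
  ext u
  change α (f ((chrt (d := d) x₀).symm y)) (diffAt f _ (chartInvDeriv x₀ y u)) =
    α ((chrt (d := e) p₀).symm (chartRep f x₀ p₀ y)) (chartInvDeriv p₀ (chartRep f x₀ p₀ y)
      (fderiv ℝ (chartRep f x₀ p₀) y u))
  exact (congrArg (fun w : Euc e => α (f ((chrt (d := d) x₀).symm y)) w)
    (diffAt_chartInvDeriv hy hf hfy u)).trans (form_congr α ((chrt p₀).left_inv hfy).symm _)

theorem eventually_formInChart_pullFormM {f : M → N} {x₀ : M} {p₀ : N} {y : Euc d}
    (α : ∀ p : N, Tan e p →L[ℝ] ℝ) {V : Set M} (hV : IsOpen V) (hy : y ∈ chartDom (d := d) x₀ V)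
    (hf : ContMDiffOn 𝓘(ℝ, Euc d) 𝓘(ℝ, Euc e) ∞ f V)
    (hfy : f ((chrt (d := d) x₀).symm y) ∈ (chrt (d := e) p₀).source) :
    formInChart (pullFormM f α) x₀ =ᶠ[𝓝 y] pullForm (chartRep f x₀ p₀) (formInChart α p₀) := by
  have h5 : ContinuousAt (f ∘ (chrt (d := d) x₀).symm) y :=
    (hf.contMDiffAt (hV.mem_nhds hy.2)).continuousAt.comp (contMDiffAt_chrt_symm hy.1).continuousAt
  filter_upwards [h5.preimage_mem_nhds ((isOpen_extChartAt_source p₀).mem_nhds hfy),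
    (isOpen_chartDom x₀ hV).mem_nhds hy] with z hz hz'
  exact formInChart_pullFormM α hz'.1 (hf.contMDiffAt (hV.mem_nhds hz'.2)) hz

omit [IsManifold 𝓘(ℝ, Euc d) ∞ M] [IsManifold 𝓘(ℝ, Euc e) ∞ N] in
theorem diffAt_id (x : M) (u : Tan d x) : diffAt (fun z : M => z) x u = u := by
  have h : mfderiv 𝓘(ℝ, Euc d) 𝓘(ℝ, Euc d) (fun z : M => z) x = ContinuousLinearMap.id ℝ _ :=
    mfderiv_id
  exact congrArg (fun A : Euc d →L[ℝ] Euc d => A u) h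

theorem chartInvDeriv_transition {x₀ x₁ : M} {y : Euc d} (hy : y ∈ (chrt (d := d) x₀).target)
    (hy' : (chrt (d := d) x₀).symm y ∈ (chrt (d := d) x₁).source) (u : Euc d) :
    (chartInvDeriv x₀ y u : Euc d) = chartInvDeriv x₁ (chartRep (fun z : M => z) x₀ x₁ y)
      (fderiv ℝ (chartRep (d := d) (e := d) (fun z : M => z) x₀ x₁) y u) :=
  (diffAt_id _ _).symm.trans (diffAt_chartInvDeriv (f := fun z : M => z) hy contMDiffAt_id hy' u)

omit [IsManifold 𝓘(ℝ, Euc d) ∞ M] in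
theorem pullFormM_id (α : ∀ p : M, Tan d p →L[ℝ] ℝ) : pullFormM (d := d) (fun z : M => z) α = α := by
  funext x
  ext u
  exact congrArg (α x) (diffAt_id x u)

/-- `extDer` uses at each point the preferred chart of that very point, so a computation on an open
set needs independence of the chart. The identity map read in two charts is their transition map,
and `extDerFlat_pullForm` applies to it. -/
theorem extDer_chart {α : ∀ x : M, Tan d x →L[ℝ] ℝ} {V : Set M} (hV : IsOpen V)
    (hα : SmoothOneForm α V) {x₀ : M} {y : Euc d} (hy : y ∈ chartDom (d := d) x₀ V) (u v : Euc d) :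
    extDer α ((chrt (d := d) x₀).symm y) (chartInvDeriv x₀ y u) (chartInvDeriv x₀ y v) =
      extDerFlat (formInChart α x₀) y u v := by
  set x₁ := (chrt (d := d) x₀).symm y with hx₁
  have hs : x₁ ∈ (chrt (d := d) x₁).source := mem_extChartAt_source x₁
  have h1 := eventually_formInChart_pullFormM (f := fun z : M => z) (p₀ := x₁) α hV hy
    contMDiffOn_id hs
  rw [pullFormM_id] at h1
  have h2 : chartRep (fun z : M => z) x₀ x₁ y = coord (d := d) x₁ := rfl
  have h3 : ∀ u : Euc d, (chartInvDeriv x₀ y u : Euc d) =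
      fderiv ℝ (chartRep (d := d) (e := d) (fun z : M => z) x₀ x₁) y u := fun u =>
    (chartInvDeriv_transition hy.1 hs u).trans (chartInvDeriv_coord x₁ _)
  have h4 : ContDiffAt ℝ ∞ (formInChart α x₁) (coord x₁) :=
    (contDiffOn_formInChart hV hα x₁).contDiffAt
      ((isOpen_chartDom x₁ hV).mem_nhds (coord_mem_chartDom hy.2))
  have h5 := contDiffAt_chartRep (f := fun z : M => z) (p₀ := x₁) hy.1 contMDiffAt_id hs
  have h6 := extDerFlat_pullForm (α := formInChart α x₁) (h5.of_le two_le_smooth)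
    (h4.differentiableAt (by simp)) u v
  rw [extDerFlat_congr h1, h6]
  exact (congrArg₂ (fun a b : Euc d => extDer α x₁ a b) (h3 u) (h3 v))

theorem extDer_pullFormM {f : M → N} {α : ∀ p : N, Tan e p →L[ℝ] ℝ} {V : Set M} {V' : Set N}
    (hV : IsOpen V) (hV' : IsOpen V') (hf : ContMDiffOn 𝓘(ℝ, Euc d) 𝓘(ℝ, Euc e) ∞ f V)
    (hα : SmoothOneForm α V') {x : M} (hx : x ∈ V) (hfx : f x ∈ V') (u v : Tan d x) :
    extDer (pullFormM f α) x u v = extDer α (f x) (diffAt f x u) (diffAt f x v) := by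
  have hxt : coord x ∈ (chrt (d := d) x).target := mem_extChartAt_target x
  have hs : f ((chrt (d := d) x).symm (coord x)) ∈ (chrt (d := e) (f x)).source := by
    rw [symm_coord]; exact mem_extChartAt_source (f x)
  have h1 := eventually_formInChart_pullFormM (p₀ := f x) α hV (coord_mem_chartDom hx) hf hs
  have hfc : ContMDiffAt 𝓘(ℝ, Euc d) 𝓘(ℝ, Euc e) ∞ f ((chrt (d := d) x).symm (coord x)) := by
    rw [symm_coord]; exact hf.contMDiffAt (hV.mem_nhds hx)
  have h2 := contDiffAt_chartRep hxt hfc hs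
  have h3 : chartRep f x (f x) (coord (d := d) x) = coord (d := e) (f x) := by
    rw [chartRep, symm_coord]; rfl
  have h4 : ContDiffAt ℝ ∞ (formInChart α (f x)) (coord (f x)) :=
    (contDiffOn_formInChart hV' hα (f x)).contDiffAt
      ((isOpen_chartDom (f x) hV').mem_nhds (coord_mem_chartDom hfx))
  rw [← h3] at h4
  have h6 := extDerFlat_pullForm (α := formInChart α (f x)) (h2.of_le two_le_smooth)
    (h4.differentiableAt (by simp)) u v
  have h7 : ∀ u : Euc d, (diffAt f x u : Euc e) =
      fderiv ℝ (chartRep (d := d) (e := e) f x (f x)) (coord x) u := by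
    intro u
    have h8 := diffAt_chartInvDeriv hxt hfc hs u
    rw [chartInvDeriv_coord, h3] at h8
    have h9 : ∀ z : M, z = x → (diffAt (d := d) (e := e) f z u : Euc e) = diffAt (d := d) f x u := by
      intro z hz; subst hz; rfl
    exact ((h9 _ (symm_coord x)).symm.trans h8).trans (chartInvDeriv_coord (f x) _)
  refine (extDerFlat_congr h1 u v).trans (h6.trans ?_)
  rw [h3]
  exact (congrArg₂ (fun a b : Euc e => extDer α (f x) a b) (h7 u) (h7 v)).symm

omit [IsManifold 𝓘(ℝ, Euc e) ∞ N] in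
theorem tensor_congr (g : ∀ p : N, Tan e p →L[ℝ] Tan e p →L[ℝ] ℝ) {p q : N} (h : p = q)
    (w z : Euc e) : g p w z = g q w z := by
  subst h; rfl

/-- The transition map relates the two chart expressions of `k` and pulls one expression of `g` back
to the other, which is the setting of `lieTensorFlat_pullback`. -/
theorem lieTensor_chart {k : ∀ x : M, Tan d x} {V : Set M} (hV : IsOpen V) (hk : SmoothVF k V)
    (g : LorentzMetric d M) {x₀ : M} {y : Euc d} (hy : y ∈ chartDom (d := d) x₀ V) (u v : Euc d) :
    lieTensor k g.val ((chrt (d := d) x₀).symm y) (chartInvDeriv x₀ y u) (chartInvDeriv x₀ y v) =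
      lieTensorFlat (vfInChart k x₀) (tensorInChart g.val x₀) y u v := by
  set x₁ := (chrt (d := d) x₀).symm y with hx₁
  have hs : x₁ ∈ (chrt (d := d) x₁).source := mem_extChartAt_source x₁
  set τ : Euc d → Euc d := chartRep (fun z : M => z) x₀ x₁ with hτ
  have h3 : ∀ u : Euc d, (chartInvDeriv x₀ y u : Euc d) = fderiv ℝ τ y u := fun u =>
    (chartInvDeriv_transition hy.1 hs u).trans (chartInvDeriv_coord x₁ _)
  have h5 : ContDiffAt ℝ ∞ τ y :=
    contDiffAt_chartRep (f := fun z : M => z) (p₀ := x₁) hy.1 contMDiffAt_id hs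
  have hcont : ContinuousAt (chrt (d := d) x₀).symm y := (contMDiffAt_chrt_symm hy.1).continuousAt
  have hev : ∀ᶠ z in 𝓝 y, z ∈ chartDom (d := d) x₀ V ∧
      (chrt (d := d) x₀).symm z ∈ (chrt (d := d) x₁).source :=
    Eventually.and ((isOpen_chartDom x₀ hV).mem_nhds hy)
      (hcont.preimage_mem_nhds ((isOpen_extChartAt_source x₁).mem_nhds hs))
  have hG : tensorInChart g.val x₀ =ᶠ[𝓝 y] fun z =>
      (tensorInChart g.val x₁ (τ z)).bilinearComp (fderiv ℝ τ z) (fderiv ℝ τ z) := by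
    filter_upwards [hev] with z hz
    ext a b
    have h1 := chartInvDeriv_transition hz.1.1 hz.2
    have h2 : (chrt (d := d) x₀).symm z = (chrt (d := d) x₁).symm (τ z) :=
      ((chrt x₁).left_inv hz.2).symm
    exact (congrArg₂ (fun p q : Euc d => g.val ((chrt (d := d) x₀).symm z) p q) (h1 a) (h1 b)).trans
      (tensor_congr g.val h2 _ _)
  have hrel : ∀ᶠ z in 𝓝 y, fderiv ℝ τ z (vfInChart k x₀ z) = vfInChart k x₁ (τ z) := by
    filter_upwards [hev] with z hz
    have h2 : (chrt (d := d) x₁).symm (τ z) = (chrt (d := d) x₀).symm z := (chrt x₁).left_inv hz.2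
    have h1 := chartInvDeriv_transition hz.1.1 hz.2 (vfInChart k x₀ z)
    refine ((vfInChart_eq_iff k ((chrt x₁).map_source hz.2) _).2 ?_).symm
    have h4 : ∀ p q : M, p = q → (k p : Euc d) = k q := by
      intro p q h; subst h; rfl
    exact ((h4 _ _ h2).trans (chartInvDeriv_vfInChart k hz.1.1).symm).trans h1
  have hk0 : DifferentiableAt ℝ (vfInChart k x₀) y :=
    ((contDiffOn_vfInChart hV hk x₀).contDiffAt
      ((isOpen_chartDom x₀ hV).mem_nhds hy)).differentiableAt (by simp)
  have hk1 : DifferentiableAt ℝ (vfInChart k x₁) (τ y) :=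
    ((contDiffOn_vfInChart hV hk x₁).contDiffAt
      ((isOpen_chartDom x₁ hV).mem_nhds (coord_mem_chartDom hy.2))).differentiableAt (by simp)
  have hG1 : DifferentiableAt ℝ (tensorInChart g.val x₁) (τ y) :=
    ((contDiffOn_tensorInChart g x₁).contDiffAt
      ((isOpen_extChartAt_target x₁).mem_nhds (mem_extChartAt_target x₁))).differentiableAt (by simp)
  rw [lieTensorFlat_congr (EventuallyEq.refl _ _) hG,
    lieTensorFlat_pullback (h5.of_le two_le_smooth) hk0 hk1 hG1 hrel]
  exact (congrArg₂ (fun a b : Euc d => lieTensor k g.val x₁ a b) (h3 u) (h3 v))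

theorem lieForm_eq {k : ∀ x : M, Tan d x} {α : ∀ x : M, Tan d x →L[ℝ] ℝ} {V : Set M} (hV : IsOpen V)
    (hk : SmoothVF k V) (hα : SmoothOneForm α V) {x : M} (hx : x ∈ V)
    (h0 : ∀ z ∈ V, α z (k z) = 0) (v : Tan d x) :
    lieForm k α x v = extDer α x (k x) v := by
  have hy := coord_mem_chartDom (d := d) hx
  have hnb := (isOpen_chartDom x hV).mem_nhds hy
  have h1 : DifferentiableAt ℝ (formInChart α x) (coord x) :=
    ((contDiffOn_formInChart hV hα x).contDiffAt hnb).differentiableAt (by simp)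
  have h2 : DifferentiableAt ℝ (vfInChart k x) (coord x) :=
    ((contDiffOn_vfInChart hV hk x).contDiffAt hnb).differentiableAt (by simp)
  have h3 : (fun z => formInChart α x z (vfInChart k x z)) =ᶠ[𝓝 (coord x)] fun _ => 0 := by
    filter_upwards [hnb] with z hz
    exact (congrArg (fun w : Euc d => α ((chrt (d := d) x).symm z) w)
      (chartInvDeriv_vfInChart k hz.1)).trans (h0 _ hz.2)
  have h5 := lieFlat_eq_extDerFlat (α := formInChart α x) (k := vfInChart k x) h1 h2 h3 v
  exact h5.trans (congrArg (fun w : Euc d => extDer α x w v) (vfInChart_coord k x))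

theorem inCoordinates_form (α : ∀ x : M, Tan d x →L[ℝ] ℝ) (x z : M) (u : Euc d) :
    (ContinuousLinearMap.inCoordinates (Euc d) (fun z : M => Tan d z) ℝ
      (fun z : M => Bundle.Trivial M ℝ z) x z x z (α z)) u =
      α z ((trivializationAt (Euc d) (TangentSpace 𝓘(ℝ, Euc d)) x).symmL ℝ z u) := by
  exact congrArg (fun A : ℝ →L[ℝ] ℝ => A (α z ((trivializationAt (Euc d)
    (TangentSpace 𝓘(ℝ, Euc d)) x).symmL ℝ z u)))
    (Bundle.Trivial.continuousLinearMapAt_trivialization ℝ M ℝ z)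

/-- The bundle trivialisation hidden in `SmoothOneForm` agrees with `formInChart`, so that
smoothness of a form can be proved in charts. -/
theorem inCoordinates_form_eq (α : ∀ x : M, Tan d x →L[ℝ] ℝ) {x z : M}
    (hz : z ∈ (chrt (d := d) x).source) :
    ContinuousLinearMap.inCoordinates (Euc d) (fun z : M => Tan d z) ℝ
      (fun z : M => Bundle.Trivial M ℝ z) x z x z (α z) = formInChart α x (chrt (d := d) x z) := by
  have hz' : z ∈ (chartAt (Euc d) x).source := by rwa [← extChartAt_source 𝓘(ℝ, Euc d)]
  have h2 := TangentBundle.symmL_trivializationAt (I := 𝓘(ℝ, Euc d)) hz'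
  rw [ModelWithCorners.range_eq_univ, mfderivWithin_univ] at h2
  ext u
  have h3 : (trivializationAt (Euc d) (TangentSpace 𝓘(ℝ, Euc d)) x).symmL ℝ z u =
      chartInvDeriv x (chrt (d := d) x z) u :=
    congrArg (fun A : Euc d →L[ℝ] Euc d => A u) h2
  rw [inCoordinates_form]
  exact (congrArg (fun w : Euc d => α z w) h3).trans
    (form_congr α ((chrt x).left_inv hz).symm _)

theorem contMDiffAt_form {α : ∀ x : M, Tan d x →L[ℝ] ℝ} {x : M}
    (h : ContDiffAt ℝ ∞ (formInChart α x) (coord x)) :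
    ContMDiffAt 𝓘(ℝ, Euc d) (𝓘(ℝ, Euc d).prod 𝓘(ℝ, Euc d →L[ℝ] ℝ)) ∞
      (fun x => Bundle.TotalSpace.mk' (Euc d →L[ℝ] ℝ)
        (E := fun x : M => Tan d x →L[ℝ] Bundle.Trivial M ℝ x) x (α x)) x := by
  have h1 : ContMDiffAt 𝓘(ℝ, Euc d) 𝓘(ℝ, Euc d →L[ℝ] ℝ) ∞
      (fun z => formInChart α x (chrt (d := d) x z)) x :=
    ContMDiffAt.comp (g := formInChart α x) x (contMDiffAt_iff_contDiffAt.2 h) (contMDiffAt_chrt (mem_extChartAt_source x))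
  have hsrc : (chrt (d := d) x).source ∈ 𝓝 x := extChartAt_source_mem_nhds x
  have h6 : ContMDiffAt 𝓘(ℝ, Euc d) 𝓘(ℝ, Euc d →L[ℝ] ℝ) ∞
      (fun z => ContinuousLinearMap.inCoordinates (Euc d) (fun z : M => Tan d z) ℝ
      (fun z : M => Bundle.Trivial M ℝ z) x z x z (α z)) x := by
    refine h1.congr_of_eventuallyEq ?_
    filter_upwards [hsrc] with z hz using inCoordinates_form_eq α hz
  exact (contMDiffAt_hom_bundle _).2 ⟨contMDiffAt_id, h6⟩

theorem smoothOneForm_of_chart {α : ∀ x : M, Tan d x →L[ℝ] ℝ} {V : Set M}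
    (h : ∀ x ∈ V, ContDiffAt ℝ ∞ (formInChart α x) (coord x)) : SmoothOneForm α V :=
  fun x hx => (contMDiffAt_form (h x hx)).contMDiffWithinAt

end Naturality

/-! ### Levi-Civita connection and curvature in coordinates (`Flat` refers to the normed space, not
to zero curvature). -/

section FlatCurvature

set_option maxSynthPendingDepth 3

variable {E : Type*} [NormedAddCommGroup E] [NormedSpace ℝ E] {G : E → E →L[ℝ] E →L[ℝ] ℝ} {Ω : Set E}

/-- `G` is a smooth pseudo-Riemannian metric on the open set `Ω`. -/
structure IsFlatMetric (G : E → E →L[ℝ] E →L[ℝ] ℝ) (Ω : Set E) : Prop where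
  isOpen : IsOpen Ω
  smooth : ContDiffOn ℝ ∞ G Ω
  symm : ∀ z ∈ Ω, ∀ u v, G z u v = G z v u
  inv : ∀ z ∈ Ω, (G z).IsInvertible

/-- The Christoffel symbols as a field of bilinear maps. -/
def chrCLM (G : E → E →L[ℝ] E →L[ℝ] ℝ) (z : E) : E →L[ℝ] E →L[ℝ] E :=
  (ContinuousLinearMap.compL ℝ E (E →L[ℝ] ℝ) E (G z).inverse).comp
    ((1 / 2 : ℝ) • (fderiv ℝ G z + (fderiv ℝ G z).flip -
      ((ContinuousLinearMap.flipₗᵢ ℝ E E ℝ).toContinuousLinearEquiv :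
        (E →L[ℝ] E →L[ℝ] ℝ) →L[ℝ] (E →L[ℝ] E →L[ℝ] ℝ)).comp (fderiv ℝ G z).flip))

/-- The curvature of a pseudo-Riemannian metric on a normed space. -/
def riemannFlat (G : E → E →L[ℝ] E →L[ℝ] ℝ) (z a b w : E) : E :=
  fderiv ℝ (chrCLM G) z a b w - fderiv ℝ (chrCLM G) z b a w +
    chrCLM G z a (chrCLM G z b w) - chrCLM G z b (chrCLM G z a w)

theorem riemannFlat_antisymm (G : E → E →L[ℝ] E →L[ℝ] ℝ) (z a b c : E) :
    riemannFlat G z a b c = - riemannFlat G z b a c := by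
  rw [riemannFlat, riemannFlat]
  abel

namespace IsFlatMetric

variable (h : IsFlatMetric G Ω)
include h

theorem contDiffAt {z : E} (hz : z ∈ Ω) : ContDiffAt ℝ ∞ G z :=
  h.smooth.contDiffAt (h.isOpen.mem_nhds hz)

theorem differentiableAt {z : E} (hz : z ∈ Ω) : DifferentiableAt ℝ G z :=
  (h.contDiffAt hz).differentiableAt (by simp)

variable [CompleteSpace E]

theorem contDiffOn_inverse : ContDiffOn ℝ ∞ (fun z => (G z).inverse) Ω := by
  intro z hz
  obtain ⟨e, he⟩ := h.inv z hz
  have h1 : ContDiffAt ℝ ∞ ContinuousLinearMap.inverse (G z) := by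
    rw [← he]; exact contDiffAt_map_inverse e
  exact (h1.comp z (h.contDiffAt hz)).contDiffWithinAt

theorem contDiffOn_chrCLM : ContDiffOn ℝ ∞ (chrCLM G) Ω := by
  have h1 : ContDiffOn ℝ ∞ (fderiv ℝ G) Ω := h.smooth.fderiv_of_isOpen h.isOpen (by simp)
  have h2 : ContDiffOn ℝ ∞ (fun z => (fderiv ℝ G z).flip) Ω :=
    (ContinuousLinearMap.flipₗᵢ ℝ E E
      (E →L[ℝ] ℝ)).toContinuousLinearEquiv.contDiff.comp_contDiffOn h1
  exact ((ContinuousLinearMap.compL ℝ E (E →L[ℝ] ℝ) E).contDiff.comp_contDiffOn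
    h.contDiffOn_inverse).clm_comp
      (((h1.add h2).sub (contDiffOn_const.clm_comp h2)).const_smul (1 / 2 : ℝ))

omit [CompleteSpace E] in
theorem fderiv_symm {z : E} (hz : z ∈ Ω) (a u v : E) :
    fderiv ℝ G z a u v = fderiv ℝ G z a v u := by
  have key : ∀ u v, fderiv ℝ (fun z => G z u v) z a = fderiv ℝ G z a u v := by
    intro u v
    have h1 := (((h.differentiableAt hz).hasFDerivAt.clm_apply (hasFDerivAt_const u z)).clm_apply
      (hasFDerivAt_const v z)).fderiv
    rw [h1]; simp
  rw [← key u v, ← key v u]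
  have h2 : (fun z => G z u v) =ᶠ[𝓝 z] fun z => G z v u := by
    filter_upwards [h.isOpen.mem_nhds hz] with z hz using h.symm z hz u v
  rw [h2.fderiv_eq]

omit [CompleteSpace E] in
theorem koszul {z : E} (hz : z ∈ Ω) (u v w : E) :
    G z (chrCLM G z u v) w =
      (1 / 2) * (fderiv ℝ G z u v w + fderiv ℝ G z v u w - fderiv ℝ G z w u v) := by
  have h1 : chrCLM G z u v = (G z).inverse ((1 / 2 : ℝ) •
      (fderiv ℝ G z u v + fderiv ℝ G z v u - ((fderiv ℝ G z).flip u).flip v)) := rfl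
  rw [h1, self_apply_inverse (h.inv z hz)]
  simp

-- This is `∇g = 0`: two instances of the Koszul formula are added.
omit [CompleteSpace E] in
theorem compat {z : E} (hz : z ∈ Ω) (a u v : E) :
    fderiv ℝ G z a u v = G z (chrCLM G z a u) v + G z u (chrCLM G z a v) := by
  rw [h.symm z hz u, h.koszul hz, h.koszul hz, h.fderiv_symm hz a v u]
  ring

omit [CompleteSpace E] in
theorem injective {z : E} (hz : z ∈ Ω) {u v : E} (huv : ∀ w, G z u w = G z v w) :
    u = v := by
  obtain ⟨e, he⟩ := h.inv z hz
  have h1 : G z u = G z v := ContinuousLinearMap.ext huv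
  rw [← he] at h1
  exact e.injective h1

omit [CompleteSpace E] in
theorem chr_symm {z : E} (hz : z ∈ Ω) (u v : E) : chrCLM G z u v = chrCLM G z v u := by
  refine h.injective hz fun w => ?_
  rw [h.koszul hz, h.koszul hz, h.fderiv_symm hz w u v]
  ring

theorem differentiableAt_chr {z : E} (hz : z ∈ Ω) : DifferentiableAt ℝ (chrCLM G) z :=
  (h.contDiffOn_chrCLM.contDiffAt (h.isOpen.mem_nhds hz)).differentiableAt (by simp)

theorem fderiv_chr_symm {z : E} (hz : z ∈ Ω) (a u v : E) :
    fderiv ℝ (chrCLM G) z a u v = fderiv ℝ (chrCLM G) z a v u := by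
  have key : ∀ u v, fderiv ℝ (fun z => chrCLM G z u v) z a = fderiv ℝ (chrCLM G) z a u v := by
    intro u v
    have h1 := (((h.differentiableAt_chr hz).hasFDerivAt.clm_apply
      (hasFDerivAt_const u z)).clm_apply (hasFDerivAt_const v z)).fderiv
    rw [h1]; simp
  rw [← key u v, ← key v u]
  have h2 : (fun z => chrCLM G z u v) =ᶠ[𝓝 z] fun z => chrCLM G z v u := by
    filter_upwards [h.isOpen.mem_nhds hz] with z hz using h.chr_symm hz u v
  rw [h2.fderiv_eq]

theorem riemann_bianchi {z : E} (hz : z ∈ Ω) (a b c : E) :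
    riemannFlat G z a b c + riemannFlat G z b c a + riemannFlat G z c a b = 0 := by
  rw [riemannFlat, riemannFlat, riemannFlat, h.fderiv_chr_symm hz a c b,
    h.fderiv_chr_symm hz b a c, h.fderiv_chr_symm hz c b a, h.chr_symm hz b c, h.chr_symm hz a c,
    h.chr_symm hz b a]
  abel

omit [CompleteSpace E] in
/-- The derivative of a scalar product along a direction, in terms of covariant derivatives. -/
theorem fderiv_metric {z : E} (hz : z ∈ Ω) {X Y : E → E} (hX : DifferentiableAt ℝ X z)
    (hY : DifferentiableAt ℝ Y z) (a : E) :
    fderiv ℝ (fun z => G z (X z) (Y z)) z a =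
      G z (fderiv ℝ X z a + chrCLM G z a (X z)) (Y z) +
        G z (X z) (fderiv ℝ Y z a + chrCLM G z a (Y z)) := by
  have h1 := (((h.differentiableAt hz).hasFDerivAt.clm_apply hX.hasFDerivAt).clm_apply
    hY.hasFDerivAt).fderiv
  rw [h1]
  simp [h.compat hz]
  ring

/-- The second derivatives of `G · v w` in the directions `a`, `b` commute. Expanded by `compat`,
the products of two Christoffel terms paired with each other are symmetric in `a`, `b` and cancel;
the rest is the skewness. -/
theorem riemann_skew {z : E} (hz : z ∈ Ω) (a b v w : E) :
    G z (riemannFlat G z a b v) w = - G z v (riemannFlat G z a b w) := by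
  have hD : ∀ a b : E, fderiv ℝ (fun z => fderiv ℝ G z b v w) z a =
      G z (fderiv ℝ (chrCLM G) z a b v + chrCLM G z a (chrCLM G z b v)) w
      + G z (chrCLM G z b v) (chrCLM G z a w) + G z (chrCLM G z a v) (chrCLM G z b w)
      + G z v (fderiv ℝ (chrCLM G) z a b w + chrCLM G z a (chrCLM G z b w)) := by
    intro a b
    have h1 : (fun z => fderiv ℝ G z b v w) =ᶠ[𝓝 z]
        fun z => G z (chrCLM G z b v) w + G z v (chrCLM G z b w) := by
      filter_upwards [h.isOpen.mem_nhds hz] with z hz using h.compat hz b v w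
    have hchr : ∀ v, HasFDerivAt (fun z => chrCLM G z b v) _ z := fun v =>
      ((h.differentiableAt_chr hz).hasFDerivAt.clm_apply
        (hasFDerivAt_const b z)).clm_apply (hasFDerivAt_const v z)
    have hd1 : DifferentiableAt ℝ (fun z => G z (chrCLM G z b v) w) z :=
      ((h.differentiableAt hz).clm_apply (hchr v).differentiableAt).clm_apply
        (differentiableAt_const w)
    have hd2 : DifferentiableAt ℝ (fun z => G z v (chrCLM G z b w)) z :=
      ((h.differentiableAt hz).clm_apply (differentiableAt_const v)).clm_apply
        (hchr w).differentiableAt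
    rw [h1.fderiv_eq, fderiv_fun_add hd1 hd2, add_apply,
      h.fderiv_metric hz (Y := fun _ => w) (hchr v).differentiableAt (differentiableAt_const w),
      h.fderiv_metric hz (X := fun _ => v) (differentiableAt_const v) (hchr w).differentiableAt,
      (hchr v).fderiv, (hchr w).fderiv]
    simp
    ring
  have h2 : ∀ a b : E, fderiv ℝ (fun z => fderiv ℝ G z b v w) z a =
      fderiv ℝ (fderiv ℝ G) z a b v w := by
    intro a b
    have h3 : DifferentiableAt ℝ (fderiv ℝ G) z :=
      ((h.smooth.fderiv_of_isOpen (m := 1) h.isOpen (by exact two_le_smooth)).contDiffAt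
        (h.isOpen.mem_nhds hz)).differentiableAt (by simp)
    have h4 := (((h3.hasFDerivAt.clm_apply (hasFDerivAt_const b z)).clm_apply
      (hasFDerivAt_const v z)).clm_apply (hasFDerivAt_const w z)).fderiv
    rw [h4]; simp
  have h5 : fderiv ℝ (fderiv ℝ G) z a b = fderiv ℝ (fderiv ℝ G) z b a :=
    (((h.contDiffAt hz).of_le two_le_smooth).isSymmSndFDerivAt (by simp)).eq a b
  have h6 := hD a b
  have h7 := hD b a
  rw [h2] at h6 h7
  rw [h5, h7] at h6
  rw [riemannFlat, riemannFlat]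
  simp only [map_add, map_sub, add_apply, sub_apply] at h6 ⊢
  linarith

/-- The octahedron argument: four cyclic identities are combined with skewness in the first and in
the last pair of arguments. -/
theorem riemann_pair {z : E} (hz : z ∈ Ω) (a b c e : E) :
    G z (riemannFlat G z a b c) e = G z (riemannFlat G z c e a) b := by
  have hB : ∀ a b c e, G z (riemannFlat G z a b c) e + G z (riemannFlat G z b c a) e +
      G z (riemannFlat G z c a b) e = 0 := by
    intro a b c e
    have := congrArg (fun t => G z t e) (h.riemann_bianchi hz a b c)
    simpa using this
  have hA : ∀ a b c e, G z (riemannFlat G z a b c) e = - G z (riemannFlat G z b a c) e := by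
    intro a b c e
    rw [riemannFlat_antisymm G z a b c]; simp
  have hS : ∀ a b c e, G z (riemannFlat G z a b c) e = - G z (riemannFlat G z a b e) c := by
    intro a b c e
    rw [h.riemann_skew hz, h.symm z hz c]
  have b1 := hB a b c e
  have b2 := hB b c e a
  have b3 := hB c e a b
  have b4 := hB e a b c
  linarith [hA a b c e, hA b c a e, hA c a b e, hA b c e a, hA c e b a, hA e b c a, hA c e a b,
    hA e a c b, hA a c e b, hA e a b c, hA a b e c, hA b e a c, hS a b c e, hS b c a e, hS c a b e,
    hS c e b a, hS e b c a, hS e a c b, hS a c e b, hS b e a c, hS b c e a, hS c e a b, hS e a b c]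

end IsFlatMetric

end FlatCurvature

/-! ### The coordinate curvature `riemann` agrees with `riemannFlat`. -/

section EucCurvature

set_option maxSynthPendingDepth 3

variable {d : ℕ} {G : Euc d → Euc d →L[ℝ] Euc d →L[ℝ] ℝ} {Ω : Set (Euc d)}

theorem IsFlatMetric.riemann_eq (h : IsFlatMetric G Ω) {z : Euc d} (hz : z ∈ Ω) (a b w : Euc d) :
    riemann G z a b w = riemannFlat G z a b w := by
  have key : ∀ a b, fderiv ℝ (fun z => christoffel G z b w) z a = fderiv ℝ (chrCLM G) z a b w := by
    intro a b
    have h1 := (((h.differentiableAt_chr hz).hasFDerivAt.clm_apply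
      (hasFDerivAt_const b z)).clm_apply (hasFDerivAt_const w z)).fderiv
    change fderiv ℝ (fun z => chrCLM G z b w) z a = _
    rw [h1]; simp
  rw [riemann, key, key]
  rfl

end EucCurvature

/-! ### The Sachs equation for a shear-free null geodesic congruence. -/

section Sachs

set_option maxSynthPendingDepth 3

theorem differentiableAt_real_div {E : Type*} [NormedAddCommGroup E] [NormedSpace ℝ E]
    {f g : E → ℝ} {x : E} (hf : DifferentiableAt ℝ f x) (hg : DifferentiableAt ℝ g x)
    (h0 : g x ≠ 0) : DifferentiableAt ℝ (fun z => f z / g z) x := by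
  simp only [div_eq_mul_inv]
  exact hf.mul (hg.fun_inv h0)

variable {E : Type*} [NormedAddCommGroup E] [NormedSpace ℝ E] {G : E → E →L[ℝ] E →L[ℝ] ℝ} {Ω : Set E}

/-- The covariant derivative of a vector field, as a field of endomorphisms. -/
def covDer (G : E → E →L[ℝ] E →L[ℝ] ℝ) (k : E → E) (z : E) : E →L[ℝ] E :=
  fderiv ℝ k z + (chrCLM G z).flip (k z)

theorem covDer_apply (k : E → E) (z u : E) :
    covDer G k z u = fderiv ℝ k z u + chrCLM G z u (k z) := rfl

/-- `k` is a smooth non-vanishing null vector field generating a shear-free geodesic congruence. -/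
structure IsShearFreeNull (G : E → E →L[ℝ] E →L[ℝ] ℝ) (Ω : Set E) (k : E → E) : Prop where
  smooth : ContDiffOn ℝ ∞ k Ω
  ne_zero : ∀ z ∈ Ω, k z ≠ 0
  null : ∀ z ∈ Ω, G z (k z) (k z) = 0
  geodesic : ∀ z ∈ Ω, ∀ v, G z (k z) v = 0 → extDerFlat (fun z => G z (k z)) z (k z) v = 0
  shearFree : ∀ z ∈ Ω, ∃ μ : ℝ, ∀ u v, G z (k z) u = 0 → G z (k z) v = 0 →
    lieTensorFlat k G z u v = μ * G z u v

variable [CompleteSpace E]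

omit [CompleteSpace E] in
theorem IsFlatMetric.exists_pairing_ne_zero (h : IsFlatMetric G Ω) {z u : E} (hz : z ∈ Ω)
    (hu : u ≠ 0) : ∃ n, G z u n ≠ 0 := by
  by_contra! hn
  exact hu (h.injective hz (u := u) (v := 0) fun w => by simp [hn w])

omit [CompleteSpace E] in
theorem IsFlatMetric.lieTensorFlat_eq (h : IsFlatMetric G Ω) (k : E → E) {z : E}
    (hz : z ∈ Ω) (u v : E) :
    lieTensorFlat k G z u v = G z (covDer G k z u) v + G z u (covDer G k z v) := by
  rw [lieTensorFlat, h.compat hz, covDer_apply, covDer_apply, h.chr_symm hz u, h.chr_symm hz v]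
  simp
  ring

omit [CompleteSpace E] in
theorem IsFlatMetric.extDerFlat_lower (h : IsFlatMetric G Ω) {k : E → E} {z : E} (hz : z ∈ Ω)
    (hk : DifferentiableAt ℝ k z) (u v : E) :
    extDerFlat (fun z => G z (k z)) z u v = G z (covDer G k z u) v - G z (covDer G k z v) u := by
  have h1 : fderiv ℝ (fun z => G z (k z)) z = _ :=
    ((h.differentiableAt hz).hasFDerivAt.clm_apply hk.hasFDerivAt).fderiv
  rw [extDerFlat, h1, covDer_apply, covDer_apply]
  simp [h.compat hz, h.chr_symm hz v u]
  ring

namespace IsShearFreeNull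

variable {k : E → E} (hk : IsShearFreeNull G Ω k) (h : IsFlatMetric G Ω)
include hk h

omit [CompleteSpace E] in
theorem differentiableAt {z : E} (hz : z ∈ Ω) : DifferentiableAt ℝ k z :=
  (hk.smooth.contDiffAt (h.isOpen.mem_nhds hz)).differentiableAt (by simp)

theorem contDiffOn_covDer : ContDiffOn ℝ ∞ (covDer G k) Ω :=
  (hk.smooth.fderiv_of_isOpen h.isOpen (by simp)).add
    (((ContinuousLinearMap.flipₗᵢ ℝ E E E).toContinuousLinearEquiv.contDiff.comp_contDiffOn
      h.contDiffOn_chrCLM).clm_apply hk.smooth)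

theorem differentiableAt_covDer {z : E} (hz : z ∈ Ω) : DifferentiableAt ℝ (covDer G k) z :=
  ((hk.contDiffOn_covDer h).contDiffAt (h.isOpen.mem_nhds hz)).differentiableAt (by simp)

-- Differentiate `g(k, k) = 0`.
omit [CompleteSpace E] in
theorem covDer_perp {z : E} (hz : z ∈ Ω) (u : E) : G z (covDer G k z u) (k z) = 0 := by
  have h1 : (fun z => G z (k z) (k z)) =ᶠ[𝓝 z] fun _ => 0 := by
    filter_upwards [h.isOpen.mem_nhds hz] with z hz using hk.null z hz
  have h2 := congrArg (fun A : E →L[ℝ] ℝ => A u) (h1.fderiv_eq (𝕜 := ℝ))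
  have h3 := h.fderiv_metric hz (hk.differentiableAt h hz) (hk.differentiableAt h hz) u
  simp only [fderiv_const_apply, zero_apply] at h2
  rw [h2, ← covDer_apply, h.symm z hz (k z)] at h3
  linarith

omit [CompleteSpace E] in
theorem covDer_self {z : E} (hz : z ∈ Ω) {v : E} (hv : G z (k z) v = 0) :
    G z (covDer G k z (k z)) v = 0 := by
  have h1 := hk.geodesic z hz v hv
  rw [h.extDerFlat_lower hz (hk.differentiableAt h hz), hk.covDer_perp h hz] at h1
  linarith

-- `∇_k k` is orthogonal to `k^⊥`, so it pairs like a multiple of `k`. The factor is read off on a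
-- vector `n` with `g(k, n) ≠ 0`, after projecting `v` to `k^⊥` along `n`.
omit [CompleteSpace E] in
theorem exists_covDer_self {z : E} (hz : z ∈ Ω) :
    ∃ l : ℝ, ∀ v, G z (covDer G k z (k z)) v = l * G z (k z) v := by
  obtain ⟨n, hn⟩ := h.exists_pairing_ne_zero hz (hk.ne_zero z hz)
  refine ⟨G z (covDer G k z (k z)) n / G z (k z) n, fun v => ?_⟩
  have h1 := hk.covDer_self h hz (v := v - (G z (k z) v / G z (k z) n) • n)
    (by simp; field_simp; ring)
  simp at h1
  field_simp at h1 ⊢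
  linarith

omit [CompleteSpace E] in
theorem exists_shear {z : E} (hz : z ∈ Ω) : ∃ φ : ℝ, ∀ u v, G z (k z) u = 0 → G z (k z) v = 0 →
    G z (covDer G k z u) v + G z u (covDer G k z v) = 2 * φ * G z u v := by
  obtain ⟨μ, hμ⟩ := hk.shearFree z hz
  refine ⟨μ / 2, fun u v hu hv => ?_⟩
  rw [← h.lieTensorFlat_eq k hz, hμ u v hu hv]
  ring

/-- The Ricci identity `R(a,b)k = (∇_a B)b - (∇_b B)a`. The terms `B(Γ(a,b))` of the covariant
derivatives do not appear because they are symmetric and cancel. -/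
theorem riemannFlat_apply {z : E} (hz : z ∈ Ω) (a b : E) :
    riemannFlat G z a b (k z) =
      (fderiv ℝ (covDer G k) z a b + chrCLM G z a (covDer G k z b)) -
        (fderiv ℝ (covDer G k) z b a + chrCLM G z b (covDer G k z a)) := by
  have hk2 : ContDiffAt ℝ ∞ k z := hk.smooth.contDiffAt (h.isOpen.mem_nhds hz)
  have hk1 : DifferentiableAt ℝ (fderiv ℝ k) z :=
    ((hk2.of_le two_le_smooth).fderiv_right (m := 1) (by norm_num)).differentiableAt (by simp)
  have hsymm : fderiv ℝ (fderiv ℝ k) z a b = fderiv ℝ (fderiv ℝ k) z b a :=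
    ((hk2.of_le two_le_smooth).isSymmSndFDerivAt (by simp)).eq a b
  have key : ∀ a b, fderiv ℝ (covDer G k) z a b = fderiv ℝ (fderiv ℝ k) z a b +
      fderiv ℝ (chrCLM G) z a b (k z) + chrCLM G z b (fderiv ℝ k z a) := by
    intro a b
    have h1 := (((hk.differentiableAt_covDer h hz).hasFDerivAt.clm_apply
      (hasFDerivAt_const b z))).fderiv
    have h2 : fderiv ℝ (fun z => covDer G k z b) z a = fderiv ℝ (covDer G k) z a b := by
      rw [h1]; simp
    have h3 : HasFDerivAt (fun z => fderiv ℝ k z b + chrCLM G z b (k z)) (_ : E →L[ℝ] E) z :=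
      (hk1.hasFDerivAt.clm_apply (hasFDerivAt_const b z)).add
        (((h.differentiableAt_chr hz).hasFDerivAt.clm_apply (hasFDerivAt_const b z)).clm_apply
          (hk.differentiableAt h hz).hasFDerivAt)
    rw [← h2]
    change fderiv ℝ (fun z => fderiv ℝ k z b + chrCLM G z b (k z)) z a = _
    rw [h3.fderiv]
    simp
    abel
  rw [key, key, riemannFlat, covDer_apply, covDer_apply, hsymm, map_add, map_add]
  abel

omit [CompleteSpace E] in
/-- A vector orthogonal to `k` extends to a differentiable vector field orthogonal to `k`. -/
theorem exists_extension {y : E} (hy : y ∈ Ω) {v : E} (hv : G y (k y) v = 0) :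
    ∃ V : E → E, V y = v ∧ DifferentiableAt ℝ V y ∧ ∀ᶠ z in 𝓝 y, G z (k z) (V z) = 0 := by
  obtain ⟨n, hn⟩ := h.exists_pairing_ne_zero hy (hk.ne_zero y hy)
  have hd : ∀ n, DifferentiableAt ℝ (fun z => G z (k z) n) y := fun n =>
    ((h.differentiableAt hy).clm_apply (hk.differentiableAt h hy)).clm_apply
      (differentiableAt_const n)
  refine ⟨fun z => v - (G z (k z) v / G z (k z) n) • n, by simp [hv],
    (differentiableAt_const v).sub ((differentiableAt_real_div (hd v) (hd n) hn).smul_const n), ?_⟩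
  filter_upwards [(hd n).continuousAt.eventually_ne hn] with z hz
  simp
  field_simp
  ring

/-- The trace-free part of the Sachs equation. -/
theorem sachs {y : E} (hy : y ∈ Ω) {s : E} (hs : G y (k y) s = 0) (hss : G y s s ≠ 0) :
    ∃ ρ : ℝ, ∀ v w, G y (k y) v = 0 → G y (k y) w = 0 →
      (∀ u, G y (k y) u = 0 → G y w u = 1 / 2 * extDerFlat (fun z => G z (k z)) y v u) →
      G y (k y) (riemannFlat G y (k y) v v) = ρ * G y v v + G y w w := by
  obtain ⟨S, hSy, hSd, hSp⟩ := hk.exists_extension h hy hs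
  obtain ⟨l, hl⟩ := hk.exists_covDer_self h hy
  set B := covDer G k with hB
  have hBd : DifferentiableAt ℝ B y := hk.differentiableAt_covDer h hy
  have hne : G y (S y) (S y) ≠ 0 := by rwa [hSy]
  -- The factor in the shear-free condition is only given point by point. Reading it off on the
  -- field `S`, of non-zero length near `y`, exhibits it as a differentiable function, the
  -- expansion.
  set φ : E → ℝ := fun z => G z (B z (S z)) (S z) / G z (S z) (S z) with hφ
  have hφd : DifferentiableAt ℝ φ y :=
    differentiableAt_real_div
      (((h.differentiableAt hy).clm_apply (hBd.clm_apply hSd)).clm_apply hSd)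
      (((h.differentiableAt hy).clm_apply hSd).clm_apply hSd) hne
  have hSne : ∀ᶠ z in 𝓝 y, G z (S z) (S z) ≠ 0 :=
    (((h.differentiableAt hy).clm_apply hSd).clm_apply hSd).continuousAt.eventually_ne hne
  have hshear : ∀ᶠ z in 𝓝 y, ∀ u v, G z (k z) u = 0 → G z (k z) v = 0 →
      G z (B z u) v + G z u (B z v) = 2 * φ z * G z u v := by
    filter_upwards [h.isOpen.mem_nhds hy, hSp, hSne] with z hz hzS hzne u v hu hv
    obtain ⟨ψ, hψ⟩ := hk.exists_shear h hz
    have h1 := hψ (S z) (S z) hzS hzS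
    rw [h.symm z hz (S z) (covDer G k z (S z))] at h1
    have h2 : φ z = ψ := by
      rw [hφ]
      simp only
      rw [div_eq_iff hzne]
      linarith
    rw [h2]
    exact hψ u v hu hv
  -- On the screen `B = φ + F` with `F` skew and `F v = w`, so `g(B²v, v) = φ² g(v,v) - g(w,w)`. All
  -- terms proportional to `g(v,v)` are collected in `ρ`.
  refine ⟨-(fderiv ℝ φ y (k y) - l * φ y + φ y ^ 2), fun v w hv hw hvw => ?_⟩
  obtain ⟨V, hVy, hVd, hVp⟩ := hk.exists_extension h hy hv
  have hBV : DifferentiableAt ℝ (fun z => B z (V z)) y := hBd.clm_apply hVd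
  have hkd := hk.differentiableAt h hy
  have hBk : DifferentiableAt ℝ (fun z => B z (k z)) y := hBd.clm_apply hkd
  have hDB : ∀ (X : E → E), DifferentiableAt ℝ X y → ∀ a,
      fderiv ℝ (fun z => B z (X z)) y a = fderiv ℝ B y a (X y) + B y (fderiv ℝ X y a) := by
    intro X hX a
    rw [(hBd.hasFDerivAt.clm_apply hX.hasFDerivAt).fderiv]
    simp [add_comm]
  have hsh := hshear.self_of_nhds
  -- the derivative along `k` of the expansion identity
  have e1 : (fun z => G z (B z (V z)) (V z)) =ᶠ[𝓝 y] fun z => φ z * G z (V z) (V z) := by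
    filter_upwards [h.isOpen.mem_nhds hy, hshear, hVp] with z hz hz1 hz2
    have := hz1 (V z) (V z) hz2 hz2
    rw [h.symm z hz (V z) (B z (V z))] at this
    linarith
  have d1 := congrArg (fun A : E →L[ℝ] ℝ => A (k y)) (e1.fderiv_eq (𝕜 := ℝ))
  have hVV : DifferentiableAt ℝ (fun z => G z (V z) (V z)) y :=
    ((h.differentiableAt hy).clm_apply hVd).clm_apply hVd
  have d2 := congrArg (fun A : E →L[ℝ] ℝ => A (k y)) (fderiv_fun_mul hφd hVV)
  simp only [add_apply, smul_apply, smul_eq_mul] at d1 d2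
  rw [d2, h.fderiv_metric hy hBV hVd, h.fderiv_metric hy hVd hVd, hDB V hVd, hVy] at d1
  -- the derivative along `v` of the geodesic identity
  have e2 : (fun z => G z (B z (k z)) (V z)) =ᶠ[𝓝 y] fun _ => 0 := by
    filter_upwards [h.isOpen.mem_nhds hy, hVp] with z hz hz2
    exact hk.covDer_self h hz hz2
  have d3 := congrArg (fun A : E →L[ℝ] ℝ => A v) (e2.fderiv_eq (𝕜 := ℝ))
  simp only [fderiv_const_apply, zero_apply] at d3
  rw [h.fderiv_metric hy hBk hVd, hDB k hkd, hVy] at d3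
  -- the derivatives of `g (k, V) = 0`
  have e3 : (fun z => G z (k z) (V z)) =ᶠ[𝓝 y] fun _ => 0 := hVp
  have d4 : ∀ a, G y (B y a) v + G y (k y) (fderiv ℝ V y a + chrCLM G y a v) = 0 := by
    intro a
    have d := congrArg (fun A : E →L[ℝ] ℝ => A a) (e3.fderiv_eq (𝕜 := ℝ))
    simp only [fderiv_const_apply, zero_apply] at d
    rw [h.fderiv_metric hy hkd hVd, hVy, ← covDer_apply] at d
    exact d
  -- The covariant derivatives `∇_k V` and `∇_v V`. The first is again orthogonal to `k`; the second
  -- has `g(k, ∇_v V) = -φ g(v,v)`, which is the source of the term with `l φ`.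
  set v' := fderiv ℝ V y (k y) + chrCLM G y (k y) v with hv'
  set v'' := fderiv ℝ V y v + chrCLM G y v v with hv''
  have hv'p : G y (k y) v' = 0 := by
    have := d4 (k y)
    rw [hk.covDer_self h hy hv] at this
    linarith
  have hBvp : G y (k y) (B y v) = 0 := by rw [h.symm y hy]; exact hk.covDer_perp h hy v
  have s1 := hsh v v' hv hv'p
  have s2 := hsh v v hv hv
  rw [h.symm y hy v (B y v)] at s2
  have s3 := hsh (B y v) v hBvp hv
  have s4 := d4 v
  have s5 := hl v''
  have hBveq : ∀ u, G y (k y) u = 0 → G y (B y v) u = φ y * G y v u + G y w u := by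
    intro u hu
    have t1 := hvw u hu
    rw [h.extDerFlat_lower hy hkd, h.symm y hy (covDer G k y u)] at t1
    have t2 := hsh v u hv hu
    rw [t1]
    linarith
  have t1 := hBveq (B y v) hBvp
  have t2 := hBveq v hv
  have t3 := hBveq w hw
  have hwv : G y w v = 0 := by
    rw [hvw v hv, extDerFlat]; ring
  rw [h.symm y hy v (B y v)] at t1
  rw [h.symm y hy w (B y v), t2, t3, h.symm y hy v w, hwv] at t1
  -- Coordinate derivatives are traded for covariant ones. The leftover `B(Γ(k,v))` occurs in both
  -- `d1` and `d3` and drops out of their difference, which is the curvature.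
  have hΓ : B y (fderiv ℝ V y (k y)) = B y v' - B y (chrCLM G y (k y) v) := by
    rw [hv', map_add, add_sub_cancel_right]
  have hΓ' : B y (fderiv ℝ k y v) = B y (B y v) - B y (chrCLM G y (k y) v) := by
    rw [h.chr_symm hy (k y) v, ← map_sub]
    congr 1
    rw [hB, covDer_apply, add_sub_cancel_right]
  have hR1 := hk.riemannFlat_apply h hy (k y) v
  rw [hΓ] at d1
  rw [hΓ'] at d3
  have hR2 := h.riemann_skew hy (k y) v (k y) v
  rw [hR1] at hR2
  have s4' : G y (k y) v'' = - (φ y * G y v v) := by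
    have h1 : G y (B y v) v + G y (k y) v'' = 0 := s4
    rw [t2, hwv] at h1
    linarith
  rw [s4'] at s5
  rw [t2, t1, hwv] at s3
  rw [h.symm y hy v (B y v'), h.symm y hy v v'] at s1
  rw [h.symm y hy v v'] at d1
  rw [← hB] at hR2
  simp only [map_add, map_sub, add_apply, sub_apply] at hR2 d1 d3
  linarith

end IsShearFreeNull

end Sachs

/-! ### `W(k,v,k,v)` as the trace-free part of the Jacobi operator of `k`. -/

section NullWeyl

set_option maxSynthPendingDepth 3

variable {d : ℕ} {G : Euc d → Euc d →L[ℝ] Euc d →L[ℝ] ℝ} {Ω : Set (Euc d)}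

/-- The trace of the rank-one map `x ↦ f x • a`, used for the traces in `ricci_null`. -/
theorem sum_apply_single (f : Euc d →ₗ[ℝ] ℝ) (a : Euc d) :
    ∑ c : Fin d, f (EuclideanSpace.single c 1) * a c = f a := by
  conv_rhs => rw [← (EuclideanSpace.basisFun (Fin d) ℝ).sum_repr a]
  simp [mul_comm]

/-- Of the four Schouten terms only `g(v,v) P(k,k)` survives, and in `P(k,k)` the scalar curvature
is multiplied by `g(k,k) = 0`. -/
theorem weylFlat_null {y k v : Euc d} (hkk : G y k k = 0) (hkv : G y k v = 0) (hvk : G y v k = 0) :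
    weylFlat G y k v k v =
      G y k (riemann G y k v v) - (1 / ((d : ℝ) - 2) * ricci G y k k) * G y v v := by
  have h1 : schouten G y k k = 1 / ((d : ℝ) - 2) * ricci G y k k := by
    rw [schouten, hkk, mul_zero, sub_zero]
  rw [weylFlat, hkk, hkv, hvk, h1]
  ring

/-- The Jacobi operator `x ↦ R(x,k)k`. -/
def jacobiOp (G : Euc d → Euc d →L[ℝ] Euc d →L[ℝ] ℝ) (y k : Euc d) : Euc d →ₗ[ℝ] Euc d where
  toFun x := riemannFlat G y x k k
  map_add' a b := by simp only [riemannFlat, map_add, add_apply]; abel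
  map_smul' r a := by
    simp only [riemannFlat, map_smul, smul_apply, RingHom.id_apply, smul_sub, smul_add]

theorem jacobiOp_apply (y k x : Euc d) : jacobiOp G y k x = riemannFlat G y x k k := rfl

/-- `Ric(k,k)` is the trace of `T = R(·,k)k`. The operator `T` is symmetric and kills `k`, so its
image lies in `k^⊥`; on `k^⊥` it is `l` modulo `k`. Only the `d - 2` screen directions contribute to
the trace. -/
theorem ricci_null (h : IsFlatMetric G Ω) {y k : Euc d} (hy : y ∈ Ω) (hk0 : k ≠ 0)
    (hkk : G y k k = 0) {l : ℝ}
    (hl : ∀ v, G y k v = 0 → G y k (riemannFlat G y k v v) = l * G y v v) :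
    ricci G y k k = (d - 2) * l := by
  obtain ⟨n, hn⟩ := h.exists_pairing_ne_zero hy hk0
  set T := jacobiOp G y k with hT
  have hsymm : ∀ x z, G y (T x) z = G y (T z) x := by
    intro x z
    rw [hT, jacobiOp_apply, jacobiOp_apply, h.riemann_pair hy, riemannFlat_antisymm, map_neg,
      neg_apply, h.riemann_skew hy, h.symm y hy x]
    ring
  have hTk : T k = 0 := by
    have := riemannFlat_antisymm G y k k k
    rw [hT, jacobiOp_apply]
    have h2 : (2 : ℝ) • riemannFlat G y k k k = 0 := by
      rw [two_smul]
      nth_rewrite 1 [this]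
      exact neg_add_cancel _
    simpa using h2
  have hTp : ∀ x, G y k (T x) = 0 := by
    intro x
    rw [h.symm y hy, hsymm, hTk]
    simp
  have hq : ∀ v, G y k v = 0 → G y (T v) v = l * G y v v := by
    intro v hv
    rw [← hl v hv, hT, jacobiOp_apply, riemannFlat_antisymm, map_neg, neg_apply,
      h.riemann_skew hy]
    ring
  have hpol : ∀ u v, G y k u = 0 → G y k v = 0 → G y (T u) v = l * G y u v := by
    intro u v hu hv
    have h1 := hq (u + v) (by rw [map_add, hu, hv, add_zero])
    have h2 := hq u hu
    have h3 := hq v hv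
    simp only [map_add, add_apply] at h1
    rw [hsymm v u, h.symm y hy v u] at h1
    linarith
  set c := (G y k n)⁻¹ with hc
  have hcn : c * G y k n = 1 := inv_mul_cancel₀ hn
  have hmain : ∀ x, T x = l • (x - (c * G y k x) • n) +
      (c * (G y (T x - (c * G y k x) • T n - l • (x - (c * G y k x) • n)) n)) • k +
      (c * G y k x) • T n := by
    intro x
    set x' := x - (c * G y k x) • n with hx'
    have hx'p : G y k x' = 0 := by
      rw [hx', map_sub, map_smul, smul_eq_mul]
      linear_combination -(G y k x) * hcn
    have hTx : T x - (c * G y k x) • T n = T x' := by rw [hx', map_sub, map_smul]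
    rw [hTx]
    have hgoal : T x' = l • x' + (c * (G y (T x' - l • x') n)) • k := by
      refine h.injective hy fun w => ?_
      have h1 := hpol x' (w - (c * G y k w) • n) hx'p (by
        rw [map_sub, map_smul, smul_eq_mul]
        linear_combination -(G y k w) * hcn)
      simp only [map_sub, map_smul, sub_apply, smul_apply, map_add, add_apply, smul_eq_mul] at h1 ⊢
      linarith
    rw [← hgoal, ← hTx]
    abel
  have hcomp : ricci G y k k = ∑ c : Fin d, T (EuclideanSpace.single c 1) c := by
    refine Finset.sum_congr rfl fun c _ => ?_
    rw [h.riemann_eq hy]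
    rfl
  let f : Euc d →ₗ[ℝ] ℝ :=
    { toFun := fun x => c * (G y (T x - (c * G y k x) • T n - l • (x - (c * G y k x) • n)) n)
      map_add' := by
        intro a b
        simp only [map_sub, map_smul, sub_apply, smul_apply, map_add, add_apply, smul_eq_mul]
        ring
      map_smul' := by
        intro r a
        simp only [map_sub, map_smul, sub_apply, smul_apply, smul_eq_mul, RingHom.id_apply]
        ring }
  let e : Euc d →ₗ[ℝ] ℝ := c • (G y k).toLinearMap
  have hterm : ∀ i : Fin d, T (EuclideanSpace.single i 1) i =
      l * 1 - l * (e (EuclideanSpace.single i 1) * n i) + f (EuclideanSpace.single i 1) * k i +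
        e (EuclideanSpace.single i 1) * T n i := by
    intro i
    have h1 := congrArg (fun z : Euc d => z i) (hmain (EuclideanSpace.single i 1))
    have hf : f (EuclideanSpace.single i 1) = c * (G y (T (EuclideanSpace.single i 1) -
        (c * G y k (EuclideanSpace.single i 1)) • T n - l • (EuclideanSpace.single i 1 -
          (c * G y k (EuclideanSpace.single i 1)) • n)) n) := rfl
    have he : e (EuclideanSpace.single i 1) = c * G y k (EuclideanSpace.single i 1) := rfl
    rw [he, hf]
    simp only [PiLp.add_apply, PiLp.sub_apply, PiLp.smul_apply, smul_eq_mul,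
      PiLp.single_apply, if_true] at h1
    rw [h1]
    ring
  rw [hcomp, Finset.sum_congr rfl fun i _ => hterm i]
  rw [Finset.sum_add_distrib, Finset.sum_add_distrib, Finset.sum_sub_distrib, ← Finset.mul_sum,
    ← Finset.mul_sum, sum_apply_single, sum_apply_single, sum_apply_single]
  have hek : ∀ x, e x = c * G y k x := fun _ => rfl
  have hfk : f k = - l := by
    change c * (G y (T k - (c * G y k k) • T n - l • (k - (c * G y k k) • n)) n) = -l
    rw [hTk, hkk]
    simp only [map_sub, map_smul, sub_apply, smul_apply, smul_eq_mul, mul_zero, zero_smul, map_zero,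
      zero_apply]
    linear_combination -l * hcn
  rw [hek, hek, hTp, hcn, hfk]
  simp
  ring

/-- For a twisting shear-free null geodesic congruence, the component `W(k,v,k,v)` of the Weyl
tensor vanishes exactly when the square of the twist endomorphism is a multiple of the identity. -/
theorem weylFlat_eq_zero_iff {k : Euc d → Euc d} (hk : IsShearFreeNull G Ω k)
    (h : IsFlatMetric G Ω) (hd : 2 < d) {y s : Euc d} (hy : y ∈ Ω) (hs : G y (k y) s = 0)
    (hss : G y s s ≠ 0) :
    (∀ v, G y (k y) v = 0 → weylFlat G y (k y) v (k y) v = 0) ↔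
      ∃ c : ℝ, ∀ v w, G y (k y) v = 0 → G y (k y) w = 0 →
        (∀ u, G y (k y) u = 0 →
          G y w u = 1 / 2 * extDerFlat (fun z => G z (k z)) y v u) → G y w w = c * G y v v := by
  obtain ⟨ρ, hρ⟩ := hk.sachs h hy hs hss
  have hkk := hk.null y hy
  have hW : ∀ v, G y (k y) v = 0 → weylFlat G y (k y) v (k y) v =
      G y (k y) (riemannFlat G y (k y) v v) -
        (1 / ((d : ℝ) - 2) * ricci G y (k y) (k y)) * G y v v := by
    intro v hv
    rw [weylFlat_null hkk hv (by rw [h.symm y hy, hv]), h.riemann_eq hy]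
  constructor
  · intro hw0
    -- The constant is forced: comparison of `ρ g(v,v) + g(w,w)` with the trace part `Ric(k,k)/(d-2)
    -- g(v,v)`.
    refine ⟨1 / ((d : ℝ) - 2) * ricci G y (k y) (k y) - ρ, fun v w hv hw hvw => ?_⟩
    have h1 := hρ v w hv hw hvw
    have h2 := hw0 v hv
    rw [hW v hv] at h2
    linarith
  · rintro ⟨c, hc⟩ v hv
    have key : ∀ v, G y (k y) v = 0 →
        G y (k y) (riemannFlat G y (k y) v v) = (ρ + c) * G y v v := by
      intro v hv
      -- `(G y).inverse α` is `F v`; the geodesic condition places it in `k^⊥`.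
      set α : Euc d →L[ℝ] ℝ := (1 / 2 : ℝ) • (fderiv ℝ (fun z => G z (k z)) y v -
        (fderiv ℝ (fun z => G z (k z)) y).flip v) with hα
      have hαu : ∀ u, G y ((G y).inverse α) u =
          1 / 2 * extDerFlat (fun z => G z (k z)) y v u := by
        intro u
        rw [self_apply_inverse (h.inv y hy), hα]
        simp [extDerFlat]
      have hwk : G y (k y) ((G y).inverse α) = 0 := by
        have h1 := hk.geodesic y hy v hv
        rw [h.symm y hy, hαu, extDerFlat_swap, h1]
        simp
      rw [hρ v _ hv hwk fun u _ => hαu u, hc v _ hv hwk fun u _ => hαu u]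
      ring
    have hd' : (d : ℝ) - 2 ≠ 0 := by
      have : (2 : ℝ) < d := by exact_mod_cast hd
      linarith
    rw [hW v hv, ricci_null h hy (hk.ne_zero y hy) hkk key, key v hv]
    field_simp
    ring

end NullWeyl

/-! ### Linear algebra of Lorentzian scalar products. -/

section LorentzForm

variable {E : Type*} [AddCommGroup E] [Module ℝ E] [TopologicalSpace E]

/-- A scalar product of signature `(+,…,+,-)`. -/
structure IsLorentzForm (b : E →L[ℝ] E →L[ℝ] ℝ) : Prop where
  symm : ∀ u v, b u v = b v u
  timelike : ∃ t, b t t < 0 ∧ ∀ v, b t v = 0 → v ≠ 0 → 0 < b v v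

namespace IsLorentzForm

variable {b : E →L[ℝ] E →L[ℝ] ℝ} (hb : IsLorentzForm b)
include hb

theorem exists_pairing_ne_zero {u : E} (hu : u ≠ 0) : ∃ n, b u n ≠ 0 := by
  by_contra! h
  obtain ⟨t, -, ht⟩ := hb.timelike
  exact (ht u (by rw [hb.symm, h]) hu).ne' (h u)

theorem eq_of_forall {u v : E} (h : ∀ w, b u w = b v w) : u = v := by
  by_contra hne
  obtain ⟨n, hn⟩ := hb.exists_pairing_ne_zero (sub_ne_zero.2 hne)
  exact hn (by rw [map_sub, sub_apply, h, sub_self])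

/-- Subtracting a multiple of `k` from `v` does not change `b v v`. The multiple `a` is the one that
makes the result orthogonal to the timelike `t`, where `b` is positive definite. -/
theorem null_perp {k v : E} (hkk : b k k = 0) (hk : k ≠ 0) (hv : b k v = 0) :
    0 ≤ b v v ∧ (b v v = 0 → ∃ r : ℝ, v = r • k) := by
  obtain ⟨t, -, ht⟩ := hb.timelike
  have htk : b t k ≠ 0 := fun h => (ht k h hk).ne' hkk
  set a : ℝ := b t v / b t k with ha
  have h1 : b (v - a • k) (v - a • k) = b v v := by
    simp only [map_sub, map_smul, sub_apply, smul_apply, smul_eq_mul]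
    rw [hkk, hb.symm v k, hv]
    ring
  by_cases h0 : v - a • k = 0
  · have h2 : b v v = 0 := by rw [← h1, h0, map_zero]
    exact ⟨h2.ge, fun _ => ⟨a, sub_eq_zero.1 h0⟩⟩
  · have h2 : 0 < b v v := by
      rw [← h1]
      refine ht _ ?_ h0
      rw [map_sub, map_smul, ha, smul_eq_mul, div_mul_cancel₀ _ htk, sub_self]
    exact ⟨h2.le, fun h => absurd h h2.ne'⟩

theorem pairing_timelike_ne_zero {k t : E} (hkk : b k k = 0) (hk : k ≠ 0) (ht : b t t < 0) :
    b k t ≠ 0 :=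
  fun h => absurd (hb.null_perp hkk hk h).1 (not_le.2 ht)

end IsLorentzForm

end LorentzForm

/-! ### Lorentzian metrics, lowered fields and the twist in charts. -/

section Metric

variable {d : ℕ} {M : Type*} [TopologicalSpace M] [ChartedSpace (Euc d) M]
  [IsManifold 𝓘(ℝ, Euc d) ∞ M]

theorem LorentzMetric.isLorentzForm (g : LorentzMetric d M) (x : M) : IsLorentzForm (g.val x) :=
  ⟨g.symm x, g.lorentzian x⟩

theorem isInvertible_of_injective {A : Euc d →L[ℝ] Euc d →L[ℝ] ℝ} (hA : Function.Injective A) :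
    A.IsInvertible := by
  have h1 : Module.finrank ℝ (Euc d) = Module.finrank ℝ (Euc d →L[ℝ] ℝ) :=
    ((LinearMap.toContinuousLinearMap (𝕜 := ℝ) (E := Euc d) (F' := ℝ)).finrank_eq.symm.trans
      Subspace.dual_finrank_eq).symm
  exact ⟨(LinearMap.linearEquivOfInjective A.toLinearMap hA h1).toContinuousLinearEquiv, by
    ext u v; rfl⟩

theorem surjective_chartInvDeriv {x₀ : M} {y : Euc d} (hy : y ∈ (chrt (d := d) x₀).target)
    (v : Tan d ((chrt (d := d) x₀).symm y)) : ∃ u, chartInvDeriv x₀ y u = v := by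
  exact ⟨_, self_apply_inverse (E := Euc d) (F := Euc d) (isInvertible_chartInvDeriv hy) v⟩

theorem chartInvDeriv_eq_zero {x₀ : M} {y : Euc d} (hy : y ∈ (chrt (d := d) x₀).target) {u : Euc d} :
    chartInvDeriv x₀ y u = 0 ↔ u = 0 := by
  have h := inverse_apply_eq_iff (E := Euc d) (F := Euc d) (isInvertible_chartInvDeriv hy) 0 u
  rw [map_zero] at h
  exact ⟨fun h1 => (h.2 h1.symm).symm, fun h1 => (h.1 h1.symm).symm⟩

theorem LorentzMetric.isFlatMetric (g : LorentzMetric d M) (x₀ : M) :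
    IsFlatMetric (tensorInChart g.val x₀) (chrt (d := d) x₀).target where
  isOpen := isOpen_extChartAt_target x₀
  smooth := contDiffOn_tensorInChart g x₀
  symm z _ u v := g.symm _ _ _
  inv z hz := by
    refine isInvertible_of_injective ((injective_iff_map_eq_zero _).2 fun u hu => ?_)
    rw [← chartInvDeriv_eq_zero hz]
    refine (g.isLorentzForm _).eq_of_forall fun w => ?_
    obtain ⟨v, rfl⟩ := surjective_chartInvDeriv hz w
    have h1 := congrArg (fun A : Euc d →L[ℝ] ℝ => A v) hu
    rw [map_zero, zero_apply]
    exact h1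

theorem IsFlatMetric.mono {G : Euc d → Euc d →L[ℝ] Euc d →L[ℝ] ℝ} {Ω Ω' : Set (Euc d)}
    (h : IsFlatMetric G Ω) (h' : IsOpen Ω') (hs : Ω' ⊆ Ω) : IsFlatMetric G Ω' :=
  ⟨h', h.smooth.mono hs, fun z hz => h.symm z (hs hz), fun z hz => h.inv z (hs hz)⟩

theorem formInChart_lowerVF (g : LorentzMetric d M) (k : ∀ x : M, Tan d x) {x₀ : M} {y : Euc d}
    (hy : y ∈ (chrt (d := d) x₀).target) :
    formInChart (lowerVF g k) x₀ y = tensorInChart g.val x₀ y (vfInChart k x₀ y) := by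
  ext u
  rw [formInChart_apply, tensorInChart_apply, chartInvDeriv_vfInChart k hy]
  rfl

theorem smoothOneForm_lowerVF (g : LorentzMetric d M) {k : ∀ x : M, Tan d x} {V : Set M}
    (hV : IsOpen V) (hk : SmoothVF k V) : SmoothOneForm (lowerVF g k) V := by
  refine smoothOneForm_of_chart fun x hx => ?_
  have hnb := (isOpen_chartDom (d := d) x hV).mem_nhds (coord_mem_chartDom hx)
  have h1 : ContDiffAt ℝ ∞ (fun y => tensorInChart g.val x y (vfInChart k x y)) (coord x) :=
    (((contDiffOn_tensorInChart g x).mono inter_subset_left).clm_apply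
      (contDiffOn_vfInChart hV hk x)).contDiffAt hnb
  refine h1.congr_of_eventuallyEq ?_
  filter_upwards [hnb] with y hy using formInChart_lowerVF g k hy.1

theorem extDer_smul {α : ∀ x : M, Tan d x →L[ℝ] ℝ} {f : M → ℝ} {V : Set M} (hV : IsOpen V)
    (hα : SmoothOneForm α V) (hf : ContMDiffOn 𝓘(ℝ, Euc d) 𝓘(ℝ, ℝ) ∞ f V) {x : M} (hx : x ∈ V)
    {β : ∀ x : M, Tan d x →L[ℝ] ℝ} (hβ : ∀ z ∈ V, β z = f z • α z) {u v : Tan d x}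
    (hu : α x u = 0) (hv : α x v = 0) : extDer β x u v = f x * extDer α x u v := by
  have hnb := (isOpen_chartDom x hV).mem_nhds (coord_mem_chartDom (d := d) hx)
  have h1 : formInChart β x =ᶠ[𝓝 (coord x)]
      fun y => f ((chrt (d := d) x).symm y) • formInChart α x y := by
    filter_upwards [hnb] with y hy
    ext u
    rw [formInChart_apply, hβ _ hy.2]
    rfl
  have h2 : DifferentiableAt ℝ (fun y => f ((chrt (d := d) x).symm y)) (coord x) :=
    ((contDiffOn_of_symm hf).contDiffAt hnb).differentiableAt (by simp)
  have h3 : DifferentiableAt ℝ (formInChart α x) (coord x) :=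
    ((contDiffOn_formInChart hV hα x).contDiffAt hnb).differentiableAt (by simp)
  have h4 : ∀ u : Euc d, formInChart α x (coord x) u = α x u := by
    intro u
    rw [formInChart_apply, chartInvDeriv_coord]
    exact form_congr α (symm_coord x) u
  have h5 := extDerFlat_smul h2 h3 (u := (u : Euc d)) (v := (v : Euc d)) ((h4 u).trans hu)
    ((h4 v).trans hv)
  rw [symm_coord] at h5
  exact (extDerFlat_congr h1 u v).trans h5

omit [IsManifold 𝓘(ℝ, Euc d) ∞ M] in
theorem extDer_swap (α : ∀ x : M, Tan d x →L[ℝ] ℝ) (x : M) (u v : Tan d x) :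
    extDer α x u v = - extDer α x v u :=
  extDerFlat_swap (formInChart α x) _ _ _

/-- The twist as a bilinear form on the tangent space. -/
def twistCLM (g : LorentzMetric d M) (k : ∀ x : M, Tan d x) (x : M) :
    Tan d x →L[ℝ] Tan d x →L[ℝ] ℝ :=
  let A : Euc d →L[ℝ] Euc d →L[ℝ] ℝ := fderiv ℝ (formInChart (lowerVF g k) x) (coord x)
  let A' : Euc d →L[ℝ] Euc d →L[ℝ] ℝ := (1 / 2 : ℝ) • (A - A.flip)
  A'

theorem twistCLM_apply (g : LorentzMetric d M) (k : ∀ x : M, Tan d x) (x : M) (u v : Tan d x) :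
    twistCLM g k x u v = twist g k x u v := rfl

theorem twist_smul_left (g : LorentzMetric d M) (k : ∀ x : M, Tan d x) (x : M) (r : ℝ)
    (u v : Tan d x) : twist g k x (r • u) v = r * twist g k x u v := by
  rw [← twistCLM_apply, ← twistCLM_apply, map_smul, smul_apply, smul_eq_mul]

theorem twist_swap (g : LorentzMetric d M) (k : ∀ x : M, Tan d x) (x : M) (u v : Tan d x) :
    twist g k x u v = - twist g k x v u := by
  rw [twist, twist, extDer_swap]
  ring

end Metric

/-! ### Optical geometries: the null line, its complement and the Weyl condition in terms of the
twist. -/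

section OpticalBasics

variable {d : ℕ} {M : Type*} [TopologicalSpace M] [ChartedSpace (Euc d) M]
  [IsManifold 𝓘(ℝ, Euc d) ∞ M] {c : ConformalStructure d M} {K : ∀ x : M, Submodule ℝ (Tan d x)}

namespace IsOptical

variable (hK : IsOptical c K)
include hK

theorem exists_local_field (x₀ : M) : ∃ V : Set M, IsOpen V ∧ x₀ ∈ V ∧
    ∃ k : ∀ x : M, Tan d x, IsOpticalField K k V := by
  obtain ⟨V, hV, hx, X, hX, h⟩ := hK.1 x₀
  refine ⟨V, hV, hx, X 0, hX 0, fun x hx => ⟨?_, (h x hx).1.ne_zero 0⟩⟩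
  rw [(h x hx).2]
  exact Submodule.subset_span ⟨0, rfl⟩

theorem mem_iff_smul {x : M} {k : Tan d x} (hk : k ∈ K x) (hk0 : k ≠ 0) (v : Tan d x) :
    v ∈ K x ↔ ∃ r : ℝ, v = r • k := by
  obtain ⟨V, hV, hx, X, hX, h⟩ := hK.1 x
  have hspan : K x = Submodule.span ℝ {X 0 x} := by
    rw [(h x hx).2]
    congr 1
    ext v
    simp [eq_comm, Fin.exists_fin_one]
  constructor
  · intro hv
    rw [hspan, Submodule.mem_span_singleton] at hv hk
    obtain ⟨a, rfl⟩ := hk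
    obtain ⟨b, rfl⟩ := hv
    have ha : a ≠ 0 := by rintro rfl; simp at hk0
    exact ⟨b / a, by rw [smul_smul, div_mul_cancel₀ _ ha]⟩
  · rintro ⟨r, rfl⟩
    exact (K x).smul_mem r hk

theorem null {g : LorentzMetric d M} (hg : g ∈ c.metrics) {x : M} {k : Tan d x} (hk : k ∈ K x) :
    g.val x k k = 0 := hK.2 g hg x k hk k hk

/-- The metrics of the class are proportional and `K x` is a line, so one metric and one vector
decide. -/
theorem mem_perp_iff {g : LorentzMetric d M} (hg : g ∈ c.metrics) {x : M} {k : Tan d x}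
    (hk : k ∈ K x) (hk0 : k ≠ 0) (v : Tan d x) : v ∈ perp c K x ↔ g.val x k v = 0 := by
  refine ⟨fun h => h g hg k hk, fun h g' hg' u hu => ?_⟩
  obtain ⟨r, rfl⟩ := (hK.mem_iff_smul hk hk0 u).1 hu
  obtain ⟨φ, -, hφ⟩ := (c.mem_iff g hg g').1 hg'
  rw [hφ, map_smul]
  simp [h]

theorem exists_ne_zero (x : M) : ∃ k ∈ K x, k ≠ 0 := by
  obtain ⟨V, hV, hx, k, hk⟩ := hK.exists_local_field x
  exact ⟨k x, hk.2 x hx⟩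

theorem le_perp (x : M) : K x ≤ perp c K x :=
  fun _ hv g hg u hu => hK.2 g hg x u hu _ hv

theorem nonneg_of_mem_perp {g : LorentzMetric d M} (hg : g ∈ c.metrics) {x : M} {v : Tan d x}
    (hv : v ∈ perp c K x) : 0 ≤ g.val x v v := by
  obtain ⟨k, hk, hk0⟩ := hK.exists_ne_zero x
  exact ((g.isLorentzForm x).null_perp (hK.null hg hk) hk0 (hv g hg k hk)).1

theorem mem_of_null {g : LorentzMetric d M} (hg : g ∈ c.metrics) {x : M} {v : Tan d x}
    (hv : v ∈ perp c K x) (h0 : g.val x v v = 0) : v ∈ K x := by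
  obtain ⟨k, hk, hk0⟩ := hK.exists_ne_zero x
  exact (hK.mem_iff_smul hk hk0 v).2
    (((g.isLorentzForm x).null_perp (hK.null hg hk) hk0 (hv g hg k hk)).2 h0)

theorem pos_of_not_mem {g : LorentzMetric d M} (hg : g ∈ c.metrics) {x : M} {v : Tan d x}
    (hv : v ∈ perp c K x) (h0 : v ∉ K x) : 0 < g.val x v v :=
  (hK.nonneg_of_mem_perp hg hv).lt_of_ne fun h => h0 (hK.mem_of_null hg hv h.symm)

theorem lowerVF_self {g : LorentzMetric d M} (hg : g ∈ c.metrics) {k : ∀ x : M, Tan d x} {V : Set M}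
    (hk : IsOpticalField K k V) : ∀ z ∈ V, lowerVF g k z (k z) = 0 :=
  fun z hz => hK.null hg (hk.2 z hz).1

end IsOptical

/-- `(M, c, K)` is an optical geometry whose congruence is geodesic, non-shearing and twisting. -/
structure IsTwistingOptical (c : ConformalStructure d M) (K : ∀ x : M, Submodule ℝ (Tan d x)) :
    Prop where
  optical : IsOptical c K
  geodesic : IsGeodesic c K
  nonShearing : IsNonShearing c K
  twisting : IsTwisting c K

/-- `w` represents the image of `v` under the twist endomorphism of the screen space. -/
def IsTwistRep (c : ConformalStructure d M) (K : ∀ x : M, Submodule ℝ (Tan d x))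
    (g : LorentzMetric d M) (k : ∀ x : M, Tan d x) (x : M) (v w : Tan d x) : Prop :=
  v ∈ perp c K x ∧ w ∈ perp c K x ∧ ∀ u ∈ perp c K x, g.val x w u = twist g k x v u

namespace IsTwistingOptical

variable (hK : IsTwistingOptical c K) {g : LorentzMetric d M} (hg : g ∈ c.metrics) {V : Set M}
  (hV : IsOpen V) {k : ∀ x : M, Tan d x} (hk : IsOpticalField K k V)
include hK hg hV hk

theorem extDer_self {x : M} (hx : x ∈ V) {v : Tan d x} (hv : v ∈ perp c K x) :
    extDer (lowerVF g k) x (k x) v = 0 := by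
  rw [← lieForm_eq hV hk.1 (smoothOneForm_lowerVF g hV hk.1) hx (hK.optical.lowerVF_self hg hk)]
  exact hK.geodesic g hg V k hV hk x hx v hv

theorem twist_self {x : M} (hx : x ∈ V) {v : Tan d x} (hv : v ∈ perp c K x) :
    twist g k x (k x) v = 0 := by
  rw [twist, hK.extDer_self hg hV hk hx hv, mul_zero]

theorem isShearFreeNull (x₀ : M) :
    IsShearFreeNull (tensorInChart g.val x₀) (chartDom (d := d) x₀ V) (vfInChart k x₀) := by
  have hperp : ∀ z ∈ chartDom (d := d) x₀ V, ∀ v : Euc d,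
      tensorInChart g.val x₀ z (vfInChart k x₀ z) v = 0 ↔
        chartInvDeriv x₀ z v ∈ perp c K ((chrt (d := d) x₀).symm z) := by
    intro z hz v
    rw [tensorInChart_apply, chartInvDeriv_vfInChart k hz.1,
      hK.optical.mem_perp_iff hg (hk.2 _ hz.2).1 (hk.2 _ hz.2).2]
  refine ⟨contDiffOn_vfInChart hV hk.1 x₀, fun z hz h0 => ?_, fun z hz => ?_, fun z hz v hv => ?_,
    fun z hz => ?_⟩
  · refine (hk.2 _ hz.2).2 ?_
    rw [← chartInvDeriv_vfInChart k hz.1, h0, map_zero]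
  · rw [tensorInChart_apply, chartInvDeriv_vfInChart k hz.1]
    exact hK.optical.null hg (hk.2 _ hz.2).1
  · have h1 := extDer_chart hV (smoothOneForm_lowerVF g hV hk.1) hz (vfInChart k x₀ z) v
    rw [chartInvDeriv_vfInChart k hz.1,
      hK.extDer_self hg hV hk hz.2 ((hperp z hz v).1 hv)] at h1
    refine (extDerFlat_congr ?_ _ _).trans h1.symm
    filter_upwards [(isOpen_chartDom x₀ hV).mem_nhds hz] with y hy
    exact (formInChart_lowerVF g k hy.1).symm
  · obtain ⟨μ, hμ⟩ := hK.nonShearing g hg V k hV hk _ hz.2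
    refine ⟨μ, fun u v hu hv => ?_⟩
    rw [← lieTensor_chart hV hk.1 g hz, hμ _ ((hperp z hz u).1 hu) _ ((hperp z hz v).1 hv)]
    rfl

/-- The condition `W(k,v,k,v) = 0` in terms of the twist. -/
theorem weyl_eq_zero_iff (hd : 2 < d) {x : M} (hx : x ∈ V) :
    (∀ v ∈ perp c K x, g.weyl x (k x) v (k x) v = 0) ↔
      ∃ a : ℝ, ∀ v w, IsTwistRep c K g k x v w → g.val x w w = a * g.val x v v := by
  have hy := coord_mem_chartDom (d := d) hx
  have hG : ∀ u v : Euc d, tensorInChart g.val x (coord x) u v = g.val x u v := by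
    intro u v
    rw [tensorInChart_apply, chartInvDeriv_coord, chartInvDeriv_coord]
    exact tensor_congr g.val (symm_coord x) u v
  have hkx : vfInChart k x (coord x) = k x := vfInChart_coord k x
  have hperp : ∀ v : Euc d, tensorInChart g.val x (coord x) (vfInChart k x (coord x)) v = 0 ↔
      (v : Tan d x) ∈ perp c K x := by
    intro v
    have h1 : tensorInChart g.val x (coord x) (vfInChart k x (coord x)) v = g.val x (k x) v :=
      (congrArg (fun w : Euc d => tensorInChart g.val x (coord x) w v) hkx).trans (hG _ _)
    rw [h1]
    exact (hK.optical.mem_perp_iff hg (hk.2 x hx).1 (hk.2 x hx).2 v).symm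
  -- Since the twist annihilates `k`, a vector with non-zero twist lies outside `K` and is
  -- spacelike: it is the reference vector required by the Sachs equation.
  obtain ⟨s, hs, s', hs', hss'⟩ := hK.twisting g hg V k hV hk x hx
  have hsK : s ∉ K x := by
    intro h
    obtain ⟨r, rfl⟩ := (hK.optical.mem_iff_smul (hk.2 x hx).1 (hk.2 x hx).2 s).1 h
    refine hss' ?_
    rw [twist_smul_left, hK.twist_self hg hV hk hx hs', mul_zero]
  have key := weylFlat_eq_zero_iff (hK.isShearFreeNull hg hV hk x)
    ((g.isFlatMetric x).mono (isOpen_chartDom x hV) inter_subset_left) hd hy (s := s)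
    ((hperp s).2 hs) (ne_of_eq_of_ne (hG s s) (hK.optical.pos_of_not_mem hg hs hsK).ne')
  have hext : ∀ u v : Euc d, 1 / 2 * extDerFlat
      (fun z => tensorInChart g.val x z (vfInChart k x z)) (coord x) u v = twist g k x u v := by
    intro u v
    refine congrArg (fun t : ℝ => 1 / 2 * t) (extDerFlat_congr ?_ u v)
    filter_upwards [(isOpen_chartDom x hV).mem_nhds hy] with z hz
    exact (formInChart_lowerVF g k hz.1).symm
  simp only [hperp, hext] at key
  simp only [hG] at key
  rw [hkx] at key
  refine key.trans (exists_congr fun a => ?_)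
  exact ⟨fun h v w hr => h v w hr.1 hr.2.1 hr.2.2, fun h v w h1 h2 h3 => h v w ⟨h1, h2, h3⟩⟩

end IsTwistingOptical

end OpticalBasics

/-! ### Smoothness of the transpose of a bilinear form. -/

section FlipSmooth

set_option maxSynthPendingDepth 3

theorem contDiffOn_flip {E : Type*} [NormedAddCommGroup E] [NormedSpace ℝ E]
    {A : E → E →L[ℝ] E →L[ℝ] ℝ} {Ω : Set E} (hA : ContDiffOn ℝ ∞ A Ω) :
    ContDiffOn ℝ ∞ (fun y => (A y).flip) Ω :=
  (ContinuousLinearMap.flipₗᵢ ℝ E E ℝ).toContinuousLinearEquiv.contDiff.comp_contDiffOn hA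

end FlipSmooth

/-! ### Smooth fields and the twist endomorphism as a smooth tensor. -/

section SmoothTools

variable {d : ℕ} {M : Type*} [TopologicalSpace M] [ChartedSpace (Euc d) M]

variable [IsManifold 𝓘(ℝ, Euc d) ∞ M]

theorem SmoothVF.mono {X : ∀ x : M, Tan d x} {V W : Set M} (hX : SmoothVF X V) (h : W ⊆ V) :
    SmoothVF X W := ContMDiffOn.mono hX h

theorem SmoothVF.smul {X : ∀ x : M, Tan d x} {f : M → ℝ} {V : Set M}
    (hf : ContMDiffOn 𝓘(ℝ, Euc d) 𝓘(ℝ, ℝ) ∞ f V) (hX : SmoothVF X V) :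
    SmoothVF (fun x => f x • X x) V :=
  ContMDiffOn.smul_section (V := fun x : M => Tan d x) hf hX

theorem SmoothVF.sub {X Y : ∀ x : M, Tan d x} {V : Set M} (hX : SmoothVF X V)
    (hY : SmoothVF Y V) : SmoothVF (fun x => X x - Y x) V :=
  ContMDiffOn.sub_section (V := fun x : M => Tan d x) hX hY

theorem SmoothVF.add {X Y : ∀ x : M, Tan d x} {V : Set M} (hX : SmoothVF X V)
    (hY : SmoothVF Y V) : SmoothVF (fun x => X x + Y x) V :=
  ContMDiffOn.add_section (V := fun x : M => Tan d x) hX hY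

theorem SmoothVF.congr {X Y : ∀ x : M, Tan d x} {V : Set M} (hX : SmoothVF X V)
    (h : ∀ x ∈ V, Y x = X x) : SmoothVF Y V :=
  ContMDiffOn.congr hX fun x hx => by rw [h x hx]

theorem contMDiffOn_metric (g : LorentzMetric d M) {X Y : ∀ x : M, Tan d x} {V : Set M}
    (hV : IsOpen V) (hX : SmoothVF X V) (hY : SmoothVF Y V) :
    ContMDiffOn 𝓘(ℝ, Euc d) 𝓘(ℝ, ℝ) ∞ (fun x => g.val x (X x) (Y x)) V := by
  intro x hx
  have h2 := ContMDiffAt.clm_bundle_apply₂ (F₁ := Euc d) (F₂ := Euc d) (F₃ := ℝ)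
    (E₃ := fun _ : M => ℝ)
    g.smooth.contMDiffAt (hX.contMDiffAt (hV.mem_nhds hx)) (hY.contMDiffAt (hV.mem_nhds hx))
  simp only [Bundle.contMDiffAt_totalSpace] at h2
  exact h2.2.contMDiffWithinAt

omit [IsManifold 𝓘(ℝ, Euc d) ∞ M] in
theorem contMDiffOn_real_div {f h : M → ℝ} {V : Set M}
    (hf : ContMDiffOn 𝓘(ℝ, Euc d) 𝓘(ℝ, ℝ) ∞ f V) (hh : ContMDiffOn 𝓘(ℝ, Euc d) 𝓘(ℝ, ℝ) ∞ h V)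
    (h0 : ∀ x ∈ V, h x ≠ 0) : ContMDiffOn 𝓘(ℝ, Euc d) 𝓘(ℝ, ℝ) ∞ (fun x => f x / h x) V :=
  hf.div₀ hh h0

/-- Every tangent vector extends to a smooth vector field on a neighbourhood. -/
theorem exists_smoothVF (x : M) (v : Tan d x) : ∃ X : ∀ x : M, Tan d x,
    SmoothVF X (chrt (d := d) x).source ∧ X x = v := by
  refine ⟨chartVF x fun _ => v, smoothVF_chartVF (isOpen_extChartAt_source x) subset_rfl
    contDiffOn_const, ?_⟩
  have h1 := vfInChart_chartVF (mem_extChartAt_target (I := 𝓘(ℝ, Euc d)) x) fun _ : Euc d => v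
  exact (vfInChart_coord (chartVF x fun _ => v) x).symm.trans h1

/-- The scalar product at a point, as a bilinear form on the model space. -/
def LorentzMetric.modelForm (g : LorentzMetric d M) (x : M) : Euc d →L[ℝ] Euc d →L[ℝ] ℝ := g.val x

theorem LorentzMetric.isInvertible_modelForm (g : LorentzMetric d M) (x : M) :
    (g.modelForm x).IsInvertible :=
  isInvertible_of_injective fun _ _ h =>
    (g.isLorentzForm x).eq_of_forall fun w => congrArg (fun A : Euc d →L[ℝ] ℝ => A w) h

/-- The endomorphism `F` with `g(F v, u) = τ(v, u)`. -/
def twistMap (g : LorentzMetric d M) (k : ∀ x : M, Tan d x) (x : M) : Tan d x →L[ℝ] Tan d x :=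
  let B : Euc d →L[ℝ] Euc d →L[ℝ] ℝ := twistCLM g k x
  let F : Euc d →L[ℝ] Euc d := (g.modelForm x).inverse.comp B
  F

theorem twistMap_spec (g : LorentzMetric d M) (k : ∀ x : M, Tan d x) (x : M) (v u : Tan d x) :
    g.val x (twistMap g k x v) u = twist g k x v u := by
  exact congrArg (fun A : Euc d →L[ℝ] ℝ => A u)
    (self_apply_inverse (g.isInvertible_modelForm x) (twistCLM g k x v))

theorem twist_chart (g : LorentzMetric d M) {k : ∀ x : M, Tan d x} {V : Set M} (hV : IsOpen V)
    (hk : SmoothVF k V) {x₀ : M} {y : Euc d} (hy : y ∈ chartDom (d := d) x₀ V) (u v : Euc d) :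
    twist g k ((chrt (d := d) x₀).symm y) (chartInvDeriv x₀ y u) (chartInvDeriv x₀ y v) =
      1 / 2 * extDerFlat (formInChart (lowerVF g k) x₀) y u v := by
  rw [twist, extDer_chart hV (smoothOneForm_lowerVF g hV hk) hy]

/-- The twist map in terms of the metric and of `κ`, in a chart. -/
def twistMapFlat (G : Euc d → Euc d →L[ℝ] Euc d →L[ℝ] ℝ) (α : Euc d → Euc d →L[ℝ] ℝ)
    (X : Euc d → Euc d) (y : Euc d) : Euc d :=
  (G y).inverse ((1 / 2 : ℝ) • (fderiv ℝ α y (X y) - (fderiv ℝ α y).flip (X y)))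

theorem contDiffOn_twistMapFlat {G : Euc d → Euc d →L[ℝ] Euc d →L[ℝ] ℝ}
    {α : Euc d → Euc d →L[ℝ] ℝ} {X : Euc d → Euc d} {Ω Ω' : Set (Euc d)} (hG : IsFlatMetric G Ω')
    (hs : Ω ⊆ Ω') (hΩ : IsOpen Ω) (hα : ContDiffOn ℝ ∞ α Ω) (hX : ContDiffOn ℝ ∞ X Ω) :
    ContDiffOn ℝ ∞ (twistMapFlat G α X) Ω := by
  have hα1 : ContDiffOn ℝ ∞ (fderiv ℝ α) Ω := hα.fderiv_of_isOpen hΩ (by simp)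
  have h1 : ContDiffOn ℝ ∞ (fun y => fderiv ℝ α y (X y)) Ω := hα1.clm_apply hX
  have h2 : ContDiffOn ℝ ∞ (fun y => (fderiv ℝ α y).flip) Ω :=
    contDiffOn_flip hα1
  have h3 : ContDiffOn ℝ ∞ (fun y => (fderiv ℝ α y).flip (X y)) Ω := h2.clm_apply hX
  exact (hG.contDiffOn_inverse.mono hs).clm_apply ((h1.sub h3).const_smul (1 / 2 : ℝ))

theorem twistMapFlat_spec {G : Euc d → Euc d →L[ℝ] Euc d →L[ℝ] ℝ}
    {α : Euc d → Euc d →L[ℝ] ℝ} {X : Euc d → Euc d} {y : Euc d} (hG : (G y).IsInvertible)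
    (w : Euc d) : G y (twistMapFlat G α X y) w = 1 / 2 * extDerFlat α y (X y) w := by
  rw [twistMapFlat, self_apply_inverse hG, extDerFlat]
  rfl

theorem vfInChart_twistMap (g : LorentzMetric d M) {k : ∀ x : M, Tan d x} {V : Set M}
    (hV : IsOpen V) (hk : SmoothVF k V) (X : ∀ x : M, Tan d x) {x₀ : M} {y : Euc d}
    (hy : y ∈ chartDom (d := d) x₀ V) :
    vfInChart (fun x => twistMap g k x (X x)) x₀ y =
      twistMapFlat (tensorInChart g.val x₀) (formInChart (lowerVF g k) x₀) (vfInChart X x₀) y := by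
  refine (vfInChart_eq_iff _ hy.1 _).2 ((g.isLorentzForm _).eq_of_forall fun w => ?_)
  obtain ⟨w, rfl⟩ := surjective_chartInvDeriv hy.1 w
  have h1 := twist_chart g hV hk hy (vfInChart X x₀ y) w
  rw [chartInvDeriv_vfInChart X hy.1] at h1
  exact (twistMap_spec g k _ _ _).trans
    (h1.trans (twistMapFlat_spec ((g.isFlatMetric x₀).inv y hy.1) w).symm)

theorem smoothVF_twistMap (g : LorentzMetric d M) {k X : ∀ x : M, Tan d x} {V : Set M}
    (hV : IsOpen V) (hk : SmoothVF k V) (hX : SmoothVF X V) :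
    SmoothVF (fun x => twistMap g k x (X x)) V := by
  refine smoothVF_of_chart fun x hx => ?_
  refine ⟨x, V ∩ (chrt (d := d) x).source, hV.inter (isOpen_extChartAt_source x),
    ⟨hx, mem_extChartAt_source x⟩, inter_subset_right, ?_⟩
  refine ((contDiffOn_twistMapFlat (g.isFlatMetric x) inter_subset_left (isOpen_chartDom x hV)
    (contDiffOn_formInChart hV (smoothOneForm_lowerVF g hV hk) x)
    (contDiffOn_vfInChart hV hX x)).congr fun y hy =>
      vfInChart_twistMap g hV hk X hy).mono (chartDom_mono x inter_subset_left)

-- Serves to show that a factor of proportionality chosen point by point is smooth.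
omit [IsManifold 𝓘(ℝ, Euc d) ∞ M] in
theorem contMDiffAt_of_eventuallyEq_div {a f h : M → ℝ} {V : Set M} {x : M} (hV : IsOpen V)
    (hx : x ∈ V)
    (hf : ContMDiffOn 𝓘(ℝ, Euc d) 𝓘(ℝ, ℝ) ∞ f V) (hh : ContMDiffOn 𝓘(ℝ, Euc d) 𝓘(ℝ, ℝ) ∞ h V)
    (h0 : h x ≠ 0) (ha : ∀ z ∈ V, f z = a z * h z) :
    ContMDiffAt 𝓘(ℝ, Euc d) 𝓘(ℝ, ℝ) ∞ a x := by
  have h1 : ContMDiffAt 𝓘(ℝ, Euc d) 𝓘(ℝ, ℝ) ∞ (fun x => f x / h x) x :=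
    (hf.contMDiffAt (hV.mem_nhds hx)).div₀ (hh.contMDiffAt (hV.mem_nhds hx)) h0
  refine h1.congr_of_eventuallyEq ?_
  filter_upwards [hV.mem_nhds hx,
    (hh.contMDiffAt (hV.mem_nhds hx)).continuousAt.eventually_ne h0] with z hz hz0
  rw [ha z hz, mul_div_cancel_right₀ _ hz0]

end SmoothTools

/-! ### Local sections of `K^⊥` and a global optical vector field. -/

section Normalize

variable {d : ℕ} {M : Type*} [TopologicalSpace M] [ChartedSpace (Euc d) M]
  [IsManifold 𝓘(ℝ, Euc d) ∞ M] {c : ConformalStructure d M} {K : ∀ x : M, Submodule ℝ (Tan d x)}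

/-- A vector of `K^⊥` extends to a smooth local section of `K^⊥`. -/
theorem IsOptical.exists_section (hK : IsOptical c K) (x : M) {v : Tan d x}
    (hv : v ∈ perp c K x) : ∃ V : Set M, IsOpen V ∧ x ∈ V ∧ ∃ X : ∀ x : M, Tan d x,
      SmoothVF X V ∧ X x = v ∧ ∀ z ∈ V, X z ∈ perp c K z := by
  obtain ⟨g, hg⟩ := c.nonempty
  obtain ⟨V, hV, hx, k, hk⟩ := hK.exists_local_field x
  obtain ⟨n, hn⟩ := (g.isLorentzForm x).exists_pairing_ne_zero (hk.2 x hx).2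
  obtain ⟨X, hX, hXv⟩ := exists_smoothVF x v
  obtain ⟨N, hN, hNn⟩ := exists_smoothVF x n
  set W := V ∩ (chrt (d := d) x).source with hW
  have hWo : IsOpen W := hV.inter (isOpen_extChartAt_source x)
  have hxW : x ∈ W := ⟨hx, mem_extChartAt_source x⟩
  have hkN := contMDiffOn_metric g hWo (hk.1.mono inter_subset_left) (hN.mono inter_subset_right)
  have hkX := contMDiffOn_metric g hWo (hk.1.mono inter_subset_left) (hX.mono inter_subset_right)
  set W' := W ∩ {z | g.val z (k z) (N z) ≠ 0} with hW'
  have hW'o : IsOpen W' := hkN.continuousOn.isOpen_inter_preimage hWo isOpen_ne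
  -- An arbitrary extension `X` of `v` is projected to `K^⊥` along a field `N` transversal to it.
  refine ⟨W', hW'o, ⟨hxW, by rwa [mem_ofPred_eq, hNn]⟩,
    fun z => X z - (g.val z (k z) (X z) / g.val z (k z) (N z)) • N z, ?_, ?_, ?_⟩
  · exact (hX.mono fun z hz => hz.1.2).sub
      (SmoothVF.smul (contMDiffOn_real_div (hkX.mono inter_subset_left)
        (hkN.mono inter_subset_left) fun z hz => hz.2) (hN.mono fun z hz => hz.1.2))
  · dsimp only
    rw [hXv, hv g hg _ (hk.2 x hx).1, zero_div, zero_smul, sub_zero]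
  · intro z hz
    rw [hK.mem_perp_iff hg (hk.2 z hz.1.1).1 (hk.2 z hz.1.1).2, map_sub, map_smul, smul_eq_mul,
      div_mul_cancel₀ _ hz.2, sub_self]

theorem IsOptical.exists_global_field (hK : IsOptical c K) (hc : c.TimeOrientable) :
    ∃ k, IsOpticalField K k univ := by
  obtain ⟨g, hg⟩ := c.nonempty
  obtain ⟨T, hT, hTt⟩ := hc
  -- A timelike vector is never orthogonal to a null one, so `g(k, T) = -1` singles out one vector
  -- in each line. Being unique, it is the rescaling of any smooth local section, hence smooth.
  have hex : ∀ x, ∃ k ∈ K x, g.val x k (T x) = -1 := by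
    intro x
    obtain ⟨k, hk, hk0⟩ := hK.exists_ne_zero x
    have h1 := (g.isLorentzForm x).pairing_timelike_ne_zero (hK.null hg hk) hk0 (hTt g hg x)
    refine ⟨(-(g.val x k (T x))⁻¹) • k, (K x).smul_mem _ hk, ?_⟩
    rw [map_smul, smul_apply, smul_eq_mul, neg_mul, inv_mul_cancel₀ h1]
  choose k hk hkT using hex
  refine ⟨k, fun x _ => ?_, fun x _ => ⟨hk x, fun h => ?_⟩⟩
  · obtain ⟨V, hV, hx, k', hk'⟩ := hK.exists_local_field x
    have hne : ∀ z ∈ V, g.val z (k' z) (T z) ≠ 0 := fun z hz =>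
      (g.isLorentzForm z).pairing_timelike_ne_zero (hK.null hg (hk'.2 z hz).1) (hk'.2 z hz).2
        (hTt g hg z)
    have h1 : SmoothVF (fun z => (-1 / g.val z (k' z) (T z)) • k' z) V :=
      SmoothVF.smul (contMDiffOn_real_div contMDiffOn_const
        (contMDiffOn_metric g hV hk'.1 (hT.mono (subset_univ V))) hne) hk'.1
    have h2 : SmoothVF k V := h1.congr fun z hz => by
      obtain ⟨r, hr⟩ := (hK.mem_iff_smul (hk'.2 z hz).1 (hk'.2 z hz).2 (k z)).1 (hk z)
      have h3 := hkT z
      rw [hr, map_smul, smul_apply, smul_eq_mul] at h3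
      rw [hr, ← h3, mul_div_cancel_right₀ _ (hne z hz)]
    exact (h2.contMDiffAt (hV.mem_nhds hx)).contMDiffWithinAt
  · have h1 := hkT x
    rw [h, map_zero, zero_apply] at h1
    norm_num at h1

end Normalize

/-! ### Homogeneity of `W(k,v,k,v)` in `k`. -/

section WeylScaling

variable {d : ℕ} {M : Type*} [TopologicalSpace M] [ChartedSpace (Euc d) M]
  [IsManifold 𝓘(ℝ, Euc d) ∞ M] {c : ConformalStructure d M} {K : ∀ x : M, Submodule ℝ (Tan d x)}

theorem weylFlat_smul {G : Euc d → Euc d →L[ℝ] Euc d →L[ℝ] ℝ} {Ω : Set (Euc d)}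
    (h : IsFlatMetric G Ω) {y k v : Euc d} (hy : y ∈ Ω) (hkk : G y k k = 0) (hkv : G y k v = 0)
    (r : ℝ) : weylFlat G y (r • k) v (r • k) v = r ^ 2 * weylFlat G y k v k v := by
  have hvk : G y v k = 0 := by rw [h.symm y hy, hkv]
  have hR : riemannFlat G y (r • k) v v = r • riemannFlat G y k v v := by
    simp only [riemannFlat, map_smul, smul_apply, smul_sub, smul_add]
  have hRic : ricci G y (r • k) (r • k) = r ^ 2 * ricci G y k k := by
    rw [ricci, ricci, Finset.mul_sum]
    refine Finset.sum_congr rfl fun i _ => ?_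
    rw [h.riemann_eq hy, h.riemann_eq hy]
    have h1 : ∀ e : Euc d, riemannFlat G y e (r • k) (r • k) = r ^ 2 • riemannFlat G y e k k := by
      intro e
      simp only [riemannFlat, map_smul, smul_apply, smul_sub, smul_add, smul_smul, pow_two]
    rw [h1]
    rfl
  rw [weylFlat_null hkk hkv hvk, weylFlat_null (by simp [hkk]) (by simp [hkv]) (by simp [hvk]),
    h.riemann_eq hy, h.riemann_eq hy, hR, hRic]
  simp
  ring

namespace IsTwistingOptical

variable (hK : IsTwistingOptical c K)
include hK

theorem weyl_smul {g : LorentzMetric d M} (hg : g ∈ c.metrics) {x : M} {k v : Tan d x}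
    (hk : k ∈ K x) (hv : v ∈ perp c K x) (r : ℝ) :
    g.weyl x (r • k) v (r • k) v = r ^ 2 * g.weyl x k v k v := by
  have hG : ∀ u v : Euc d, tensorInChart g.val x (coord x) u v = g.val x u v := by
    intro u v
    rw [tensorInChart_apply, chartInvDeriv_coord, chartInvDeriv_coord]
    exact tensor_congr g.val (symm_coord x) u v
  exact weylFlat_smul (g.isFlatMetric x) (mem_extChartAt_target (I := 𝓘(ℝ, Euc d)) x)
    ((hG k k).trans (hK.optical.null hg hk)) ((hG k v).trans (hv g hg k hk)) r

end IsTwistingOptical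

end WeylScaling

/-! ### The twist endomorphism of the screen and its normalisation. -/

section TwistEndo

variable {d : ℕ} {M : Type*} [TopologicalSpace M] [ChartedSpace (Euc d) M]
  [IsManifold 𝓘(ℝ, Euc d) ∞ M] {c : ConformalStructure d M} {K : ∀ x : M, Submodule ℝ (Tan d x)}

theorem screen_mk_eq {x : M} {v w : perp c K x} :
    (Submodule.Quotient.mk v : Screen c K x) = Submodule.Quotient.mk w ↔
      (v : Tan d x) - w ∈ K x := by
  rw [Submodule.Quotient.eq]
  rfl

/-- The difference is orthogonal to itself, and null vectors of `K^⊥` lie in `K`. -/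
theorem IsOptical.sub_mem_of_forall (hK : IsOptical c K) {g : LorentzMetric d M}
    (hg : g ∈ c.metrics) {x : M} {v w : Tan d x} (hv : v ∈ perp c K x) (hw : w ∈ perp c K x)
    (h : ∀ u ∈ perp c K x, g.val x v u = g.val x w u) : v - w ∈ K x := by
  have hp := (perp c K x).sub_mem hv hw
  refine hK.mem_of_null hg hp ?_
  rw [ContinuousLinearMap.map_sub₂, h _ hp, sub_self]

/-- The metric and `κ` acquire the same factor `e^{2φ}`, whose differential is invisible on `K^⊥ =
ker κ`. Hence the twist endomorphism is the same for the whole conformal class. -/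
theorem IsOpticalField.twist_conformal {k : ∀ x : M, Tan d x} {V : Set M}
    (hk : IsOpticalField K k V) (hV : IsOpen V) {g : LorentzMetric d M} (hg : g ∈ c.metrics)
    {g' : LorentzMetric d M} (hg' : g' ∈ c.metrics) :
    ∃ f : M → ℝ, ∀ x ∈ V, g'.val x = f x • g.val x ∧ ∀ v ∈ perp c K x, ∀ w ∈ perp c K x,
      twist g' k x v w = f x * twist g k x v w := by
  obtain ⟨φ, hφ, hφ'⟩ := (c.mem_iff g hg g').1 hg'
  refine ⟨fun x => Real.exp (2 * φ x), fun x hx => ⟨hφ' x, fun v hv w hw => ?_⟩⟩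
  have h1 : ContMDiffOn 𝓘(ℝ, Euc d) 𝓘(ℝ, ℝ) ∞ (fun x => Real.exp (2 * φ x)) V := by
    have h2 : ContDiff ℝ ∞ fun t : ℝ => Real.exp (2 * t) := by fun_prop
    exact (h2.contMDiff.comp hφ).contMDiffOn
  rw [twist, twist, extDer_smul hV (smoothOneForm_lowerVF g hV hk.1) h1 hx (fun z _ => ?_)
    (hv g hg _ (hk.2 x hx).1) (hw g hg _ (hk.2 x hx).1)]
  · ring
  · rw [lowerVF, lowerVF, hφ' z]
    rfl

/-- Vectors of `K^⊥` that are congruent modulo `K` have the same scalar products with `K^⊥`. -/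
theorem metric_congr {g : LorentzMetric d M}
    (hg : g ∈ c.metrics) {x : M} {v w u : Tan d x} (h : v - w ∈ K x) (hu : u ∈ perp c K x) :
    g.val x v u = g.val x w u := by
  have h1 := hu g hg _ h
  rw [map_sub, sub_apply] at h1
  linarith

theorem IsTwistEndo.eq_iff {k : ∀ x : M, Tan d x} {x : M}
    {J : Screen c K x →ₗ[ℝ] Screen c K x} (hJ : IsTwistEndo c K k x J) (hK : IsOptical c K)
    {g : LorentzMetric d M} (hg : g ∈ c.metrics) (v w : perp c K x) :
    J (Submodule.Quotient.mk v) = Submodule.Quotient.mk w ↔ IsTwistRep c K g k x v w := by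
  refine ⟨fun h => ⟨v.2, w.2, fun u hu => hJ g hg v w ⟨u, hu⟩ h⟩, fun h => ?_⟩
  obtain ⟨w', hw'⟩ := Submodule.Quotient.mk_surjective _ (J (Submodule.Quotient.mk v))
  rw [← hw', screen_mk_eq]
  refine hK.sub_mem_of_forall hg w'.2 w.2 fun u hu => ?_
  rw [hJ g hg v w' ⟨u, hu⟩ hw'.symm, h.2.2 u hu]

/-- Skewness of `τ` gives `g(Jv,Jv) = τ(v,Jv) = -τ(Jv,v) = -g(J²v,v) = g(v,v)`. -/
theorem IsTwistEndo.isometry {k : ∀ x : M, Tan d x} {x : M}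
    {J : Screen c K x →ₗ[ℝ] Screen c K x} (hJ : IsTwistEndo c K k x J) (hK : IsOptical c K)
    (hJ2 : ∀ s, J (J s) = -s) {g : LorentzMetric d M} (hg : g ∈ c.metrics) {v w : Tan d x}
    (h : IsTwistRep c K g k x v w) : g.val x w w = g.val x v v := by
  have h1 := (hJ.eq_iff hK hg ⟨v, h.1⟩ ⟨w, h.2.1⟩).2 h
  have h2 : J (Submodule.Quotient.mk ⟨w, h.2.1⟩) = Submodule.Quotient.mk (-⟨v, h.1⟩) := by
    rw [← h1, hJ2]
    rfl
  have h3 := ((hJ.eq_iff hK hg ⟨w, h.2.1⟩ (-⟨v, h.1⟩)).1 h2).2.2 v h.1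
  have h4 := h.2.2 w h.2.1
  have h5 := twist_swap g k x v w
  have h6 : g.val x (-v) v = twist g k x w v := h3
  rw [map_neg, neg_apply] at h6
  linarith

/-- The isometry property is the criterion `weyl_eq_zero_iff` with constant 1; `weyl_smul` carries
the result to the other vectors of the line. -/
theorem IsTwistingOptical.weylCondition_of_endo (hK : IsTwistingOptical c K) (hd : 2 < d)
    (h : ∀ x, ∃ V : Set M, IsOpen V ∧ x ∈ V ∧ ∃ k : ∀ x : M, Tan d x, IsOpticalField K k V ∧
      ∃ J : Screen c K x →ₗ[ℝ] Screen c K x, IsTwistEndo c K k x J ∧ ∀ s, J (J s) = -s) :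
    WeylCondition c K := by
  intro g hg x k₀ hk₀ v hv
  obtain ⟨V, hV, hx, k, hk, J, hJ, hJ2⟩ := h x
  obtain ⟨r, rfl⟩ := (hK.optical.mem_iff_smul (hk.2 x hx).1 (hk.2 x hx).2 k₀).1 hk₀
  have h1 := (hK.weyl_eq_zero_iff hg hV hk hd hx).2 ⟨1, fun v w hr => by
    rw [hJ.isometry hK.optical hJ2 hg hr, one_mul]⟩ v hv
  rw [hK.weyl_smul hg (hk.2 x hx).1 hv, h1, mul_zero]

namespace IsTwistingOptical

variable (hK : IsTwistingOptical c K) {g : LorentzMetric d M} (hg : g ∈ c.metrics) {V : Set M}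
  (hV : IsOpen V) {k : ∀ x : M, Tan d x} (hk : IsOpticalField K k V)
include hK hg hV hk

theorem twistMap_mem_perp {x : M} (hx : x ∈ V) {v : Tan d x} (hv : v ∈ perp c K x) :
    twistMap g k x v ∈ perp c K x := by
  rw [hK.optical.mem_perp_iff hg (hk.2 x hx).1 (hk.2 x hx).2, g.symm, twistMap_spec, twist_swap,
    hK.twist_self hg hV hk hx hv, neg_zero]

theorem isTwistRep_twistMap {x : M} (hx : x ∈ V) {v : Tan d x} (hv : v ∈ perp c K x) :
    IsTwistRep c K g k x v (twistMap g k x v) :=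
  ⟨hv, hK.twistMap_mem_perp hg hV hk hx hv, fun u _ => twistMap_spec g k x v u⟩

theorem twistMap_mem {x : M} (hx : x ∈ V) {v : Tan d x} (hv : v ∈ K x) :
    twistMap g k x v ∈ K x := by
  have hp := hK.twistMap_mem_perp hg hV hk hx (hK.optical.le_perp x hv)
  refine hK.optical.mem_of_null hg hp ?_
  obtain ⟨r, rfl⟩ := (hK.optical.mem_iff_smul (hk.2 x hx).1 (hk.2 x hx).2 v).1 hv
  rw [twistMap_spec, twist_smul_left, hK.twist_self hg hV hk hx hp, mul_zero]

/-- Such a vector shows that the factor in `g(Fv,Fv) = a g(v,v)` is positive, and makes it a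
quotient with non-zero denominator. -/
theorem exists_not_mem {x : M} (hx : x ∈ V) :
    ∃ v ∈ perp c K x, v ∉ K x ∧ twistMap g k x v ∉ K x := by
  obtain ⟨v, hv, u, hu, hvu⟩ := hK.twisting g hg V k hV hk x hx
  have h1 : twistMap g k x v ∉ K x := fun h => hvu (by
    rw [← twistMap_spec]
    exact hu g hg _ h)
  exact ⟨v, hv, fun h => h1 (hK.twistMap_mem hg hV hk hx h), h1⟩

/-- The endomorphism of the screen space defined by the twist. -/
def screenEndo {x : M} (hx : x ∈ V) : Screen c K x →ₗ[ℝ] Screen c K x :=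
  Submodule.mapQ _ _ ((twistMap g k x).toLinearMap.restrict fun _ hv =>
    hK.twistMap_mem_perp hg hV hk hx hv) fun _ hv => hK.twistMap_mem hg hV hk hx hv

theorem screenEndo_mk {x : M} (hx : x ∈ V) (v : perp c K x) :
    hK.screenEndo hg hV hk hx (Submodule.Quotient.mk v) =
      Submodule.Quotient.mk ⟨twistMap g k x v, hK.twistMap_mem_perp hg hV hk hx v.2⟩ := rfl

theorem isTwistEndo_screenEndo {x : M} (hx : x ∈ V) :
    IsTwistEndo c K k x (hK.screenEndo hg hV hk hx) := by
  intro g' hg' v w u h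
  rw [hK.screenEndo_mk hg hV hk hx, screen_mk_eq] at h
  obtain ⟨f, hf⟩ := hk.twist_conformal hV hg hg'
  rw [(hf x hx).2 v v.2 u u.2, (hf x hx).1, ← twistMap_spec,
    metric_congr hg h u.2]
  rfl

/-- Polarisation gives `g(Fv,Fu) = g(v,u)`, and skewness turns this into `g(F²v,u) = -g(v,u)` for
all `u` in `K^⊥`. -/
theorem screenEndo_sq {x : M} (hx : x ∈ V)
    (h : ∀ v ∈ perp c K x, g.val x (twistMap g k x v) (twistMap g k x v) = g.val x v v)
    (s : Screen c K x) :
    hK.screenEndo hg hV hk hx (hK.screenEndo hg hV hk hx s) = -s := by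
  obtain ⟨v, rfl⟩ := Submodule.Quotient.mk_surjective _ s
  rw [screenEndo_mk, screenEndo_mk, ← Submodule.Quotient.mk_neg, screen_mk_eq]
  have hv := v.2
  have hF := hK.twistMap_mem_perp hg hV hk hx hv
  refine hK.optical.sub_mem_of_forall hg (hK.twistMap_mem_perp hg hV hk hx hF)
    ((perp c K x).neg_mem hv) fun u hu => ?_
  have h1 := h (v + u) ((perp c K x).add_mem hv hu)
  have h2 := h v hv
  have h3 := h u hu
  simp only [map_add, add_apply] at h1
  rw [twistMap_spec, twist_swap, ← twistMap_spec]
  change -g.val x (twistMap g k x u) (twistMap g k x v) = g.val x (-(v : Tan d x)) u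
  rw [map_neg, neg_apply]
  have h4 := g.symm x (twistMap g k x v) (twistMap g k x u)
  have h5 := g.symm x v u
  linarith

end IsTwistingOptical

/-- If the Weyl tensor satisfies `W(k,v,k,v) = 0`, the twist of a suitable optical vector field is
a bundle complex structure on the screen bundle. -/
theorem IsTwistingOptical.exists_unit_twist (hK : IsTwistingOptical c K) (hd : 2 < d)
    (hc : c.TimeOrientable) (hW : WeylCondition c K) {g : LorentzMetric d M}
    (hg : g ∈ c.metrics) : ∃ k, IsOpticalField K k univ ∧ ∀ x, ∀ v ∈ perp c K x,
      g.val x (twistMap g k x v) (twistMap g k x v) = g.val x v v := by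
  obtain ⟨k, hk⟩ := hK.optical.exists_global_field hc
  have hF : ∀ x, ∃ a : ℝ, 0 < a ∧ ∀ v ∈ perp c K x,
      g.val x (twistMap g k x v) (twistMap g k x v) = a * g.val x v v := by
    intro x
    obtain ⟨a, ha⟩ := (hK.weyl_eq_zero_iff hg isOpen_univ hk hd (mem_univ x)).1 fun v hv =>
      hW g hg x (k x) (hk.2 x (mem_univ x)).1 v hv
    have ha' : ∀ v ∈ perp c K x,
        g.val x (twistMap g k x v) (twistMap g k x v) = a * g.val x v v := fun v hv =>
      ha v _ (hK.isTwistRep_twistMap hg isOpen_univ hk (mem_univ x) hv)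
    obtain ⟨v, hv, hvK, hFv⟩ := hK.exists_not_mem hg isOpen_univ hk (mem_univ x)
    have h1 := hK.optical.pos_of_not_mem hg
      (hK.twistMap_mem_perp hg isOpen_univ hk (mem_univ x) hv) hFv
    rw [ha' v hv] at h1
    exact ⟨a, (pos_iff_pos_of_mul_pos h1).2 (hK.optical.pos_of_not_mem hg hv hvK), ha'⟩
  choose a ha hFa using hF
  -- Near `x` the factor is `g(FX,FX)/g(X,X)` for a section `X` of `K^⊥` with `X x` outside `K`.
  have hsm : ContMDiff 𝓘(ℝ, Euc d) 𝓘(ℝ, ℝ) ∞ a := by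
    intro x
    obtain ⟨v, hv, hvK, -⟩ := hK.exists_not_mem hg isOpen_univ hk (mem_univ x)
    obtain ⟨W, hW, hxW, X, hX, hXv, hXp⟩ := hK.optical.exists_section x hv
    have hFX := smoothVF_twistMap g hW (hk.1.mono (subset_univ W)) hX
    refine contMDiffAt_of_eventuallyEq_div hW hxW (contMDiffOn_metric g hW hFX hFX)
      (contMDiffOn_metric g hW hX hX) ?_ fun z hz => hFa z _ (hXp z hz)
    rw [hXv]
    exact (hK.optical.pos_of_not_mem hg hv hvK).ne'
  have hf : ContMDiff 𝓘(ℝ, Euc d) 𝓘(ℝ, ℝ) ∞ fun x => (Real.sqrt (a x))⁻¹ := by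
    intro x
    have h1 : ContDiffAt ℝ ∞ (fun t : ℝ => (Real.sqrt t)⁻¹) (a x) :=
      (contDiffAt_id.sqrt (ha x).ne').inv (Real.sqrt_ne_zero'.2 (ha x))
    exact (contMDiffAt_iff_contDiffAt.2 h1).comp x (hsm x)
  have hpos : ∀ x, 0 < (Real.sqrt (a x))⁻¹ := fun x => inv_pos.2 (Real.sqrt_pos.2 (ha x))
  -- Multiplying `k` by a function multiplies `F` by it modulo `K`, so the factor `a^(-1/2)` makes
  -- `F` isometric.
  have hk' : IsOpticalField K (fun x => (Real.sqrt (a x))⁻¹ • k x) univ :=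
    ⟨SmoothVF.smul hf.contMDiffOn hk.1, fun x hx => ⟨(K x).smul_mem _ (hk.2 x hx).1,
      smul_ne_zero (hpos x).ne' (hk.2 x hx).2⟩⟩
  refine ⟨_, hk', fun x v hv => ?_⟩
  set k' : ∀ x : M, Tan d x := fun x => (Real.sqrt (a x))⁻¹ • k x with hk'def
  have hx := mem_univ x
  have htw : ∀ u ∈ perp c K x, ∀ w ∈ perp c K x,
      twist g k' x u w = (Real.sqrt (a x))⁻¹ * twist g k x u w := by
    intro u hu w hw
    rw [twist, twist, extDer_smul isOpen_univ (smoothOneForm_lowerVF g isOpen_univ hk.1)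
      hf.contMDiffOn hx (fun z _ => ?_) (hu g hg _ (hk.2 x hx).1) (hw g hg _ (hk.2 x hx).1)]
    · ring
    · rw [lowerVF, lowerVF, hk'def, map_smul]
  have hFv' := hK.twistMap_mem_perp hg isOpen_univ hk' hx hv
  have hFv := hK.twistMap_mem_perp hg isOpen_univ hk hx hv
  have h1 : twistMap g k' x v - (Real.sqrt (a x))⁻¹ • twistMap g k x v ∈ K x := by
    refine hK.optical.sub_mem_of_forall hg hFv' ((perp c K x).smul_mem _ hFv) fun u hu => ?_
    rw [twistMap_spec, htw v hv u hu, map_smul, smul_apply, smul_eq_mul, twistMap_spec]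
  rw [metric_congr hg h1 hFv', map_smul, smul_apply, smul_eq_mul, g.symm,
    metric_congr hg h1 hFv, map_smul, smul_apply, smul_eq_mul, hFa x v hv, ← mul_assoc,
    ← mul_assoc, ← mul_inv, Real.mul_self_sqrt (ha x).le, inv_mul_cancel₀ (ha x).ne', one_mul]

end TwistEndo

/-! ### Complex tangent vectors `u + iv`. -/

section ComplexVectors

variable {d : ℕ} {M : Type*} [TopologicalSpace M] [ChartedSpace (Euc d) M] {x : M}

/-- The real part of a complex tangent vector. -/
def reTan (x : M) : CTan d x →ₗ[ℝ] Tan d x :=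
  TensorProduct.lift ((LinearMap.lsmul ℝ (Tan d x)).comp Complex.reLm)

/-- The imaginary part of a complex tangent vector. -/
def imTan (x : M) : CTan d x →ₗ[ℝ] Tan d x :=
  TensorProduct.lift ((LinearMap.lsmul ℝ (Tan d x)).comp Complex.imLm)

theorem reTan_cvec (u v : Tan d x) : reTan x (cvec u v) = u := by
  rw [cvec, map_add, reTan, TensorProduct.lift.tmul, TensorProduct.lift.tmul]
  simp

theorem imTan_cvec (u v : Tan d x) : imTan x (cvec u v) = v := by
  rw [cvec, map_add, imTan, TensorProduct.lift.tmul, TensorProduct.lift.tmul]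
  simp

theorem cvec_add (u v u' v' : Tan d x) : cvec u v + cvec u' v' = cvec (u + u') (v + v') := by
  rw [cvec, cvec, cvec, TensorProduct.tmul_add, TensorProduct.tmul_add]
  abel

theorem cvec_zero : cvec (0 : Tan d x) 0 = 0 := by
  rw [cvec, TensorProduct.tmul_zero, TensorProduct.tmul_zero, add_zero]

theorem real_smul_cvec (r : ℝ) (u v : Tan d x) : r • cvec u v = cvec (r • u) (r • v) := by
  rw [cvec, cvec, smul_add, TensorProduct.tmul_smul, TensorProduct.tmul_smul]

theorem tmul_eq_cvec (a : ℂ) (u : Tan d x) : a ⊗ₜ[ℝ] u = cvec (a.re • u) (a.im • u) := by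
  rw [cvec, ← TensorProduct.smul_tmul, ← TensorProduct.smul_tmul, ← TensorProduct.add_tmul]
  congr 1
  apply Complex.ext <;> simp

theorem smul_cvec (a : ℂ) (u v : Tan d x) :
    a • cvec u v = cvec (a.re • u - a.im • v) (a.im • u + a.re • v) := by
  rw [cvec, smul_add, TensorProduct.smul_tmul', TensorProduct.smul_tmul', tmul_eq_cvec,
    tmul_eq_cvec, cvec_add]
  congr 1
  · simp [sub_eq_add_neg]
  · simp

theorem cvec_surjective (z : CTan d x) : ∃ u v, z = cvec u v := by
  induction z using TensorProduct.induction_on with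
  | zero => exact ⟨0, 0, cvec_zero.symm⟩
  | tmul a u => exact ⟨_, _, tmul_eq_cvec a u⟩
  | add z w hz hw =>
    obtain ⟨u, v, rfl⟩ := hz
    obtain ⟨u', v', rfl⟩ := hw
    exact ⟨_, _, cvec_add _ _ _ _⟩

theorem cvec_inj {u v u' v' : Tan d x} : cvec u v = cvec u' v' ↔ u = u' ∧ v = v' := by
  refine ⟨fun h => ⟨?_, ?_⟩, fun h => by rw [h.1, h.2]⟩
  · simpa [reTan_cvec] using congrArg (reTan x) h
  · simpa [imTan_cvec] using congrArg (imTan x) h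

theorem conjTan_cvec (u v : Tan d x) : conjTan x (cvec u v) = cvec u (-v) := by
  rw [cvec, cvec, map_add, conjTan, TensorProduct.map_tmul, TensorProduct.map_tmul,
    TensorProduct.tmul_neg, ← TensorProduct.neg_tmul]
  simp

theorem cvec_mem_baseChange {P : Submodule ℝ (Tan d x)} {u v : Tan d x} :
    cvec u v ∈ P.baseChange ℂ ↔ u ∈ P ∧ v ∈ P := by
  constructor
  · intro h
    have key : ∀ z ∈ P.baseChange ℂ, reTan x z ∈ P ∧ imTan x z ∈ P := by
      intro z hz
      rw [Submodule.baseChange_eq_span] at hz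
      induction hz using Submodule.span_induction with
      | mem z hz =>
        obtain ⟨w, hw, rfl⟩ := hz
        have h1 : (TensorProduct.mk ℝ ℂ (Tan d x) 1) w = cvec w 0 := by
          rw [cvec, TensorProduct.tmul_zero, add_zero]
          rfl
        rw [h1, reTan_cvec, imTan_cvec]
        exact ⟨hw, P.zero_mem⟩
      | zero => simp
      | add z w _ _ hz hw =>
        rw [map_add, map_add]
        exact ⟨P.add_mem hz.1 hw.1, P.add_mem hz.2 hw.2⟩
      | smul a z _ hz =>
        obtain ⟨u, v, rfl⟩ := cvec_surjective z
        rw [reTan_cvec, imTan_cvec] at hz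
        rw [smul_cvec, reTan_cvec, imTan_cvec]
        exact ⟨P.sub_mem (P.smul_mem _ hz.1) (P.smul_mem _ hz.2),
          P.add_mem (P.smul_mem _ hz.1) (P.smul_mem _ hz.2)⟩
    have h1 := key _ h
    rwa [reTan_cvec, imTan_cvec] at h1
  · rintro ⟨hu, hv⟩
    exact Submodule.add_mem _ (Submodule.tmul_mem_baseChange_of_mem _ hu)
      (Submodule.tmul_mem_baseChange_of_mem _ hv)

/-- The complex components of a complex tangent vector with respect to a linear map. -/
def complexCoords (A : Tan d x →L[ℝ] Euc d) : CTan d x →ₗ[ℂ] (Fin d → ℂ) where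
  toFun z i := (A (reTan x z) i : ℂ) + Complex.I * (A (imTan x z) i : ℂ)
  map_add' z w := by
    funext i
    simp only [map_add, PiLp.add_apply, Complex.ofReal_add, Pi.add_apply]
    ring
  map_smul' a z := by
    obtain ⟨u, v, rfl⟩ := cvec_surjective z
    funext i
    rw [smul_cvec]
    simp only [reTan_cvec, imTan_cvec, map_add, map_sub, map_smul, PiLp.add_apply, PiLp.sub_apply,
      PiLp.smul_apply, smul_eq_mul, RingHom.id_apply, Pi.smul_apply]
    apply Complex.ext <;> (simp; try ring)

theorem complexCoords_cvec (A : Tan d x →L[ℝ] Euc d) (u v : Tan d x) (i : Fin d) :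
    complexCoords A (cvec u v) i = (A u i : ℂ) + Complex.I * (A v i : ℂ) := by
  change (A (reTan x _) i : ℂ) + Complex.I * (A (imTan x _) i : ℂ) = _
  rw [reTan_cvec, imTan_cvec]

theorem complexCoords_injective {A : Tan d x →L[ℝ] Euc d} (hA : Function.Injective A) :
    Function.Injective (complexCoords A) := by
  refine (injective_iff_map_eq_zero _).2 fun z hz => ?_
  obtain ⟨u, v, rfl⟩ := cvec_surjective z
  have h1 : ∀ i, A u i = 0 ∧ A v i = 0 := by
    intro i
    have h2 := congrFun hz i
    rw [complexCoords_cvec] at h2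
    have h3 := congrArg Complex.re h2
    have h4 := congrArg Complex.im h2
    simp at h3 h4
    exact ⟨h3, h4⟩
  have hu : u = 0 := hA (by rw [map_zero]; ext i; exact (h1 i).1)
  have hv : v = 0 := hA (by rw [map_zero]; ext i; exact (h1 i).2)
  rw [hu, hv, cvec_zero]

variable [IsManifold 𝓘(ℝ, Euc d) ∞ M]

/-- Linear independence is an open condition on tuples in `ℂ^d`; the chart brings the varying
tangent spaces into this fixed space. -/
theorem eventually_linearIndependent_cvec {r : ℕ} {X Y : Fin r → ∀ x : M, Tan d x} {V : Set M}
    (hV : IsOpen V) (hX : ∀ i, SmoothVF (X i) V) (hY : ∀ i, SmoothVF (Y i) V) {x₀ : M}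
    (hx : x₀ ∈ V) (h : LinearIndependent ℂ fun i => cvec (X i x₀) (Y i x₀)) :
    ∃ W ⊆ V, IsOpen W ∧ x₀ ∈ W ∧
      ∀ x ∈ W, LinearIndependent ℂ fun i => cvec (X i x) (Y i x) := by
  set f : Euc d → Fin r → Fin d → ℂ := fun y i j =>
    (vfInChart (X i) x₀ y j : ℂ) + Complex.I * (vfInChart (Y i) x₀ y j : ℂ) with hf
  have hfc : ContinuousOn f (chartDom x₀ V) := by
    refine continuousOn_pi.2 fun i => continuousOn_pi.2 fun j => ?_
    have h1 : ∀ Z : ∀ x : M, Tan d x, SmoothVF Z V →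
        ContinuousOn (fun y => ((vfInChart Z x₀ y) j : ℂ)) (chartDom x₀ V) := fun Z hZ =>
      Complex.continuous_ofReal.comp_continuousOn
        ((EuclideanSpace.proj (𝕜 := ℝ) j).continuous.comp_continuousOn
          (contDiffOn_vfInChart hV hZ x₀).continuousOn)
    exact (h1 _ (hX i)).add (continuousOn_const.mul (h1 _ (hY i)))
  let A : ∀ y : Euc d, Tan d ((chrt (d := d) x₀).symm y) →L[ℝ] Euc d :=
    fun y => (chartInvDeriv x₀ y).inverse
  have hfA : ∀ y i, f y i = complexCoords (A y) (cvec (X i ((chrt (d := d) x₀).symm y))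
      (Y i ((chrt (d := d) x₀).symm y))) := by
    intro y i
    funext j
    rw [complexCoords_cvec]
    rfl
  have hopen : IsOpen (chartDom x₀ V ∩ f ⁻¹' {f | LinearIndependent ℂ f}) :=
    hfc.isOpen_inter_preimage (isOpen_chartDom x₀ hV) isOpen_setOfPred_linearIndependent
  have hinj : Function.Injective (A (coord x₀)) := by
    refine Function.LeftInverse.injective (g := chartInvDeriv x₀ (coord (d := d) x₀)) fun w => ?_
    exact self_apply_inverse (E := Euc d) (F := Euc d)
      (isInvertible_chartInvDeriv (mem_extChartAt_target (I := 𝓘(ℝ, Euc d)) x₀)) w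
  have h0 : LinearIndependent ℂ (f (coord x₀)) := by
    have h1 : LinearIndependent ℂ fun i => cvec (X i ((chrt (d := d) x₀).symm (coord x₀)))
        (Y i ((chrt (d := d) x₀).symm (coord x₀))) := by
      have h3 : ∀ z, z = x₀ → LinearIndependent ℂ fun i => cvec (X i z) (Y i z) := by
        rintro z rfl
        exact h
      exact h3 _ (symm_coord x₀)
    have h2 := h1.map' (complexCoords (A (coord x₀)))
      (LinearMap.ker_eq_bot.2 (complexCoords_injective hinj))
    have h4 : f (coord x₀) = (complexCoords (A (coord x₀))) ∘
        fun i => cvec (X i ((chrt (d := d) x₀).symm (coord x₀)))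
          (Y i ((chrt (d := d) x₀).symm (coord x₀))) := by
      funext i
      exact hfA _ i
    rwa [← h4] at h2
  refine ⟨V ∩ ((chrt (d := d) x₀).source ∩ chrt (d := d) x₀ ⁻¹'
    (chartDom x₀ V ∩ f ⁻¹' {f | LinearIndependent ℂ f})), inter_subset_left,
    hV.inter (isOpen_extChartAt_preimage' x₀ hopen),
    ⟨hx, mem_extChartAt_source x₀, coord_mem_chartDom hx, h0⟩, fun x hxW => ?_⟩
  have h1 : LinearIndependent ℂ (f (chrt (d := d) x₀ x)) := hxW.2.2.2
  have h2 : LinearIndependent ℂ fun i => cvec (X i ((chrt (d := d) x₀).symm (chrt (d := d) x₀ x)))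
      (Y i ((chrt (d := d) x₀).symm (chrt (d := d) x₀ x))) := by
    refine LinearIndependent.of_comp (complexCoords (A (chrt (d := d) x₀ x))) ?_
    have h3 : f (chrt (d := d) x₀ x) = (complexCoords (A (chrt (d := d) x₀ x))) ∘
        fun i => cvec (X i ((chrt (d := d) x₀).symm (chrt (d := d) x₀ x)))
          (Y i ((chrt (d := d) x₀).symm (chrt (d := d) x₀ x))) := by
      funext i
      exact hfA _ i
    rwa [← h3]
  have h3 : ∀ z, z = x → (LinearIndependent ℂ fun i => cvec (X i z) (Y i z)) →
      LinearIndependent ℂ fun i => cvec (X i x) (Y i x) := by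
    rintro z rfl h
    exact h
  exact h3 _ ((chrt x₀).left_inv hxW.2.1) h2

end ComplexVectors

/-! ### The totally null distribution defined by the twist. -/

section Robinson

variable {d : ℕ} {M : Type*} [TopologicalSpace M] [ChartedSpace (Euc d) M]
  [IsManifold 𝓘(ℝ, Euc d) ∞ M] {c : ConformalStructure d M} {K : ∀ x : M, Submodule ℝ (Tan d x)}

/-- The preimage in the complexification of `K^⊥` of the `-i`-eigenspace of `J`. -/
def robinson {x : M} (J : Screen c K x →ₗ[ℝ] Screen c K x) (hJ : ∀ s, J (J s) = -s) :
    Submodule ℂ (CTan d x) where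
  carrier := {z | ∃ v w : perp c K x, z = cvec (v : Tan d x) (w : Tan d x) ∧
    J (Submodule.Quotient.mk v) = Submodule.Quotient.mk w}
  add_mem' := by
    rintro _ _ ⟨v, w, rfl, h⟩ ⟨v', w', rfl, h'⟩
    refine ⟨v + v', w + w', cvec_add _ _ _ _, ?_⟩
    rw [Submodule.Quotient.mk_add, map_add, h, h', Submodule.Quotient.mk_add]
  zero_mem' := ⟨0, 0, cvec_zero.symm, by rw [Submodule.Quotient.mk_zero, map_zero]⟩
  -- Closure under complex scalars is where `J² = -1` enters: from `w = Jv` follows `J(-w) = v`, so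
  -- `i(v + iw) = -w + iv` has the required form.
  smul_mem' := by
    rintro a _ ⟨v, w, rfl, h⟩
    refine ⟨a.re • v - a.im • w, a.im • v + a.re • w, smul_cvec _ _ _, ?_⟩
    rw [Submodule.Quotient.mk_sub, Submodule.Quotient.mk_smul, Submodule.Quotient.mk_smul, map_sub,
      map_smul, map_smul, h, Submodule.Quotient.mk_add, Submodule.Quotient.mk_smul,
      Submodule.Quotient.mk_smul, ← h, hJ, smul_neg]
    abel

theorem mem_robinson {x : M} {J : Screen c K x →ₗ[ℝ] Screen c K x} {hJ : ∀ s, J (J s) = -s}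
    {z : CTan d x} : z ∈ robinson J hJ ↔ ∃ v w : perp c K x,
      z = cvec (v : Tan d x) (w : Tan d x) ∧
        J (Submodule.Quotient.mk v) = Submodule.Quotient.mk w := Iff.rfl

theorem cvec_mem_robinson {x : M} {J : Screen c K x →ₗ[ℝ] Screen c K x} {hJ : ∀ s, J (J s) = -s}
    {u v : Tan d x} : cvec u v ∈ robinson J hJ ↔ ∃ (hu : u ∈ perp c K x) (hv : v ∈ perp c K x),
      J (Submodule.Quotient.mk ⟨u, hu⟩) = Submodule.Quotient.mk ⟨v, hv⟩ := by
  rw [mem_robinson]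
  constructor
  · rintro ⟨v', w', h, hJ'⟩
    obtain ⟨rfl, rfl⟩ := cvec_inj.1 h
    exact ⟨v'.2, w'.2, hJ'⟩
  · rintro ⟨hu, hv, h⟩
    exact ⟨_, _, rfl, h⟩

/-- If both `u + iv` and `u - iv` belong to `N`, then `Ju` is `v` and also `-v` modulo `K`. So `v`
is zero on the screen, and so is `u` because `J` is injective. -/
theorem robinson_inter_conj (hK : IsOptical c K) {x : M} {J : Screen c K x →ₗ[ℝ] Screen c K x}
    {hJ : ∀ s, J (J s) = -s} (z : CTan d x) :
    (z ∈ robinson J hJ ∧ conjTan x z ∈ robinson J hJ) ↔ z ∈ (K x).baseChange ℂ := by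
  obtain ⟨u, v, rfl⟩ := cvec_surjective z
  rw [conjTan_cvec, cvec_mem_robinson, cvec_mem_robinson, cvec_mem_baseChange]
  have hmk : ∀ (v : Tan d x) (hv : v ∈ perp c K x),
      (Submodule.Quotient.mk ⟨v, hv⟩ : Screen c K x) = 0 ↔ v ∈ K x := by
    intro v hv
    rw [Submodule.Quotient.mk_eq_zero]
    rfl
  constructor
  · rintro ⟨⟨hu, hv, h⟩, ⟨_, hv', h'⟩⟩
    have h1 : (Submodule.Quotient.mk ⟨v, hv⟩ : Screen c K x) =
        -Submodule.Quotient.mk ⟨v, hv⟩ := by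
      rw [← Submodule.Quotient.mk_neg, ← h, h']
      rfl
    have h2 : (Submodule.Quotient.mk ⟨v, hv⟩ : Screen c K x) = 0 := by
      have h3 : (2 : ℝ) • (Submodule.Quotient.mk ⟨v, hv⟩ : Screen c K x) = 0 := by
        rw [two_smul]
        nth_rewrite 1 [h1]
        exact neg_add_cancel _
      exact (smul_eq_zero.1 h3).resolve_left two_ne_zero
    refine ⟨(hmk u hu).1 ?_, (hmk v hv).1 h2⟩
    have h4 := hJ (Submodule.Quotient.mk ⟨u, hu⟩)
    rw [h, h2, map_zero] at h4
    exact neg_eq_zero.1 h4.symm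
  · rintro ⟨hu, hv⟩
    have h1 := (hmk u (hK.le_perp x hu)).2 hu
    have h2 := (hmk v (hK.le_perp x hv)).2 hv
    have h3 := (hmk (-v) (hK.le_perp x ((K x).neg_mem hv))).2 ((K x).neg_mem hv)
    exact ⟨⟨hK.le_perp x hu, hK.le_perp x hv, by rw [h1, h2, map_zero]⟩,
      ⟨hK.le_perp x hu, _, by rw [h1, h3, map_zero]⟩⟩

theorem bilin_baseChange_cvec (g : LorentzMetric d M) {x : M} (u v u' v' : Tan d x) :
    LinearMap.BilinForm.baseChange ℂ (g.bilin x) (cvec u v) (cvec u' v') =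
      ((g.val x u u' - g.val x v v' : ℝ) : ℂ) +
        Complex.I * ((g.val x u v' + g.val x v u' : ℝ) : ℂ) := by
  have hb : ∀ u v, g.bilin x u v = g.val x u v := fun _ _ => rfl
  rw [cvec, cvec]
  simp only [map_add, LinearMap.add_apply, LinearMap.BilinForm.baseChange_tmul, hb]
  apply Complex.ext <;> (simp; try ring)

/-- The product of `v + iJv` and `v' + iJv'` has real part `g(v,v') - g(Jv,Jv')`, zero by the
polarised isometry, and imaginary part `g(v,Jv') + g(Jv,v')`, zero by skewness. -/
theorem robinson_totallyNull (hK : IsOptical c K) {k : ∀ x : M, Tan d x} {x : M}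
    {J : Screen c K x →ₗ[ℝ] Screen c K x} (hJe : IsTwistEndo c K k x J) {hJ : ∀ s, J (J s) = -s}
    {g : LorentzMetric d M} (hg : g ∈ c.metrics) {z w : CTan d x} (hz : z ∈ robinson J hJ)
    (hw : w ∈ robinson J hJ) : LinearMap.BilinForm.baseChange ℂ (g.bilin x) z w = 0 := by
  obtain ⟨v, w, rfl, h⟩ := hz
  obtain ⟨v', w', rfl, h'⟩ := hw
  have hr := (hJe.eq_iff hK hg v w).1 h
  have hr' := (hJe.eq_iff hK hg v' w').1 h'
  have hs : J (Submodule.Quotient.mk (v + v')) = Submodule.Quotient.mk (w + w') := by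
    rw [Submodule.Quotient.mk_add, map_add, h, h', Submodule.Quotient.mk_add]
  have h1 := hJe.isometry hK hJ hg hr
  have h2 := hJe.isometry hK hJ hg hr'
  have h3 : g.val x ((w : Tan d x) + w') ((w : Tan d x) + w') =
      g.val x ((v : Tan d x) + v') ((v : Tan d x) + v') :=
    hJe.isometry hK hJ hg ((hJe.eq_iff hK hg (v + v') (w + w')).1 hs)
  have h4 := hr.2.2 v' v'.2
  have h5 := hr'.2.2 v v.2
  have h6 := twist_swap g k x v v'
  have h7 := g.symm x w w'
  have h8 := g.symm x v v'
  have h9 := g.symm x v w'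
  simp only [map_add, add_apply] at h3
  have e1 : g.val x (v : Tan d x) v' - g.val x (w : Tan d x) w' = 0 := by linarith
  have e2 : g.val x (v : Tan d x) w' + g.val x (w : Tan d x) v' = 0 := by linarith
  rw [bilin_baseChange_cvec, e1, e2]
  simp

end Robinson

/-! ### Rank and smooth frames of the null distribution. -/

section RobinsonRank

variable {m : ℕ} {M : Type*} [TopologicalSpace M] [ChartedSpace (Euc (2 * m + 2)) M]
  [IsManifold 𝓘(ℝ, Euc (2 * m + 2)) ∞ M] {c : ConformalStructure (2 * m + 2) M}
  {K : ∀ x : M, Submodule ℝ (Tan (2 * m + 2) x)}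

instance {d : ℕ} {M : Type*} [TopologicalSpace M] [ChartedSpace (Euc d) M] (x : M) :
    FiniteDimensional ℝ (Tan d x) := inferInstanceAs (FiniteDimensional ℝ (Euc d))

theorem finrank_tan {d : ℕ} {M : Type*} [TopologicalSpace M] [ChartedSpace (Euc d) M] (x : M) :
    Module.finrank ℝ (Tan d x) = d := (finrank_euclideanSpace_fin (𝕜 := ℝ) (n := d))

theorem IsOptical.finrank_perp {d : ℕ} {M : Type*} [TopologicalSpace M] [ChartedSpace (Euc d) M]
    [IsManifold 𝓘(ℝ, Euc d) ∞ M] {c : ConformalStructure d M} {K : ∀ x : M, Submodule ℝ (Tan d x)}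
    (hK : IsOptical c K) (x : M) : Module.finrank ℝ (perp c K x) + 1 = d := by
  obtain ⟨g, hg⟩ := c.nonempty
  obtain ⟨k, hk, hk0⟩ := hK.exists_ne_zero x
  obtain ⟨n, hn⟩ := (g.isLorentzForm x).exists_pairing_ne_zero hk0
  let f : Module.Dual ℝ (Tan d x) := (g.val x k).toLinearMap
  have hf : f ≠ 0 := fun h => hn (congrArg (fun f : Module.Dual ℝ (Tan d x) => f n) h)
  have h1 : perp c K x = LinearMap.ker f := by
    ext v
    rw [hK.mem_perp_iff hg hk hk0, LinearMap.mem_ker]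
    rfl
  rw [h1, Module.Dual.finrank_ker_add_one_of_ne_zero hf, finrank_tan]

theorem IsOptical.finrank_line {d : ℕ} {M : Type*} [TopologicalSpace M] [ChartedSpace (Euc d) M]
    [IsManifold 𝓘(ℝ, Euc d) ∞ M] {c : ConformalStructure d M} {K : ∀ x : M, Submodule ℝ (Tan d x)}
    (hK : IsOptical c K) (x : M) : Module.finrank ℝ (K x) = 1 := by
  obtain ⟨k, hk, hk0⟩ := hK.exists_ne_zero x
  have h1 : K x = Submodule.span ℝ {k} := by
    ext v
    rw [hK.mem_iff_smul hk hk0, Submodule.mem_span_singleton]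
    simp [eq_comm]
  rw [h1, finrank_span_singleton hk0]

variable (hK : IsTwistingOptical c K) {g : LorentzMetric (2 * m + 2) M} (hg : g ∈ c.metrics)
  {V : Set M} (hV : IsOpen V) {k : ∀ x : M, Tan (2 * m + 2) x} (hk : IsOpticalField K k V)
include hK hg hV hk

theorem IsTwistingOptical.cvec_mem_robinson {x : M} (hx : x ∈ V)
    (hJ : ∀ s, hK.screenEndo hg hV hk hx (hK.screenEndo hg hV hk hx s) = -s)
    {u v : Tan (2 * m + 2) x} : cvec u v ∈ robinson (hK.screenEndo hg hV hk hx) hJ ↔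
      u ∈ perp c K x ∧ v - twistMap g k x u ∈ K x := by
  rw [OpticalGeom.cvec_mem_robinson]
  constructor
  · rintro ⟨hu, hv, h⟩
    rw [hK.screenEndo_mk hg hV hk hx, eq_comm, screen_mk_eq] at h
    exact ⟨hu, h⟩
  · rintro ⟨hu, h⟩
    have hv : v ∈ perp c K x := by
      have h1 := (perp c K x).add_mem (hK.optical.le_perp x h)
        (hK.twistMap_mem_perp hg hV hk hx hu)
      rwa [sub_add_cancel] at h1
    refine ⟨hu, hv, ?_⟩
    rw [hK.screenEndo_mk hg hV hk hx, eq_comm, screen_mk_eq]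
    exact h

theorem IsTwistingOptical.finrank_robinson {x : M} (hx : x ∈ V)
    (hJ : ∀ s, hK.screenEndo hg hV hk hx (hK.screenEndo hg hV hk hx s) = -s) :
    Module.finrank ℂ (robinson (hK.screenEndo hg hV hk hx) hJ) = m + 1 := by
  -- The map `(v, l) ↦ v + i(Fv + l)` parametrises `N` by a real space of dimension `(2m+1) + 1`;
  -- half of this is the complex rank.
  let ψ : (perp c K x × K x) →ₗ[ℝ] CTan (2 * m + 2) x :=
    { toFun := fun p => cvec (p.1 : Tan (2 * m + 2) x) (twistMap g k x p.1 + p.2)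
      map_add' := fun p q => by
        rw [cvec_add]
        congr 1
        simp only [Prod.fst_add, Prod.snd_add, Submodule.coe_add, map_add]
        abel
      map_smul' := fun r p => by
        rw [RingHom.id_apply, real_smul_cvec]
        congr 1
        simp only [Prod.smul_fst, Prod.smul_snd, Submodule.coe_smul, map_smul, smul_add] }
  have hinj : Function.Injective ψ := by
    rintro ⟨v, l⟩ ⟨v', l'⟩ h
    obtain ⟨h1, h2⟩ := cvec_inj.1 h
    have h1' : v = v' := Subtype.ext h1
    subst h1'
    have h2' : l = l' := Subtype.ext (add_left_cancel h2)
    rw [h2']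
  have hrange : LinearMap.range ψ =
      (robinson (hK.screenEndo hg hV hk hx) hJ).restrictScalars ℝ := by
    ext z
    obtain ⟨u, v, rfl⟩ := cvec_surjective z
    rw [Submodule.restrictScalars_mem, hK.cvec_mem_robinson hg hV hk hx]
    constructor
    · rintro ⟨⟨v', l⟩, h⟩
      obtain ⟨rfl, rfl⟩ := cvec_inj.1 h
      refine ⟨v'.2, ?_⟩
      rw [add_sub_cancel_left]
      exact l.2
    · rintro ⟨hu, hv⟩
      refine ⟨⟨⟨u, hu⟩, ⟨_, hv⟩⟩, cvec_inj.2 ⟨rfl, ?_⟩⟩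
      exact add_sub_cancel _ _
  have h1 := LinearMap.finrank_range_of_inj hinj
  rw [hrange, Module.finrank_prod, hK.optical.finrank_line] at h1
  have h2 := hK.optical.finrank_perp x
  have h3 : Module.finrank ℝ ℂ *
      Module.finrank ℂ (robinson (hK.screenEndo hg hV hk hx) hJ) =
      Module.finrank ℝ (robinson (hK.screenEndo hg hV hk hx) hJ) :=
    Module.finrank_mul_finrank ℝ ℂ _
  rw [Complex.finrank_real_complex] at h3
  have h4 : Module.finrank ℝ (robinson (hK.screenEndo hg hV hk hx) hJ) = 2 * m + 2 := by
    change Module.finrank ℝ ((robinson (hK.screenEndo hg hV hk hx) hJ).restrictScalars ℝ) = _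
    omega
  omega

omit hV hk in
theorem IsTwistingOptical.twistInducesAlmostRobinson (hk : IsOpticalField K k univ)
    (hF : ∀ x, ∀ v ∈ perp c K x,
      g.val x (twistMap g k x v) (twistMap g k x v) = g.val x v v) :
    TwistInducesAlmostRobinson c K m := by
  have hJ : ∀ x, ∀ s, hK.screenEndo hg isOpen_univ hk (mem_univ x)
      (hK.screenEndo hg isOpen_univ hk (mem_univ x) s) = -s := fun x =>
    hK.screenEndo_sq hg isOpen_univ hk (mem_univ x) (hF x)
  have hJe := fun x => hK.isTwistEndo_screenEndo hg isOpen_univ hk (mem_univ x)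
  refine ⟨k, fun x => hK.screenEndo hg isOpen_univ hk (mem_univ x),
    fun x => robinson _ (hJ x), hk, fun x => ⟨hJe x, hJ x⟩, ⟨hK.optical, ?_,
      fun g' hg' x z hz w hw => robinson_totallyNull hK.optical (hJe x) hg' hz hw,
      fun x z => robinson_inter_conj hK.optical z⟩, fun x z => mem_robinson⟩
  intro x₀
  have hrank := hK.finrank_robinson hg isOpen_univ hk (mem_univ x₀) (hJ x₀)
  -- At `x₀` a basis consists of vectors `v_i + i(F v_i + r_i k)`. Extending the `v_i` to sections
  -- of `K^⊥` and keeping the constants `r_i` gives a local frame.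
  let b := Module.finBasisOfFinrankEq ℂ (robinson _ (hJ x₀)) hrank
  choose v w hb hJb using fun i => mem_robinson.1 (b i).2
  have hbw : ∀ i, (w i : Tan (2 * m + 2) x₀) - twistMap g k x₀ (v i) ∈ K x₀ := fun i =>
    ((hK.cvec_mem_robinson hg isOpen_univ hk (mem_univ x₀) (hJ x₀)).1
      (by rw [← hb i]; exact (b i).2)).2
  choose r hr using fun i => (hK.optical.mem_iff_smul (hk.2 x₀ (mem_univ x₀)).1
    (hk.2 x₀ (mem_univ x₀)).2 _).1 (hbw i)
  choose W hW hxW X hX hXv hXp using fun i => hK.optical.exists_section x₀ (v i).2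
  set U := ⋂ i, W i with hU
  have hUo : IsOpen U := isOpen_iInter_of_finite hW
  have hXU : ∀ i, SmoothVF (X i) U := fun i => (hX i).mono (iInter_subset _ i)
  have hkU : SmoothVF k U := hk.1.mono (subset_univ U)
  have hYU : ∀ i, SmoothVF (fun x => twistMap g k x (X i x) + r i • k x) U := fun i =>
    (smoothVF_twistMap g hUo hkU (hXU i)).add (SmoothVF.smul contMDiffOn_const hkU)
  have hli : LinearIndependent ℂ fun i => cvec (X i x₀)
      (twistMap g k x₀ (X i x₀) + r i • k x₀) := by
    have h1 : LinearIndependent ℂ fun i => ((b i : robinson _ (hJ x₀)) : CTan (2 * m + 2) x₀) :=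
      b.linearIndependent.map' (Submodule.subtype _) (Submodule.ker_subtype _)
    have h2 : (fun i => cvec (X i x₀) (twistMap g k x₀ (X i x₀) + r i • k x₀)) =
        fun i => ((b i : robinson _ (hJ x₀)) : CTan (2 * m + 2) x₀) := by
      funext i
      rw [hb i, hXv i, ← hr i, add_sub_cancel]
    rwa [h2]
  obtain ⟨U', hU'U, hU'o, hxU', hU'⟩ :=
    eventually_linearIndependent_cvec hUo hXU hYU (mem_iInter.2 hxW) hli
  refine ⟨U', hU'o, hxU', X, fun i x => twistMap g k x (X i x) + r i • k x,
    fun i => ⟨(hXU i).mono hU'U, (hYU i).mono hU'U⟩, fun x hx => ⟨hU' x hx, ?_⟩⟩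
  have hmem : ∀ i, cvec (X i x) (twistMap g k x (X i x) + r i • k x) ∈ robinson _ (hJ x) := by
    intro i
    refine (hK.cvec_mem_robinson hg isOpen_univ hk (mem_univ x) (hJ x)).2
      ⟨hXp i x (mem_iInter.1 (hU'U hx) i), ?_⟩
    rw [add_sub_cancel_left]
    exact (K x).smul_mem _ (hk.2 x (mem_univ x)).1
  symm
  have hle : Submodule.span ℂ (range fun i => cvec (X i x)
      (twistMap g k x (X i x) + r i • k x)) ≤ robinson _ (hJ x) :=
    Submodule.span_le.2 (by rintro _ ⟨i, rfl⟩; exact hmem i)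
  refine Submodule.eq_of_le_of_finrank_eq hle ?_
  rw [finrank_span_eq_card (hU' x hx), Fintype.card_fin,
    hK.finrank_robinson hg isOpen_univ hk (mem_univ x) (hJ x)]

end RobinsonRank

/-! ### Flow boxes and local leaf spaces in `ℝ^{n+1}`. -/

section FlowBox

variable {n : ℕ}

/-- A vector field that is smooth on a neighbourhood of a point agrees near that point with a
globally smooth one. -/
theorem exists_globally_smooth {d : ℕ} {k : Euc d → Euc d} {Ω : Set (Euc d)} (hΩ : IsOpen Ω)
    (hk : ContDiffOn ℝ ∞ k Ω) {y₀ : Euc d} (hy : y₀ ∈ Ω) :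
    ∃ f : Euc d → Euc d, ContDiff ℝ ∞ f ∧ ∃ r > 0, Metric.ball y₀ r ⊆ Ω ∧
      ∀ y ∈ Metric.ball y₀ r, f y = k y := by
  obtain ⟨r, hr, hrΩ⟩ := Metric.isOpen_iff.1 hΩ y₀ hy
  let χ : ContDiffBump y₀ := ⟨r / 4, r / 2, by positivity, by linarith⟩
  refine ⟨fun y => χ y • k y, ?_, r / 4, by positivity,
    (Metric.ball_subset_ball (by linarith)).trans hrΩ, fun y hy => ?_⟩
  · rw [contDiff_iff_contDiffAt]
    intro y
    by_cases hyΩ : y ∈ Ω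
    · exact χ.contDiff.contDiffAt.smul (hk.contDiffAt (hΩ.mem_nhds hyΩ))
    · have h1 : y ∉ tsupport χ := by
        rw [χ.tsupport_eq]
        intro h2
        exact hyΩ (hrΩ (Metric.closedBall_subset_ball (by change r / 2 < r; linarith) h2))
      have h2 : (fun y => χ y • k y) =ᶠ[𝓝 y] fun _ => 0 := by
        filter_upwards [(isClosed_tsupport χ).isOpen_compl.mem_nhds h1] with z hz
        rw [image_eq_zero_of_notMem_tsupport hz, zero_smul]
      exact contDiffAt_const.congr_of_eventuallyEq h2
  · dsimp only
    rw [χ.one_of_mem_closedBall (Metric.ball_subset_closedBall hy), one_smul]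

/-- A linear isomorphism `ℝ^n × ℝ ≃ ℝ^{n+1}` with prescribed image of `(0, 1)`. -/
theorem exists_adapted_equiv {k : Euc (n + 1)} (hk : k ≠ 0) :
    ∃ A : (Euc n × ℝ) ≃L[ℝ] Euc (n + 1), ∀ t : ℝ, A (0, t) = t • k := by
  have : Fact (Module.finrank ℝ (Euc (n + 1)) = n + 1) := ⟨by simp⟩
  have h1 : Module.finrank ℝ (Euc n) = Module.finrank ℝ (ℝ ∙ k)ᗮ := by
    rw [Submodule.finrank_orthogonal_span_singleton (n := n) hk]
    simp
  let e := LinearEquiv.ofFinrankEq _ _ h1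
  let L : (Euc n × ℝ) →ₗ[ℝ] Euc (n + 1) :=
    ((ℝ ∙ k)ᗮ.subtype.comp e.toLinearMap).coprod (LinearMap.toSpanSingleton ℝ _ k)
  have hL : ∀ p, L p = (e p.1 : Euc (n + 1)) + p.2 • k := fun _ => rfl
  have hinj : Function.Injective L := by
    refine (injective_iff_map_eq_zero _).2 fun p hp => ?_
    rw [hL] at hp
    have h2 : inner ℝ k (e p.1 : Euc (n + 1)) = 0 :=
      Submodule.mem_orthogonal_singleton_iff_inner_right.1 (e p.1).2
    have h3 : p.2 = 0 := by
      have h4 := congrArg (fun z => inner ℝ k z) hp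
      simp only [inner_add_right, h2, inner_smul_right, zero_add, inner_zero_right, mul_eq_zero,
        inner_self_eq_zero] at h4
      exact h4.resolve_right hk
    rw [h3, zero_smul, add_zero] at hp
    have h5 : p.1 = 0 := by
      have h6 : e p.1 = 0 := Subtype.ext hp
      exact (LinearEquiv.map_eq_zero_iff e).1 h6
    exact Prod.ext h5 h3
  refine ⟨(LinearMap.linearEquivOfInjective L hinj (by simp)).toContinuousLinearEquiv,
    fun t => ?_⟩
  change L (0, t) = _
  rw [hL, map_zero]
  simp

/-- Flow coordinates: a smooth non-vanishing vector field is `∂/∂t` in suitable coordinates. -/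
theorem exists_flow_chart {k : Euc (n + 1) → Euc (n + 1)} {Ω : Set (Euc (n + 1))} (hΩ : IsOpen Ω)
    (hk : ContDiffOn ℝ ∞ k Ω) {y₀ : Euc (n + 1)} (hy : y₀ ∈ Ω) (hk0 : k y₀ ≠ 0) :
    ∃ e : OpenPartialHomeomorph (Euc n × ℝ) (Euc (n + 1)), (0, 0) ∈ e.source ∧ e (0, 0) = y₀ ∧
      e.target ⊆ Ω ∧ ContDiffOn ℝ ∞ e e.source ∧ ContDiffOn ℝ ∞ e.symm e.target ∧
      ∀ p ∈ e.source, (fderiv ℝ e p).IsInvertible ∧ ∀ t : ℝ, fderiv ℝ e p (0, t) = t • k (e p) := by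
  obtain ⟨f, hf, r, hr, hrΩ, hfk⟩ := exists_globally_smooth hΩ hk hy
  obtain ⟨W, Φ, hW, hW0, hΦ, hΦ0, hΦt⟩ := exists_smooth_flow hf y₀
  obtain ⟨A, hA⟩ := exists_adapted_equiv hk0
  -- `S(b, t)` follows the flow for time `t` from the point `y₀ + A(b, 0)` of a hyperplane
  -- transversal to `k y₀`; its differential at the origin is `A`.
  set σ : Euc n × ℝ → Euc (n + 1) × ℝ := fun p => (y₀ + A (p.1, 0), p.2) with hσ
  have hσc : ContDiff ℝ ∞ σ := by
    refine ContDiff.prodMk (contDiff_const.add (A.contDiff.comp ?_)) contDiff_snd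
    exact contDiff_fst.prodMk contDiff_const
  have hσ0 : σ (0, 0) = (y₀, 0) := by simp [hσ]
  set S : Euc n × ℝ → Euc (n + 1) := fun p => Φ (σ p) with hS
  have hW' : IsOpen (σ ⁻¹' W) := hW.preimage hσc.continuous
  have hSc : ContDiffOn ℝ ∞ S (σ ⁻¹' W) := hΦ.comp hσc.contDiffOn fun _ h => h
  set Q := (σ ⁻¹' W) ∩ S ⁻¹' (Metric.ball y₀ r) with hQ
  have hQo : IsOpen Q := hSc.continuousOn.isOpen_inter_preimage hW' Metric.isOpen_ball
  have hS0 : S (0, 0) = y₀ := by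
    change Φ (σ (0, 0)) = y₀
    rw [hσ0]
    exact hΦ0 y₀ hW0
  have h0W : ((0 : Euc n), (0 : ℝ)) ∈ σ ⁻¹' W := by rwa [mem_preimage, hσ0]
  have h0Q : ((0 : Euc n), (0 : ℝ)) ∈ Q := ⟨h0W, by
    rw [mem_preimage, hS0]; exact Metric.mem_ball_self hr⟩
  have hdiff : ∀ p ∈ σ ⁻¹' W, DifferentiableAt ℝ S p := fun p hp =>
    (hSc.contDiffAt (hW'.mem_nhds hp)).differentiableAt (by simp)
  have hdt : ∀ p ∈ Q, ∀ t : ℝ, fderiv ℝ S p (0, t) = t • k (S p) := by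
    intro p hp t
    have h1 : HasDerivAt (fun s : ℝ => (p.1, s)) ((0 : Euc n), (1 : ℝ)) p.2 :=
      (hasDerivAt_const _ _).prodMk (hasDerivAt_id _)
    have h2 := HasFDerivAt.comp_hasDerivAt (l := S) (f := fun s : ℝ => (p.1, s)) p.2
      (hdiff p hp.1).hasFDerivAt h1
    have h3 : HasDerivAt (fun s => S (p.1, s)) (f (S p)) p.2 := hΦt (σ p) hp.1
    have h4 := h2.unique h3
    rw [hfk _ hp.2] at h4
    rw [← h4, ← map_smul]
    simp
  have hdb : ∀ b : Euc n, fderiv ℝ S (0, 0) (b, 0) = A (b, 0) := by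
    intro b
    have h1 : HasDerivAt (fun s : ℝ => (s • b, (0 : ℝ))) (b, (0 : ℝ)) 0 := by
      have := ((hasDerivAt_id (0 : ℝ)).smul_const b).prodMk (hasDerivAt_const (0 : ℝ) (0 : ℝ))
      simpa using this
    have h00 : ((0 : ℝ) • b, (0 : ℝ)) = (0, 0) := by simp
    have h2 := HasFDerivAt.comp_hasDerivAt (l := S) (f := fun s : ℝ => (s • b, (0 : ℝ))) 0
      (by rw [h00]; exact (hdiff _ h0W).hasFDerivAt) h1
    have h3 : (S ∘ fun s : ℝ => (s • b, (0 : ℝ))) =ᶠ[𝓝 0] fun s => y₀ + s • A (b, 0) := by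
      have hc : Continuous fun s : ℝ => (s • b, (0 : ℝ)) := by fun_prop
      filter_upwards [hc.continuousAt.preimage_mem_nhds
        (hW'.mem_nhds (by rw [h00]; exact h0W))] with s hs
      have h4 : S (s • b, 0) = y₀ + A (s • b, 0) := hΦ0 _ hs
      rw [Function.comp_apply, h4, ← map_smul]
      simp
    have h5 : HasDerivAt (fun s : ℝ => y₀ + s • A (b, 0)) (A (b, 0)) 0 := by
      have := ((hasDerivAt_id (0 : ℝ)).smul_const (A (b, 0))).const_add y₀
      simpa using this
    exact h2.unique (h5.congr_of_eventuallyEq h3)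
  have hder : HasFDerivAt S (A : (Euc n × ℝ) →L[ℝ] Euc (n + 1)) (0, 0) := by
    have h1 := (hdiff _ h0W).hasFDerivAt
    have h2 : fderiv ℝ S (0, 0) = (A : (Euc n × ℝ) →L[ℝ] Euc (n + 1)) := by
      refine ContinuousLinearMap.ext fun p => ?_
      have h3 : p = (p.1, 0) + (0, p.2) := by simp
      change _ = A p
      rw [h3, map_add, map_add, hdb, hdt _ h0Q, hS0, hA]
    rwa [h2] at h1
  obtain ⟨e, he0, heQ, heS, hesymm, heinv⟩ := exists_smooth_localInverse hQo
    (hSc.mono inter_subset_left) h0Q A hder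
  have heS' : (e : Euc n × ℝ → Euc (n + 1)) = S := funext heS
  refine ⟨e, he0, by rw [heS, hS0], fun y hy => ?_, ?_, hesymm, fun p hp => ?_⟩
  · have h1 := (heQ (e.map_target hy)).2
    rw [mem_preimage, ← heS, e.right_inv hy] at h1
    exact hrΩ h1
  · rw [heS']
    exact hSc.mono fun p hp => (heQ hp).1
  · rw [heS']
    exact ⟨heinv p hp, hdt p (heQ hp)⟩

theorem fderiv_apply_eq_of_leftInverse {E F : Type*} [NormedAddCommGroup E] [NormedSpace ℝ E]
    [NormedAddCommGroup F] [NormedSpace ℝ F] {f : E → F} {h : F → E} {x : E}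
    (hf : DifferentiableAt ℝ f x) (hh : DifferentiableAt ℝ h (f x))
    (hinv : ∀ᶠ z in 𝓝 x, h (f z) = z) (u : E) : fderiv ℝ h (f x) (fderiv ℝ f x u) = u := by
  have h1 := hh.hasFDerivAt.comp x hf.hasFDerivAt
  have h2 : HasFDerivAt (h ∘ f) (ContinuousLinearMap.id ℝ E) x :=
    (hasFDerivAt_id x).congr_of_eventuallyEq hinv
  exact congrArg (fun A : E →L[ℝ] E => A u) (h1.unique h2)

/-- The local leaf space of a smooth non-vanishing vector field on an open subset of `ℝ^{n+1}`. -/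
theorem exists_flat_leaf_map {k : Euc (n + 1) → Euc (n + 1)} {Ω : Set (Euc (n + 1))}
    (hΩ : IsOpen Ω) (hk : ContDiffOn ℝ ∞ k Ω) {y₀ : Euc (n + 1)} (hy : y₀ ∈ Ω) (hk0 : k y₀ ≠ 0) :
    ∃ (O : Set (Euc (n + 1))) (ρ : Euc (n + 1) → Euc n), IsOpen O ∧ y₀ ∈ O ∧ O ⊆ Ω ∧
      ContDiffOn ℝ ∞ ρ O ∧ (∀ y ∈ O, Function.Surjective (fderiv ℝ ρ y) ∧
        ∀ v, fderiv ℝ ρ y v = 0 ↔ ∃ r : ℝ, v = r • k y) ∧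
      ∀ p, IsConnected (O ∩ ρ ⁻¹' {p}) := by
  obtain ⟨e, he0, hey, heΩ, he, hesymm, hder⟩ := exists_flow_chart hΩ hk hy hk0
  obtain ⟨ε, hε, hεs⟩ := Metric.isOpen_iff.1 e.open_source _ he0
  set box : Set (Euc n × ℝ) := Metric.ball 0 ε ×ˢ Metric.ball 0 ε with hbox
  have hboxs : box ⊆ e.source := by
    rw [hbox, ball_prod_same]
    exact hεs
  have hboxo : IsOpen box := Metric.isOpen_ball.prod Metric.isOpen_ball
  -- A diffeomorphism of all of `ℝ^n` onto the ball. Composing with its inverse gives `ρ` a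
  -- non-empty fibre over every point of `ℝ^n`, as connectedness of the fibres demands.
  set β := OpenPartialHomeomorph.univBall (0 : Euc n) ε with hβ
  have hβt : β.target = Metric.ball 0 ε := OpenPartialHomeomorph.univBall_target 0 hε
  have hβc : ContDiff ℝ ∞ β := OpenPartialHomeomorph.contDiff_univBall
  have hβs : ContDiffOn ℝ ∞ β.symm (Metric.ball 0 ε) :=
    OpenPartialHomeomorph.contDiffOn_univBall_symm
  set O := e.target ∩ e.symm ⁻¹' box with hO
  have hOo : IsOpen O := e.isOpen_inter_preimage_symm hboxo
  set ρ : Euc (n + 1) → Euc n := fun y => β.symm (e.symm y).1 with hρ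
  have hesO : ContDiffOn ℝ ∞ (fun y => (e.symm y).1) O :=
    contDiff_fst.comp_contDiffOn (hesymm.mono inter_subset_left)
  have hρc : ContDiffOn ℝ ∞ ρ O := hβs.comp hesO fun y hy => hy.2.1
  have hβd : ∀ b ∈ Metric.ball (0 : Euc n) ε, DifferentiableAt ℝ β.symm b := fun b hb =>
    (hβs.contDiffAt (Metric.isOpen_ball.mem_nhds hb)).differentiableAt (by simp)
  have hβinj : ∀ b ∈ Metric.ball (0 : Euc n) ε, ∀ u, fderiv ℝ β.symm b u = 0 → u = 0 := by
    intro b hb u hu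
    have h1 := fderiv_apply_eq_of_leftInverse (f := β.symm) (h := β) (hβd b hb)
      (hβc.differentiable (by simp) _) (by
        filter_upwards [Metric.isOpen_ball.mem_nhds hb] with z hz
        exact β.right_inv (by rwa [hβt])) u
    rw [← h1, hu, map_zero]
  have hβsurj : ∀ b ∈ Metric.ball (0 : Euc n) ε, ∀ w, ∃ u, fderiv ℝ β.symm b u = w := by
    intro b hb w
    have hbb : β (β.symm b) = b := β.right_inv (by rwa [hβt])
    have h1 := fderiv_apply_eq_of_leftInverse (f := β) (h := β.symm) (x := β.symm b)
      (hβc.differentiable (by simp) _) (by rw [hbb]; exact hβd b hb)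
      (Eventually.of_forall fun z => β.left_inv (by
        rw [hβ, OpenPartialHomeomorph.univBall_source]; trivial)) w
    rw [hbb] at h1
    exact ⟨_, h1⟩
  -- the differential of `ρ` in the flow coordinates
  have hkey : ∀ y ∈ O, ∃ D : (Euc n × ℝ) →L[ℝ] Euc (n + 1), D.IsInvertible ∧
      (∀ t : ℝ, D (0, t) = t • k y) ∧
      ∀ u, fderiv ℝ ρ y (D u) = fderiv ℝ β.symm (e.symm y).1 u.1 := by
    intro y hyO
    have hs := e.map_target hyO.1
    have hed : DifferentiableAt ℝ e (e.symm y) :=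
      (he.contDiffAt (e.open_source.mem_nhds hs)).differentiableAt (by simp)
    have hyy : e (e.symm y) = y := e.right_inv hyO.1
    refine ⟨fderiv ℝ e (e.symm y), (hder _ hs).1, fun t => ?_, fun u => ?_⟩
    · rw [(hder _ hs).2 t, hyy]
    · have h1 : HasFDerivAt ρ (fderiv ℝ ρ y) (e (e.symm y)) := by
        rw [hyy]
        exact ((hρc.contDiffAt (hOo.mem_nhds hyO)).differentiableAt (by simp)).hasFDerivAt
      have h2 := h1.comp (e.symm y) hed.hasFDerivAt
      have h3 : HasFDerivAt (fun z : Euc n × ℝ => β.symm z.1) _ (e.symm y) :=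
        (hβd _ hyO.2.1).hasFDerivAt.comp (e.symm y) hasFDerivAt_fst
      have h4 : (ρ ∘ e) =ᶠ[𝓝 (e.symm y)] fun z => β.symm z.1 := by
        filter_upwards [e.open_source.mem_nhds hs] with z hz
        rw [Function.comp_apply, hρ]
        dsimp only
        rw [e.left_inv hz]
      exact congrArg (fun A : (Euc n × ℝ) →L[ℝ] Euc n => A u)
        (h2.unique (h3.congr_of_eventuallyEq h4))
  refine ⟨O, ρ, hOo, ⟨?_, ?_⟩, fun y hy => heΩ hy.1, hρc, fun y hyO => ⟨fun w => ?_, fun v => ?_⟩,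
    fun p => ?_⟩
  · rw [← hey]
    exact e.map_source he0
  · rw [mem_preimage, ← hey, e.left_inv he0]
    exact ⟨Metric.mem_ball_self hε, Metric.mem_ball_self hε⟩
  · obtain ⟨D, -, -, hD⟩ := hkey y hyO
    obtain ⟨u, hu⟩ := hβsurj _ hyO.2.1 w
    exact ⟨D (u, 0), by rw [hD, hu]⟩
  · obtain ⟨D, hDi, hDt, hD⟩ := hkey y hyO
    constructor
    · intro hv
      have h1 := self_apply_inverse hDi v
      rw [← h1, hD] at hv
      have h2 := hβinj _ hyO.2.1 _ hv
      refine ⟨(D.inverse v).2, ?_⟩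
      rw [← hDt, ← h2]
      exact h1.symm
    · rintro ⟨r, rfl⟩
      rw [← hDt, hD]
      exact map_zero _
  · have hβp : β p ∈ Metric.ball (0 : Euc n) ε := by
      rw [← hβt]
      exact β.map_source (by rw [hβ, OpenPartialHomeomorph.univBall_source]; trivial)
    -- Each fibre is the image of a full time interval under the flow chart.
    have hset : O ∩ ρ ⁻¹' {p} = (fun t : ℝ => e (β p, t)) '' Metric.ball 0 ε := by
      ext y
      constructor
      · rintro ⟨hyO, hyp⟩
        refine ⟨(e.symm y).2, hyO.2.2, ?_⟩
        have h1 : β p = (e.symm y).1 := by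
          rw [← mem_singleton_iff.1 hyp]
          exact β.right_inv (by rw [hβt]; exact hyO.2.1)
        rw [h1]
        exact e.right_inv hyO.1
      · rintro ⟨t, ht, rfl⟩
        have hs : (β p, t) ∈ box := ⟨hβp, ht⟩
        refine ⟨⟨e.map_source (hboxs hs), ?_⟩, ?_⟩
        · rw [mem_preimage, e.left_inv (hboxs hs)]
          exact hs
        · rw [mem_preimage, mem_singleton_iff, hρ]
          dsimp only
          rw [e.left_inv (hboxs hs)]
          exact β.left_inv (by rw [hβ, OpenPartialHomeomorph.univBall_source]; trivial)
    rw [hset]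
    refine (Metric.isConnected_ball hε).image _ ?_
    refine he.continuousOn.comp (by fun_prop) fun t ht => hboxs ⟨hβp, ht⟩

end FlowBox

/-! ### Local leaf spaces of the line distribution. -/

section LeafSpace

variable {m : ℕ} {M : Type*} [TopologicalSpace M] [ChartedSpace (Euc (2 * m + 2)) M]
  [IsManifold 𝓘(ℝ, Euc (2 * m + 2)) ∞ M] {c : ConformalStructure (2 * m + 2) M}
  {K : ∀ x : M, Submodule ℝ (Tan (2 * m + 2) x)}

/-- Every point has a neighbourhood with a leaf space. -/
theorem IsOptical.exists_leafSpace (hK : IsOptical c K) (x : M) :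
    ∃ (U : Set M) (π : M → Euc (2 * m + 1)), x ∈ U ∧ IsLeafSpace (m := m) K U π := by
  obtain ⟨V, hV, hxV, k, hk⟩ := hK.exists_local_field x
  have hy := coord_mem_chartDom (d := 2 * m + 2) hxV
  have hk0 : vfInChart k x (coord x) ≠ 0 := by
    rw [vfInChart_coord]
    exact (hk.2 x hxV).2
  obtain ⟨O, ρ, hO, hyO, hOV, hρ, hder, hconn⟩ := exists_flat_leaf_map (n := 2 * m + 1)
    (isOpen_chartDom x hV) (contDiffOn_vfInChart hV hk.1 x) hy hk0
  set U := (chrt (d := 2 * m + 2) x).source ∩ chrt (d := 2 * m + 2) x ⁻¹' O with hU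
  have hUo : IsOpen U := isOpen_extChartAt_preimage' x hO
  set π : M → Euc (2 * m + 1) := fun z => ρ (chrt (d := 2 * m + 2) x z) with hπ
  have hπs : ContMDiffOn 𝓘(ℝ, Euc (2 * m + 2)) 𝓘(ℝ, Euc (2 * m + 1)) ∞ π U :=
    (contMDiffOn_iff_contDiffOn.2 hρ).comp
      (fun z hz => (contMDiffAt_chrt hz.1).contMDiffWithinAt) fun z hz => hz.2
  have hOt : O ⊆ (chrt (d := 2 * m + 2) x).target := fun y hy => (hOV hy).1
  have hD : ∀ y ∈ O, ∀ u : Euc (2 * m + 2),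
      (leafDeriv (m := m) π ((chrt (d := 2 * m + 2) x).symm y) (chartInvDeriv x y u) :
        Euc (2 * m + 1)) = fderiv ℝ ρ y u := by
    intro y hy u
    have hyU : (chrt (d := 2 * m + 2) x).symm y ∈ U :=
      ⟨(chrt x).map_target (hOt hy), by rwa [mem_preimage, (chrt x).right_inv (hOt hy)]⟩
    have h1 := ((hπs.contMDiffAt (hUo.mem_nhds hyU)).mdifferentiableAt
      (by simp)).hasMFDerivAt.comp y (hasMFDerivAt_chrt_symm (hOt hy))
    have h2 := (((hρ.contDiffAt (hO.mem_nhds hy)).differentiableAt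
      (by simp)).hasFDerivAt).hasMFDerivAt
    have h3 : (π ∘ (chrt (d := 2 * m + 2) x).symm) =ᶠ[𝓝 y] ρ := by
      filter_upwards [hO.mem_nhds hy] with z hz
      rw [Function.comp_apply, hπ]
      dsimp only
      rw [(chrt x).right_inv (hOt hz)]
    have h4 := hasMFDerivAt_unique h1 (h2.congr_of_eventuallyEq h3)
    exact congrArg (fun A : Euc (2 * m + 2) →L[ℝ] Euc (2 * m + 1) => A u) h4
  have hUy : ∀ z ∈ U, ∃ y ∈ O, z = (chrt (d := 2 * m + 2) x).symm y := fun z hz =>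
    ⟨_, hz.2, ((chrt x).left_inv hz.1).symm⟩
  refine ⟨U, π, ⟨mem_extChartAt_source x, hyO⟩, hUo, hπs, fun z hz w => ?_, fun z hz v => ?_,
    fun p => ?_⟩
  · obtain ⟨y, hy, rfl⟩ := hUy z hz
    obtain ⟨u, hu⟩ := (hder y hy).1 w
    exact ⟨chartInvDeriv x y u, (hD y hy u).trans hu⟩
  · obtain ⟨y, hy, rfl⟩ := hUy z hz
    obtain ⟨u, rfl⟩ := surjective_chartInvDeriv (hOt hy) v
    have h1 := hD y hy u
    have hyV := hOV hy
    rw [hK.mem_iff_smul (hk.2 _ hyV.2).1 (hk.2 _ hyV.2).2]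
    have h2 : (leafDeriv (m := m) π ((chrt (d := 2 * m + 2) x).symm y) (chartInvDeriv x y u) = 0) ↔
        fderiv ℝ ρ y u = 0 := ⟨fun h => h1.symm.trans h, fun h => h1.trans h⟩
    rw [h2, (hder y hy).2]
    refine exists_congr fun r => ?_
    rw [← chartInvDeriv_vfInChart k hyV.1, ← map_smul]
    refine ⟨fun h => by rw [h], fun h => ?_⟩
    rw [← sub_eq_zero, ← map_sub, chartInvDeriv_eq_zero hyV.1, sub_eq_zero] at h
    exact h
  · have hset : U ∩ π ⁻¹' {p} = (chrt (d := 2 * m + 2) x).symm '' (O ∩ ρ ⁻¹' {p}) := by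
      ext z
      constructor
      · rintro ⟨hz, hzp⟩
        exact ⟨_, ⟨hz.2, hzp⟩, (chrt x).left_inv hz.1⟩
      · rintro ⟨y, ⟨hyO, hyp⟩, rfl⟩
        refine ⟨⟨(chrt x).map_target (hOt hyO), ?_⟩, ?_⟩
        · rwa [mem_preimage, (chrt x).right_inv (hOt hyO)]
        · rw [mem_preimage, hπ]
          dsimp only
          rwa [(chrt x).right_inv (hOt hyO)]
    rw [hset]
    exact (hconn p).image _ ((continuousOn_extChartAt_symm x).mono fun y hy => hOt hy.1)

end LeafSpace

/-! ### Invariance up to factors along the leaves, in a box `U × I`. -/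

section Transport

set_option maxSynthPendingDepth 3

theorem mul_eq_mul_of_hasDerivAt {f h f' h' : ℝ → ℝ} {s : Set ℝ} (hs : IsOpen s)
    (hs' : IsPreconnected s) (hf : ∀ t ∈ s, HasDerivAt f (f' t) t)
    (hh : ∀ t ∈ s, HasDerivAt h (h' t) t) (h0 : ∀ t ∈ s, h t ≠ 0)
    (hfh : ∀ t ∈ s, f' t * h t = f t * h' t) {t t₀ : ℝ} (ht : t ∈ s) (ht₀ : t₀ ∈ s) :
    f t * h t₀ = f t₀ * h t := by
  have h1 : ∀ t ∈ s, HasDerivAt (fun t => f t / h t) 0 t := by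
    intro t ht
    have h2 := (hf t ht).div (hh t ht) (h0 t ht)
    rw [hfh t ht, sub_self, zero_div] at h2
    exact h2
  have h2 := hs.is_const_of_deriv_eq_zero hs'
    (fun t ht => (h1 t ht).differentiableAt.differentiableWithinAt)
    (fun t ht => (h1 t ht).deriv) ht ht₀
  rw [div_eq_div_iff (h0 t ht) (h0 t₀ ht₀)] at h2
  exact h2

variable {B : Type*} [NormedAddCommGroup B] [NormedSpace ℝ B]

/-- A `1`-form `α` and a symmetric tensor `g` on a box in `B × ℝ` that satisfy the infinitesimal
conditions for being constant along `ℝ`, up to factors. -/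
structure IsTransported (α : B × ℝ → B × ℝ →L[ℝ] ℝ) (g : B × ℝ → B × ℝ →L[ℝ] B × ℝ →L[ℝ] ℝ)
    (U : Set B) (I : Set ℝ) (n : B × ℝ) : Prop where
  isOpen_base : IsOpen U
  isOpen_int : IsOpen I
  preconnected : IsPreconnected I
  diff_form : ∀ z ∈ U ×ˢ I, DifferentiableAt ℝ α z
  diff_metric : ∀ z ∈ U ×ˢ I, DifferentiableAt ℝ g z
  form : ∀ z ∈ U ×ˢ I, ∀ u, α z u = 0 → fderiv ℝ α z (0, 1) u = 0
  metric : ∀ z ∈ U ×ˢ I, ∃ μ : ℝ, ∀ u v, α z u = 0 → α z v = 0 →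
    fderiv ℝ g z (0, 1) u v = μ * g z u v
  posdef : ∀ z ∈ U ×ˢ I, ∀ b, α z (b, 0) = 0 → b ≠ 0 → 0 < g z (b, 0) (b, 0)
  -- The values `α z n` measure how `α` is rescaled along `I`; their constant sign makes the scaling
  -- factors positive.
  pos : ∀ z ∈ U ×ˢ I, 0 < α z n

/-- `Y` is the image of `X` under the endomorphism defined by `g` and `½ dα` on the kernel of `α`. -/
def baseRel (α : B × ℝ → B × ℝ →L[ℝ] ℝ) (g : B × ℝ → B × ℝ →L[ℝ] B × ℝ →L[ℝ] ℝ) (z : B × ℝ)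
    (X Y : B) : Prop :=
  α z (X, 0) = 0 ∧ α z (Y, 0) = 0 ∧ ∀ Z, α z (Z, 0) = 0 →
    g z (Y, 0) (Z, 0) = 1 / 2 * extDerFlat α z (X, 0) (Z, 0)

namespace IsTransported

variable {α : B × ℝ → B × ℝ →L[ℝ] ℝ} {g : B × ℝ → B × ℝ →L[ℝ] B × ℝ →L[ℝ] ℝ}
  {U : Set B} {I : Set ℝ} {n : B × ℝ} (h : IsTransported α g U I n)
include h

omit h in
theorem hasDerivAt_line {F : Type*} [NormedAddCommGroup F] [NormedSpace ℝ F] {f : B × ℝ → F}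
    {b : B} {t : ℝ} (hf : DifferentiableAt ℝ f (b, t)) :
    HasDerivAt (fun t => f (b, t)) (fderiv ℝ f (b, t) (0, 1)) t :=
  HasFDerivAt.comp_hasDerivAt (l := f) (f := fun s : ℝ => (b, s)) t hf.hasFDerivAt
    ((hasDerivAt_const _ _).prodMk (hasDerivAt_id _))

/-- The derivative of `α` along `I` vanishes on `ker α`, hence is a multiple of `α`, and the
quotient `α(u)/α(n)` is constant. The test vector `α(n) u - α(u) n` lies in the kernel. -/
theorem form_const {b : B} {t t₀ : ℝ} (hb : b ∈ U) (ht : t ∈ I) (ht₀ : t₀ ∈ I) (u : B × ℝ) :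
    α (b, t) u * α (b, t₀) n = α (b, t₀) u * α (b, t) n := by
  have hd : ∀ u, ∀ t ∈ I, HasDerivAt (fun t => α (b, t) u) (fderiv ℝ α (b, t) (0, 1) u) t := by
    intro u t ht
    have h1 := (hasDerivAt_line (h.diff_form (b, t) ⟨hb, ht⟩)).clm_apply (hasDerivAt_const t u)
    simpa using h1
  refine mul_eq_mul_of_hasDerivAt h.isOpen_int h.preconnected (hd u) (hd n)
    (fun t ht => (h.pos (b, t) ⟨hb, ht⟩).ne') (fun t ht => ?_) ht ht₀
  have h1 := h.form (b, t) ⟨hb, ht⟩ (α (b, t) n • u - α (b, t) u • n) (by simp; ring)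
  simp only [map_sub, map_smul, smul_eq_mul] at h1
  linarith

theorem ker_const {b : B} {t t₀ : ℝ} (hb : b ∈ U) (ht : t ∈ I) (ht₀ : t₀ ∈ I) {u : B × ℝ}
    (hu : α (b, t₀) u = 0) : α (b, t) u = 0 := by
  have h1 := h.form_const hb ht ht₀ u
  rw [hu, zero_mul] at h1
  exact (mul_eq_zero.1 h1).resolve_right (h.pos (b, t₀) ⟨hb, ht₀⟩).ne'

/-- On the kernel, which is the same for all times, `g` obeys a scalar linear equation; the vector
`s` normalises the quotient. -/
theorem metric_const {b : B} {t t₀ : ℝ} (hb : b ∈ U) (ht : t ∈ I) (ht₀ : t₀ ∈ I) {u v : B × ℝ}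
    {s : B} (hu : α (b, t₀) u = 0) (hv : α (b, t₀) v = 0) (hs : α (b, t₀) (s, 0) = 0)
    (hs0 : s ≠ 0) : g (b, t) u v * g (b, t₀) (s, 0) (s, 0) =
      g (b, t₀) u v * g (b, t) (s, 0) (s, 0) := by
  have hd : ∀ u v, ∀ t ∈ I,
      HasDerivAt (fun t => g (b, t) u v) (fderiv ℝ g (b, t) (0, 1) u v) t := by
    intro u v t ht
    have h1 := ((hasDerivAt_line (h.diff_metric (b, t) ⟨hb, ht⟩)).clm_apply
      (hasDerivAt_const t u)).clm_apply (hasDerivAt_const t v)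
    simpa using h1
  refine mul_eq_mul_of_hasDerivAt h.isOpen_int h.preconnected (hd u v) (hd (s, 0) (s, 0))
    (fun t ht => (h.posdef (b, t) ⟨hb, ht⟩ s (h.ker_const hb ht ht₀ hs) hs0).ne')
    (fun t ht => ?_) ht ht₀
  obtain ⟨μ, hμ⟩ := h.metric (b, t) ⟨hb, ht⟩
  rw [hμ u v (h.ker_const hb ht ht₀ hu) (h.ker_const hb ht ht₀ hv),
    hμ _ _ (h.ker_const hb ht ht₀ hs) (h.ker_const hb ht ht₀ hs)]
  ring

/-- The normalised form `β = α/α(n)` does not depend on `t`, hence neither do its derivatives in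
base directions; on the kernel `dα = α(n) dβ`. -/
theorem extDer_const {b : B} {t t₀ : ℝ} (hb : b ∈ U) (ht : t ∈ I) (ht₀ : t₀ ∈ I) {X Y : B}
    (hX : α (b, t₀) (X, 0) = 0) (hY : α (b, t₀) (Y, 0) = 0) :
    extDerFlat α (b, t) (X, 0) (Y, 0) * α (b, t₀) n =
      extDerFlat α (b, t₀) (X, 0) (Y, 0) * α (b, t) n := by
  set β : B × ℝ → B × ℝ →L[ℝ] ℝ := fun z => (α z n)⁻¹ • α z with hβ
  have hαn : ∀ z ∈ U ×ˢ I, DifferentiableAt ℝ (fun z => α z n) z := fun z hz =>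
    (h.diff_form z hz).clm_apply (differentiableAt_const n)
  have hβd : ∀ z ∈ U ×ˢ I, DifferentiableAt ℝ β z := fun z hz =>
    ((hαn z hz).fun_inv (h.pos z hz).ne').smul (h.diff_form z hz)
  have hβt : ∀ a ∈ U, ∀ t ∈ I, ∀ t₀ ∈ I, β (a, t) = β (a, t₀) := by
    intro a ha t ht t₀ ht₀
    refine ContinuousLinearMap.ext fun u => ?_
    have h1 := h.form_const ha ht ht₀ u
    have h2 := (h.pos (a, t) ⟨ha, ht⟩).ne'
    have h3 := (h.pos (a, t₀) ⟨ha, ht₀⟩).ne'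
    change (α (a, t) n)⁻¹ * α (a, t) u = (α (a, t₀) n)⁻¹ * α (a, t₀) u
    field_simp
    linarith
  have hβX : ∀ t ∈ I, ∀ X : B, HasFDerivAt (fun a => β (a, t))
      ((fderiv ℝ β (b, t)).comp (ContinuousLinearMap.inl ℝ B ℝ)) b := by
    intro t ht X
    have h1 : HasFDerivAt (fun a : B => (a, t)) (ContinuousLinearMap.inl ℝ B ℝ) b :=
      hasFDerivAt_prodMk_left b t
    exact HasFDerivAt.comp (g := β) (f := fun a : B => (a, t)) b
      (hβd (b, t) ⟨hb, ht⟩).hasFDerivAt h1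
  have hβe : ∀ X : B, fderiv ℝ β (b, t) (X, 0) = fderiv ℝ β (b, t₀) (X, 0) := by
    intro X
    have h1 := (hβX t ht X).congr_of_eventuallyEq (f₁ := fun a => β (a, t₀)) (by
      filter_upwards [h.isOpen_base.mem_nhds hb] with a ha
      exact hβt a ha t₀ ht₀ t ht)
    have h2 := congrArg (fun A : B →L[ℝ] B × ℝ →L[ℝ] ℝ => A X) (h1.unique (hβX t₀ ht₀ X))
    simpa using h2
  have key : ∀ t ∈ I, extDerFlat α (b, t) (X, 0) (Y, 0) =
      α (b, t) n * extDerFlat β (b, t) (X, 0) (Y, 0) := by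
    intro t ht
    have hz : (b, t) ∈ U ×ˢ I := ⟨hb, ht⟩
    have h1 : α =ᶠ[𝓝 (b, t)] fun z => α z n • β z := by
      filter_upwards [(h.isOpen_base.prod h.isOpen_int).mem_nhds hz] with z hz
      rw [hβ]
      dsimp only
      rw [smul_smul, mul_inv_cancel₀ (h.pos z hz).ne', one_smul]
    have hβ0 : ∀ X, α (b, t₀) (X, 0) = 0 → β (b, t) (X, 0) = 0 := by
      intro X hX
      change (α (b, t) n)⁻¹ * α (b, t) (X, 0) = 0
      rw [h.ker_const hb ht ht₀ hX, mul_zero]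
    rw [extDerFlat_congr h1, extDerFlat_smul (hαn _ hz) (hβd _ hz) (hβ0 X hX) (hβ0 Y hY)]
  rw [key t ht, key t₀ ht₀, extDerFlat, extDerFlat, hβe, hβe]
  ring

/-- From `t₀` to `t` the metric on the kernel is multiplied by some `q > 0` and `dα` by some `r >
0`, so the endomorphism is multiplied by `r / q`. As it is isometric at both times, `r / q = ±1`,
and positivity leaves `r = q`. -/
theorem baseRel_iff {b : B} {t t₀ : ℝ} (hb : b ∈ U) (ht : t ∈ I) (ht₀ : t₀ ∈ I)
    (hunit : ∀ t ∈ I, ∀ X Y, baseRel α g (b, t) X Y →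
      g (b, t) (Y, 0) (Y, 0) = g (b, t) (X, 0) (X, 0))
    {X₀ Y₀ : B} (h0 : baseRel α g (b, t₀) X₀ Y₀) (hX₀ : X₀ ≠ 0) (X Y : B) :
    baseRel α g (b, t) X Y ↔ baseRel α g (b, t₀) X Y := by
  have hp := h.posdef (b, t₀) ⟨hb, ht₀⟩ X₀ h0.1 hX₀
  have hp' := h.posdef (b, t) ⟨hb, ht⟩ X₀ (h.ker_const hb ht ht₀ h0.1) hX₀
  have hn := h.pos (b, t) ⟨hb, ht⟩
  have hn₀ := h.pos (b, t₀) ⟨hb, ht₀⟩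
  set q := g (b, t) (X₀, 0) (X₀, 0) / g (b, t₀) (X₀, 0) (X₀, 0) with hq
  set r := α (b, t) n / α (b, t₀) n with hr
  have hq0 : 0 < q := div_pos hp' hp
  have hr0 : 0 < r := div_pos hn hn₀
  have hker : ∀ u, α (b, t) u = 0 ↔ α (b, t₀) u = 0 := fun u =>
    ⟨fun hu => h.ker_const hb ht₀ ht hu, fun hu => h.ker_const hb ht ht₀ hu⟩
  have hg : ∀ u v, α (b, t₀) u = 0 → α (b, t₀) v = 0 → g (b, t) u v = q * g (b, t₀) u v := by
    intro u v hu hv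
    have h1 := h.metric_const hb ht ht₀ hu hv h0.1 hX₀
    rw [hq]
    field_simp
    linarith
  have hd : ∀ X Y, α (b, t₀) (X, 0) = 0 → α (b, t₀) (Y, 0) = 0 →
      extDerFlat α (b, t) (X, 0) (Y, 0) = r * extDerFlat α (b, t₀) (X, 0) (Y, 0) := by
    intro X Y hX hY
    have h1 := h.extDer_const hb ht ht₀ hX hY
    rw [hr]
    field_simp
    linarith
  have hsm : ∀ (a : ℝ) (Y : B), ((a • Y, 0) : B × ℝ) = a • (Y, 0) := fun a Y => by simp
  have hqr : r = q := by
    have h1 : baseRel α g (b, t) X₀ ((r / q) • Y₀) := by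
      refine ⟨(hker _).2 h0.1, (hker _).2 ?_, fun Z hZ => ?_⟩
      · rw [hsm, map_smul, h0.2.1, smul_zero]
      · have hZ' := (hker _).1 hZ
        rw [hsm, map_smul, smul_apply, hg _ _ h0.2.1 hZ', h0.2.2 Z hZ', hd _ _ h0.1 hZ', smul_eq_mul]
        field_simp
    have h2 := hunit t ht _ _ h1
    have h3 := hunit t₀ ht₀ _ _ h0
    rw [hsm, map_smul, map_smul, smul_apply, hg _ _ h0.2.1 h0.2.1, h3, hg _ _ h0.1 h0.1,
      smul_eq_mul, smul_eq_mul, ← mul_assoc] at h2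
    have h4 : r / q * (r / q) = 1 := mul_right_cancel₀ (mul_pos hq0 hp).ne' (by rw [h2, one_mul])
    have h5 : r / q = 1 := by
      rcases mul_self_eq_one_iff.1 h4 with h5 | h5
      · exact h5
      · exact absurd (div_pos hr0 hq0) (by rw [h5]; norm_num)
    rwa [div_eq_one_iff_eq hq0.ne'] at h5
  unfold baseRel
  rw [hker, hker]
  refine and_congr_right fun hX => and_congr_right fun hY => forall_congr' fun Z => ?_
  rw [hker]
  refine imp_congr_right fun hZ => ?_
  rw [hg _ _ hY hZ, hd _ _ hX hZ, hqr]
  constructor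
  · intro h1
    exact mul_left_cancel₀ hq0.ne' (by linarith)
  · intro h1
    rw [h1]
    ring

end IsTransported

end Transport

/-! ### Descent of the twist endomorphism along a submersion with fibres tangent to `k`. -/

section FlatDescent

set_option maxSynthPendingDepth 3

variable {E B : Type*} [NormedAddCommGroup E] [NormedSpace ℝ E] [NormedAddCommGroup B]
  [NormedSpace ℝ B] {G : E → E →L[ℝ] E →L[ℝ] ℝ} {Ω : Set E} {k : E → E}

/-- `w` represents the image of `v` under the endomorphism of the screen space at `y` defined by
the twist of `k`. -/
def flatRep (G : E → E →L[ℝ] E →L[ℝ] ℝ) (k : E → E) (y v w : E) : Prop :=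
  G y (k y) v = 0 ∧ G y (k y) w = 0 ∧ ∀ u, G y (k y) u = 0 →
    G y w u = 1 / 2 * extDerFlat (fun z => G z (k z)) y v u

/-- `dκ(k, ·)` and `g(k, ·)` both vanish on `k^⊥`, so only classes modulo `k` matter. -/
theorem IsShearFreeNull.flatRep_add_smul (hk : IsShearFreeNull G Ω k) {y v w : E} (hy : y ∈ Ω) (h : flatRep G k y v w) (r s : ℝ) :
    flatRep G k y (v + r • k y) (w + s • k y) := by
  refine ⟨?_, ?_, fun u hu => ?_⟩
  · rw [map_add, map_smul, h.1, hk.null y hy, smul_zero, add_zero]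
  · rw [map_add, map_smul, h.2.1, hk.null y hy, smul_zero, add_zero]
  · have h1 : extDerFlat (fun z => G z (k z)) y (v + r • k y) u =
        extDerFlat (fun z => G z (k z)) y v u + r * extDerFlat (fun z => G z (k z)) y (k y) u := by
      simp only [extDerFlat, map_add, map_smul, add_apply, smul_apply, smul_eq_mul]
      ring
    rw [h1, hk.geodesic y hy u hu, map_add, map_smul, add_apply, smul_apply, hu, h.2.2 u hu]
    simp

variable [CompleteSpace E] [CompleteSpace B]

/-- A submersion `P` whose fibres are tangent to `k` extends to a chart `(P, ℓ)`. -/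
theorem exists_submersion_chart {P : E → B} (hΩ : IsOpen Ω) (hP : ContDiffOn ℝ ∞ P Ω)
    (hker : ∀ y ∈ Ω, ∀ v, fderiv ℝ P y v = 0 ↔ ∃ r : ℝ, v = r • k y)
    (hsurj : ∀ y ∈ Ω, Function.Surjective (fderiv ℝ P y)) {y₀ : E} (hy₀ : y₀ ∈ Ω)
    (hk0 : k y₀ ≠ 0) :
    ∃ (ℓ : E →L[ℝ] ℝ) (e : OpenPartialHomeomorph E (B × ℝ)), y₀ ∈ e.source ∧ e.source ⊆ Ω ∧
      (∀ y, e y = (P y, ℓ y)) ∧ ContDiffOn ℝ ∞ e.symm e.target ∧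
      (∀ z ∈ e.target, ∀ u, fderiv ℝ P (e.symm z) (fderiv ℝ e.symm z u) = u.1) ∧
      ∀ z ∈ e.target, ∀ v, fderiv ℝ e.symm z (fderiv ℝ P (e.symm z) v, ℓ v) = v := by
  -- The kernel of `DP` at `y₀` is spanned by `k y₀`, so a functional with value 1 on it completes
  -- `P` to a local diffeomorphism.
  obtain ⟨ℓ, hℓ⟩ := SeparatingDual.exists_eq_one (R := ℝ) hk0
  have hPd : ∀ y ∈ Ω, HasFDerivAt P (fderiv ℝ P y) y := fun y hy =>
    ((hP.contDiffAt (hΩ.mem_nhds hy)).differentiableAt (by simp)).hasFDerivAt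
  have hΨ : ∀ y ∈ Ω, HasFDerivAt (fun y => (P y, ℓ y)) ((fderiv ℝ P y).prod ℓ) y :=
    fun y hy => (hPd y hy).prodMk ℓ.hasFDerivAt
  have hinj : Function.Injective ((fderiv ℝ P y₀).prod ℓ) := by
    refine (injective_iff_map_eq_zero _).2 fun v hv => ?_
    obtain ⟨h1, h2⟩ := Prod.ext_iff.1 hv
    obtain ⟨r, rfl⟩ := (hker y₀ hy₀ v).1 h1
    have h3 : r = 0 := by simpa [hℓ] using h2
    rw [h3, zero_smul]
  have hsur : Function.Surjective ((fderiv ℝ P y₀).prod ℓ) := by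
    rintro ⟨b, t⟩
    obtain ⟨v, hv⟩ := hsurj y₀ hy₀ b
    have h1 := (hker y₀ hy₀ ((t - ℓ v) • k y₀)).2 ⟨_, rfl⟩
    refine ⟨v + (t - ℓ v) • k y₀, Prod.ext ?_ ?_⟩
    · change fderiv ℝ P y₀ _ = b
      rw [map_add, h1, add_zero, hv]
    · change ℓ _ = t
      rw [map_add, map_smul, hℓ]
      simp
  obtain ⟨e, he0, heΩ, hee, hes, -⟩ := exists_smooth_localInverse hΩ
    (hP.prodMk ℓ.contDiff.contDiffOn) hy₀
    (ContinuousLinearEquiv.ofBijective ((fderiv ℝ P y₀).prod ℓ) (LinearMap.ker_eq_bot.2 hinj)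
      (LinearMap.range_eq_top.2 hsur)) (hΨ y₀ hy₀)
  have hee' : (e : E → B × ℝ) = fun y => (P y, ℓ y) := funext hee
  have hed : ∀ y ∈ e.source, HasFDerivAt e ((fderiv ℝ P y).prod ℓ) y := fun y hy => by
    rw [hee']
    exact hΨ y (heΩ hy)
  have hesd : ∀ z ∈ e.target, DifferentiableAt ℝ e.symm z := fun z hz =>
    (hes.contDiffAt (e.open_target.mem_nhds hz)).differentiableAt (by simp)
  refine ⟨ℓ, e, he0, heΩ, hee, hes, fun z hz u => ?_, fun z hz v => ?_⟩
  · have h1 := fderiv_apply_eq_of_leftInverse (hesd z hz)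
      (hed _ (e.map_target hz)).differentiableAt
      (by filter_upwards [e.open_target.mem_nhds hz] with z hz using e.right_inv hz) u
    rw [(hed _ (e.map_target hz)).fderiv] at h1
    exact congrArg Prod.fst h1
  · have h2 := e.map_target hz
    have h1 := fderiv_apply_eq_of_leftInverse (hed _ h2).differentiableAt
      (h := e.symm) (by rw [e.right_inv hz]; exact hesd z hz)
      (by filter_upwards [e.open_source.mem_nhds h2] with z hz using e.left_inv hz) v
    rw [e.right_inv hz, (hed _ h2).fderiv] at h1
    exact h1

/-- Along the fibres of a submersion with fibres tangent to `k`, the endomorphism defined by the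
twist of a `k` normalized to be isometric is locally constant. -/
theorem IsShearFreeNull.exists_section (hG : IsFlatMetric G Ω) (hk : IsShearFreeNull G Ω k)
    {P : E → B} (hP : ContDiffOn ℝ ∞ P Ω)
    (hker : ∀ y ∈ Ω, ∀ v, fderiv ℝ P y v = 0 ↔ ∃ r : ℝ, v = r • k y)
    (hsurj : ∀ y ∈ Ω, Function.Surjective (fderiv ℝ P y))
    (hpos : ∀ y ∈ Ω, ∀ v, G y (k y) v = 0 → 0 < G y v v ∨ ∃ r : ℝ, v = r • k y)
    (hunit : ∀ y ∈ Ω, ∀ v w, flatRep G k y v w → G y w w = G y v v)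
    (hex : ∀ y ∈ Ω, ∃ v w, flatRep G k y v w ∧ ∀ r : ℝ, v ≠ r • k y) {y₀ : E} (hy₀ : y₀ ∈ Ω) :
    ∃ (N : Set B) (s : B → E) (O : Set E), IsOpen N ∧ P y₀ ∈ N ∧ ContDiffOn ℝ ∞ s N ∧
      s (P y₀) = y₀ ∧ (∀ b ∈ N, s b ∈ Ω ∧ P (s b) = b) ∧ IsOpen O ∧ y₀ ∈ O ∧ O ⊆ Ω ∧
      ∀ y ∈ O, P y = P y₀ → ∀ X Y,
        ((∃ v w, flatRep G k y v w ∧ fderiv ℝ P y v = X ∧ fderiv ℝ P y w = Y) ↔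
          ∃ v w, flatRep G k y₀ v w ∧ fderiv ℝ P y₀ v = X ∧ fderiv ℝ P y₀ w = Y) := by
  obtain ⟨ℓ, e, he0, heΩ, hee, hes, hDP, hDS⟩ := exists_submersion_chart hG.isOpen hP hker hsurj
    hy₀ (hk.ne_zero y₀ hy₀)
  set S := e.symm with hS
  set T := e.target with hT
  have hSΩ : ∀ z ∈ T, S z ∈ Ω := fun z hz => heΩ (e.map_target hz)
  have hSc : ∀ z ∈ T, ContDiffAt ℝ ∞ S z := fun z hz => hes.contDiffAt (e.open_target.mem_nhds hz)
  have hSd : ∀ z ∈ T, DifferentiableAt ℝ S z := fun z hz => (hSc z hz).differentiableAt (by simp)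
  have hS2 : ∀ z ∈ T, ContDiffAt ℝ 2 S z := fun z hz => (hSc z hz).of_le two_le_smooth
  have hfS : ContDiffOn ℝ ∞ (fderiv ℝ S) T := hes.fderiv_of_isOpen e.open_target (by simp)
  have hkd : ∀ y ∈ Ω, DifferentiableAt ℝ k y := fun y hy => hk.differentiableAt hG hy
  set κ : E → E →L[ℝ] ℝ := fun y => G y (k y) with hκ
  have hκc : ContDiffOn ℝ ∞ κ Ω := hG.smooth.clm_apply hk.smooth
  have hκd : ∀ y ∈ Ω, DifferentiableAt ℝ κ y := fun y hy =>
    (hκc.contDiffAt (hG.isOpen.mem_nhds hy)).differentiableAt (by simp)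
  -- In the coordinates `(P, ℓ)` the field `k` is `a ∂_t`.
  set a : B × ℝ → ℝ := fun z => ℓ (k (S z)) with ha
  have hDk : ∀ z ∈ T, fderiv ℝ S z (0, a z) = k (S z) := by
    intro z hz
    have h1 := hDS z hz (k (S z))
    rwa [(hker _ (hSΩ z hz) _).2 ⟨1, (one_smul ℝ _).symm⟩] at h1
  have hsm : ∀ (r t : ℝ), ((0 : B), r * t) = r • ((0 : B), t) := fun r t => by simp
  have ha0 : ∀ z ∈ T, a z ≠ 0 := by
    intro z hz h1
    have h2 := hDk z hz
    rw [h1] at h2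
    exact hk.ne_zero _ (hSΩ z hz) (h2.symm.trans (map_zero _))
  have hD1 : ∀ z ∈ T, ∀ t : ℝ, fderiv ℝ S z (0, t) = (t / a z) • k (S z) := by
    intro z hz t
    rw [← hDk z hz, ← map_smul, ← hsm, div_mul_cancel₀ _ (ha0 z hz)]
  set α : B × ℝ → B × ℝ →L[ℝ] ℝ := pullForm S κ with hα
  set g : B × ℝ → B × ℝ →L[ℝ] B × ℝ →L[ℝ] ℝ := fun z =>
    (G (S z)).bilinearComp (fderiv ℝ S z) (fderiv ℝ S z) with hg
  have hαa : ∀ z u, α z u = G (S z) (k (S z)) (fderiv ℝ S z u) := fun _ _ => rfl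
  have hga : ∀ z u v, g z u v = G (S z) (fderiv ℝ S z u) (fderiv ℝ S z v) := fun _ _ _ => rfl
  have hαc : ContDiffOn ℝ ∞ α T := (hκc.comp hes hSΩ).clm_comp hfS
  have hαd : ∀ z ∈ T, DifferentiableAt ℝ α z := fun z hz =>
    (hαc.contDiffAt (e.open_target.mem_nhds hz)).differentiableAt (by simp)
  have hgd : ∀ z ∈ T, DifferentiableAt ℝ g z := by
    intro z hz
    have h0 : DifferentiableAt ℝ (fderiv ℝ S) z :=
      (hfS.contDiffAt (e.open_target.mem_nhds hz)).differentiableAt (by simp)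
    have h1 : DifferentiableAt ℝ (fun z => (G (S z)).comp (fderiv ℝ S z)) z :=
      ((hG.differentiableAt (hSΩ z hz)).comp z (hSd z hz)).clm_comp h0
    have h2 : DifferentiableAt ℝ (fun z =>
        ((ContinuousLinearMap.compL ℝ (B × ℝ) E ℝ).flip (fderiv ℝ S z)).comp
          ((G (S z)).comp (fderiv ℝ S z))) z :=
      (((ContinuousLinearMap.compL ℝ (B × ℝ) E ℝ).flip.differentiableAt).comp z h0).clm_comp h1
    exact h2
  have hα1 : ∀ z ∈ T, ∀ t, α z (0, t) = 0 := by
    intro z hz t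
    rw [hαa, hD1 z hz, map_smul, hk.null _ (hSΩ z hz), smul_zero]
  have hg1 : ∀ z ∈ T, ∀ t u, α z u = 0 → g z (0, t) u = 0 := by
    intro z hz t u hu
    rw [hga, hD1 z hz, map_smul, smul_apply, ← hαa, hu, smul_zero]
  have hext : ∀ z ∈ T, ∀ u v, extDerFlat α z u v =
      extDerFlat κ (S z) (fderiv ℝ S z u) (fderiv ℝ S z v) := fun z hz u v =>
    extDerFlat_pullForm (hS2 z hz) (hκd _ (hSΩ z hz)) u v
  -- The geodesic condition reads `dα(a ∂_t, u) = 0` on `ker α`. Since `α(∂_t)` vanishes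
  -- identically, only `a (∂_t α)(u)` is left.
  have hform : ∀ z ∈ T, ∀ u, α z u = 0 → fderiv ℝ α z (0, 1) u = 0 := by
    intro z hz u hu
    have h1 := hext z hz (0, a z) u
    rw [hDk z hz, hk.geodesic _ (hSΩ z hz) _ (by rw [← hαa, hu])] at h1
    have h2 : fderiv ℝ α z u (0, a z) = 0 := by
      have h3 := (hαd z hz).hasFDerivAt.clm_apply (hasFDerivAt_const ((0 : B), a z) z)
      have h4 : (fun w => α w (0, a z)) =ᶠ[𝓝 z] fun _ => 0 := by
        filter_upwards [e.open_target.mem_nhds hz] with w hw using hα1 w hw _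
      have h5 := h3.unique ((hasFDerivAt_const (0 : ℝ) z).congr_of_eventuallyEq h4)
      simpa using congrArg (fun A : B × ℝ →L[ℝ] ℝ => A u) h5
    rw [extDerFlat, h2, sub_zero] at h1
    have h6 := hsm (a z) 1
    rw [mul_one] at h6
    rw [h6, map_smul, smul_apply, smul_eq_mul] at h1
    exact (mul_eq_zero.1 h1).resolve_left (ha0 z hz)
  have had : ∀ z ∈ T, DifferentiableAt ℝ a z := fun z hz =>
    ℓ.differentiableAt.comp z ((hkd _ (hSΩ z hz)).comp z (hSd z hz))
  -- The Lie derivative of `g` along `a ∂_t` is `a ∂_t g` plus terms in which `da` multiplies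
  -- `g(∂_t, ·)`. These vanish on `ker α`, so shear-freeness becomes a condition on `∂_t g` alone.
  have hmet : ∀ z ∈ T, ∃ μ : ℝ, ∀ u v, α z u = 0 → α z v = 0 →
      fderiv ℝ g z (0, 1) u v = μ * g z u v := by
    intro z hz
    obtain ⟨μ, hμ⟩ := hk.shearFree _ (hSΩ z hz)
    refine ⟨μ / a z, fun u v hu hv => ?_⟩
    have hX : HasFDerivAt (fun z => ((0 : B), a z))
        ((0 : B × ℝ →L[ℝ] B).prod (fderiv ℝ a z)) z :=
      (hasFDerivAt_const _ z).prodMk (had z hz).hasFDerivAt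
    have h1 := lieTensorFlat_pullback (f := S) (k := fun z => ((0 : B), a z)) (k' := k) (G' := G)
      (hS2 z hz) hX.differentiableAt (hkd _ (hSΩ z hz)) (hG.differentiableAt (hSΩ z hz))
      (by filter_upwards [e.open_target.mem_nhds hz] with w hw using hDk w hw) u v
    rw [hμ _ _ (by rw [← hαa, hu]) (by rw [← hαa, hv])] at h1
    change lieTensorFlat _ g z u v = μ * g z u v at h1
    rw [lieTensorFlat, hX.fderiv] at h1
    have hgs : g z u (0, fderiv ℝ a z v) = g z (0, fderiv ℝ a z v) u := by
      rw [hga, hga, hG.symm _ (hSΩ z hz)]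
    simp only [ContinuousLinearMap.prod_apply, zero_apply] at h1
    rw [hgs, hg1 z hz _ _ hu, hg1 z hz _ _ hv, add_zero, add_zero] at h1
    have h6 := hsm (a z) 1
    rw [mul_one] at h6
    rw [h6, map_smul, smul_apply, smul_apply, smul_eq_mul] at h1
    have := ha0 z hz
    field_simp
    linarith
  have hpd : ∀ z ∈ T, ∀ b, α z (b, 0) = 0 → b ≠ 0 → 0 < g z (b, 0) (b, 0) := by
    intro z hz b hb hb0
    rw [hga]
    refine (hpos _ (hSΩ z hz) _ (by rw [← hαa, hb])).resolve_right ?_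
    intro h1
    have h2 := (hker _ (hSΩ z hz) _).2 h1
    rw [hDP z hz] at h2
    exact hb0 h2
  have hdec : ∀ z ∈ T, ∀ v, v = fderiv ℝ S z (fderiv ℝ P (S z) v, 0) +
      (ℓ v / a z) • k (S z) := by
    intro z hz v
    rw [← hD1 z hz, ← map_add]
    have h1 := (hDS z hz v).symm
    have h2 : ((fderiv ℝ P (S z) v, (0 : ℝ)) : B × ℝ) + (0, ℓ v) = (fderiv ℝ P (S z) v, ℓ v) := by
      simp
    rwa [h2]
  have hrel' : ∀ z ∈ T, ∀ X Y, baseRel α g z X Y →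
      flatRep G k (S z) (fderiv ℝ S z (X, 0)) (fderiv ℝ S z (Y, 0)) := by
    rintro z hz X Y ⟨h1, h2, h3⟩
    refine ⟨h1, h2, fun u hu => ?_⟩
    have hu' := hdec z hz u
    set Z := fderiv ℝ P (S z) u
    have hZ : α z (Z, 0) = 0 := by
      rw [hu', map_add, map_smul, hk.null _ (hSΩ z hz), smul_zero, add_zero] at hu
      exact hu
    have h4 := h3 Z hZ
    rw [hga, hext z hz] at h4
    have h5 : extDerFlat κ (S z) (fderiv ℝ S z (X, 0)) (k (S z)) = 0 := by
      have h6 : extDerFlat κ (S z) (k (S z)) (fderiv ℝ S z (X, 0)) = 0 :=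
        hk.geodesic _ (hSΩ z hz) _ h1
      rw [extDerFlat_swap, h6, neg_zero]
    have h6 : G (S z) (fderiv ℝ S z (Y, 0)) (k (S z)) = 0 := by
      rw [hG.symm _ (hSΩ z hz)]
      exact h2
    have h7 : extDerFlat κ (S z) (fderiv ℝ S z (X, 0)) u =
        extDerFlat κ (S z) (fderiv ℝ S z (X, 0)) (fderiv ℝ S z (Z, 0)) +
          (ℓ u / a z) * extDerFlat κ (S z) (fderiv ℝ S z (X, 0)) (k (S z)) := by
      conv_lhs => rw [hu']
      simp only [extDerFlat, map_add, map_smul, add_apply, smul_apply, smul_eq_mul]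
      ring
    rw [h7, h5, mul_zero, add_zero, ← h4]
    conv_lhs => rw [hu']
    rw [map_add, map_smul, h6, smul_zero, add_zero]
  -- Every vector orthogonal to `k` is, modulo `k`, the image of a vector tangent to the slice; so
  -- the relation on the slice is the twist relation seen through `DP`.
  have hrel : ∀ z ∈ T, ∀ X Y, baseRel α g z X Y ↔
      ∃ v w, flatRep G k (S z) v w ∧ fderiv ℝ P (S z) v = X ∧ fderiv ℝ P (S z) w = Y := by
    intro z hz X Y
    constructor
    · intro h
      exact ⟨_, _, hrel' z hz X Y h, hDP z hz _, hDP z hz _⟩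
    · rintro ⟨v, w, hvw, rfl, rfl⟩
      have h1 := hk.flatRep_add_smul (hSΩ z hz) hvw (-(ℓ v / a z)) (-(ℓ w / a z))
      have h2 : ∀ v, v + (-(ℓ v / a z)) • k (S z) = fderiv ℝ S z (fderiv ℝ P (S z) v, 0) := by
        intro v
        rw [neg_smul, ← sub_eq_add_neg, sub_eq_iff_eq_add]
        exact hdec z hz v
      rw [h2, h2] at h1
      refine ⟨h1.1, h1.2.1, fun Z hZ => ?_⟩
      rw [hga, hext z hz]
      exact h1.2.2 _ hZ
  have hz₀ : e y₀ ∈ T := e.map_source he0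
  have hSe : ∀ y ∈ e.source, S (e y) = y := fun y hy => e.left_inv hy
  obtain ⟨n, hn⟩ : ∃ n, 0 < α (e y₀) n := by
    obtain ⟨w, hw⟩ := hG.exists_pairing_ne_zero hy₀ (hk.ne_zero y₀ hy₀)
    have h1 := hDS _ hz₀ w
    rw [hSe _ he0] at h1
    have h2 : α (e y₀) (fderiv ℝ P y₀ w, ℓ w) ≠ 0 := by
      rw [hαa, h1, hSe _ he0]
      exact hw
    rcases lt_or_gt_of_ne h2 with h3 | h3
    · exact ⟨-(fderiv ℝ P y₀ w, ℓ w), by rw [map_neg]; linarith⟩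
    · exact ⟨_, h3⟩
  have hnh : T ∩ {z | 0 < α z n} ∈ 𝓝 (e y₀) := by
    refine inter_mem (e.open_target.mem_nhds hz₀) ?_
    exact ((hαd _ hz₀).continuousAt.clm_apply continuousAt_const).eventually_const_lt hn
  obtain ⟨r, hr, hrs⟩ := Metric.mem_nhds_iff.1 hnh
  have hbox : Metric.ball (P y₀) r ×ˢ Metric.ball (ℓ y₀) r ⊆ T ∩ {z | 0 < α z n} := by
    rw [ball_prod_same, ← hee]
    exact hrs
  set U := Metric.ball (P y₀) r with hU
  set I := Metric.ball (ℓ y₀) r with hI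
  have hTr : IsTransported α g U I n :=
    { isOpen_base := Metric.isOpen_ball
      isOpen_int := Metric.isOpen_ball
      preconnected := (convex_ball _ _).isPreconnected
      diff_form := fun z hz => hαd z (hbox hz).1
      diff_metric := fun z hz => hgd z (hbox hz).1
      form := fun z hz => hform z (hbox hz).1
      metric := fun z hz => hmet z (hbox hz).1
      posdef := fun z hz => hpd z (hbox hz).1
      pos := fun z hz => (hbox hz).2 }
  have hPU : P y₀ ∈ U := Metric.mem_ball_self hr
  have hℓI : ℓ y₀ ∈ I := Metric.mem_ball_self hr
  have hsb : ∀ b ∈ U, (b, ℓ y₀) ∈ T := fun b hb => (hbox (mk_mem_prod hb hℓI)).1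
  have hbo : IsOpen (U ×ˢ I) := Metric.isOpen_ball.prod Metric.isOpen_ball
  refine ⟨U, fun b => S (b, ℓ y₀), e.source ∩ e ⁻¹' (U ×ˢ I), Metric.isOpen_ball, hPU, ?_, ?_,
    fun b hb => ⟨hSΩ _ (hsb b hb), ?_⟩, e.isOpen_inter_preimage hbo, ⟨he0, ?_⟩,
    fun y hy => heΩ hy.1, fun y hy hyP X Y => ?_⟩
  · exact hes.comp (contDiff_id.prodMk contDiff_const).contDiffOn hsb
  · dsimp only
    rw [← hee, hSe _ he0]
  · have h1 := e.right_inv (hsb b hb)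
    rw [hee] at h1
    exact congrArg Prod.fst h1
  · rw [mem_preimage, hee]
    exact ⟨hPU, hℓI⟩
  · have h2 : ℓ y ∈ I := by
      have h3 := hy.2
      rw [mem_preimage, hee] at h3
      exact h3.2
    have hey : e y = (P y₀, ℓ y) := by rw [hee, hyP]
    obtain ⟨v₀, w₀, hvw, hv₀⟩ := hex y₀ hy₀
    have h0 := (hrel _ hz₀ (fderiv ℝ P y₀ v₀) (fderiv ℝ P y₀ w₀)).2
      (by rw [hSe _ he0]; exact ⟨v₀, w₀, hvw, rfl, rfl⟩)
    have hX0 : fderiv ℝ P y₀ v₀ ≠ 0 := fun h => by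
      obtain ⟨r, hr⟩ := (hker _ hy₀ _).1 h
      exact hv₀ r hr
    rw [hee] at h0
    have h1 := hTr.baseRel_iff hPU h2 hℓI (fun t ht X Y hXY => by
      have hz : (P y₀, t) ∈ T := (hbox (mk_mem_prod hPU ht)).1
      rw [hga, hga]
      exact hunit _ (hSΩ _ hz) _ _ (hrel' _ hz _ _ hXY)) h0 hX0 X Y
    rw [← hey, ← hee, hrel _ (e.map_source hy.1), hrel _ hz₀, hSe _ hy.1, hSe _ he0] at h1
    exact h1

end FlatDescent

/-! ### Sections of a leaf space and constancy of the twist endomorphism along the leaves. -/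

section LeafDescent

variable {m : ℕ} {M : Type*} [TopologicalSpace M] [ChartedSpace (Euc (2 * m + 2)) M]
  [IsManifold 𝓘(ℝ, Euc (2 * m + 2)) ∞ M] {c : ConformalStructure (2 * m + 2) M}
  {K : ∀ x : M, Submodule ℝ (Tan (2 * m + 2) x)}
  {B : Type*} [TopologicalSpace B] [ChartedSpace (Euc (2 * m + 1)) B]
  [IsManifold 𝓘(ℝ, Euc (2 * m + 1)) ∞ B] {U : Set M} {π : M → B}

/-- `Y` is the image of `X` under the map that the twist endomorphism at `x` induces on the leaf
space. -/
def leafRel (c : ConformalStructure (2 * m + 2) M) (K : ∀ x : M, Submodule ℝ (Tan (2 * m + 2) x))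
    (g : LorentzMetric (2 * m + 2) M) (k : ∀ x : M, Tan (2 * m + 2) x) (π : M → B) (x : M)
    (X Y : Euc (2 * m + 1)) : Prop :=
  ∃ v w, IsTwistRep c K g k x v w ∧ leafDeriv (m := m) π x v = X ∧ leafDeriv (m := m) π x w = Y

/-- The data of an optical vector field with isometric twist endomorphism near a leaf space. -/
structure IsUnitLeafSpace (c : ConformalStructure (2 * m + 2) M)
    (K : ∀ x : M, Submodule ℝ (Tan (2 * m + 2) x)) (U : Set M) (π : M → B)
    (g : LorentzMetric (2 * m + 2) M) (k : ∀ x : M, Tan (2 * m + 2) x) : Prop where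
  twisting : IsTwistingOptical c K
  leaf : IsLeafSpace (m := m) K U π
  metric : g ∈ c.metrics
  field : IsOpticalField K k U
  isometry : ∀ x ∈ U, ∀ v ∈ perp c K x,
    g.val x (twistMap g k x v) (twistMap g k x v) = g.val x v v

namespace IsUnitLeafSpace

variable {g : LorentzMetric (2 * m + 2) M} {k : ∀ x : M, Tan (2 * m + 2) x}
  (h : IsUnitLeafSpace (B := B) c K U π g k)
include h

omit [IsManifold 𝓘(ℝ, Euc (2 * m + 1)) ∞ B] in
theorem isometry_rep {x : M} (hx : x ∈ U) {v w : Tan (2 * m + 2) x}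
    (hvw : IsTwistRep c K g k x v w) : g.val x w w = g.val x v v := by
  have h1 := h.twisting.isTwistRep_twistMap h.metric h.leaf.isOpen h.field hx hvw.1
  have h2 := h.twisting.optical.sub_mem_of_forall h.metric hvw.2.1 h1.2.1 fun u hu => by
    rw [hvw.2.2 u hu, h1.2.2 u hu]
  rw [metric_congr h.metric h2 hvw.2.1, g.symm, metric_congr h.metric h2 h1.2.1,
    h.isometry x hx v hvw.1]

/-- Local sections of a leaf space, and local constancy of the induced endomorphism along the
leaves. -/
theorem exists_section {x₀ : M} (hx₀ : x₀ ∈ U) :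
    ∃ (N : Set B) (s : B → M), IsOpen N ∧ π x₀ ∈ N ∧
      ContMDiffOn 𝓘(ℝ, Euc (2 * m + 1)) 𝓘(ℝ, Euc (2 * m + 2)) ∞ s N ∧ s (π x₀) = x₀ ∧
      (∀ p ∈ N, s p ∈ U ∧ π (s p) = p) ∧
      ∃ O : Set M, IsOpen O ∧ x₀ ∈ O ∧ ∀ x ∈ O, π x = π x₀ → ∀ X Y,
        (leafRel c K g k π x X Y ↔ leafRel c K g k π x₀ X Y) := by
  set p₀ := π x₀ with hp₀
  set U' := U ∩ π ⁻¹' (chrt (d := 2 * m + 1) p₀).source with hU'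
  have hU'o : IsOpen U' := h.leaf.smooth.continuousOn.isOpen_inter_preimage h.leaf.isOpen
    (isOpen_extChartAt_source p₀)
  have hx₀' : x₀ ∈ U' := ⟨hx₀, mem_extChartAt_source p₀⟩
  have hk' : IsOpticalField K k U' :=
    ⟨h.field.1.mono inter_subset_left, fun x hx => h.field.2 x hx.1⟩
  set Ω := chartDom (d := 2 * m + 2) x₀ U' with hΩ
  have hΩo : IsOpen Ω := isOpen_chartDom x₀ hU'o
  set G := tensorInChart g.val x₀ with hG
  set k' := vfInChart k x₀ with hkd
  set P : Euc (2 * m + 2) → Euc (2 * m + 1) := chartRep π x₀ p₀ with hP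
  have hGΩ : IsFlatMetric G Ω := (g.isFlatMetric x₀).mono hΩo inter_subset_left
  have hkΩ : IsShearFreeNull G Ω k' := h.twisting.isShearFreeNull h.metric hU'o hk' x₀
  have hπ : ∀ y ∈ Ω, ContMDiffAt 𝓘(ℝ, Euc (2 * m + 2)) 𝓘(ℝ, Euc (2 * m + 1)) ∞ π
      ((chrt (d := 2 * m + 2) x₀).symm y) := fun y hy =>
    h.leaf.smooth.contMDiffAt (h.leaf.isOpen.mem_nhds hy.2.1)
  have hPc : ContDiffOn ℝ ∞ P Ω := fun y hy =>
    (contDiffAt_chartRep hy.1 (hπ y hy) hy.2.2).contDiffWithinAt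
  have hD : ∀ y ∈ Ω, ∀ u : Euc (2 * m + 2),
      (leafDeriv (m := m) π ((chrt (d := 2 * m + 2) x₀).symm y) (chartInvDeriv x₀ y u) :
        Euc (2 * m + 1)) = chartInvDeriv p₀ (P y) (fderiv ℝ P y u) := fun y hy u =>
    diffAt_chartInvDeriv hy.1 (hπ y hy) hy.2.2 u
  have hPt : ∀ y ∈ Ω, P y ∈ (chrt (d := 2 * m + 1) p₀).target := fun y hy =>
    (chrt p₀).map_source hy.2.2
  have hDi : ∀ y ∈ Ω, ∀ a b : Euc (2 * m + 1),
      (chartInvDeriv p₀ (P y) a : Euc (2 * m + 1)) = chartInvDeriv p₀ (P y) b → a = b := by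
    intro y hy a b hab
    rw [← sub_eq_zero, ← chartInvDeriv_eq_zero (hPt y hy), map_sub]
    exact sub_eq_zero.2 hab
  have hkx : ∀ y ∈ Ω, chartInvDeriv x₀ y (k' y) = k ((chrt (d := 2 * m + 2) x₀).symm y) :=
    fun y hy => chartInvDeriv_vfInChart k hy.1
  have hsmul : ∀ y ∈ Ω, ∀ v : Euc (2 * m + 2),
      chartInvDeriv x₀ y v ∈ K ((chrt (d := 2 * m + 2) x₀).symm y) ↔ ∃ r : ℝ, v = r • k' y := by
    intro y hy v
    rw [h.twisting.optical.mem_iff_smul (hk'.2 _ hy.2).1 (hk'.2 _ hy.2).2]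
    refine exists_congr fun r => ?_
    rw [← hkx y hy, ← map_smul, ← sub_eq_zero, ← map_sub, chartInvDeriv_eq_zero hy.1, sub_eq_zero]
  have hperp : ∀ y ∈ Ω, ∀ v : Euc (2 * m + 2), G y (k' y) v = 0 ↔
      chartInvDeriv x₀ y v ∈ perp c K ((chrt (d := 2 * m + 2) x₀).symm y) := by
    intro y hy v
    rw [hG, tensorInChart_apply, hkx y hy,
      h.twisting.optical.mem_perp_iff h.metric (hk'.2 _ hy.2).1 (hk'.2 _ hy.2).2]
  have hrep : ∀ y ∈ Ω, ∀ v w : Euc (2 * m + 2), flatRep G k' y v w ↔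
      IsTwistRep c K g k ((chrt (d := 2 * m + 2) x₀).symm y) (chartInvDeriv x₀ y v)
        (chartInvDeriv x₀ y w) := by
    intro y hy v w
    have h1 : ∀ u, twist g k ((chrt (d := 2 * m + 2) x₀).symm y) (chartInvDeriv x₀ y v)
        (chartInvDeriv x₀ y u) = 1 / 2 * extDerFlat (fun z => G z (k' z)) y v u := by
      intro u
      rw [twist_chart g hU'o hk'.1 hy]
      congr 1
      refine extDerFlat_congr ?_ _ _
      filter_upwards [hΩo.mem_nhds hy] with z hz using formInChart_lowerVF g k hz.1
    unfold flatRep IsTwistRep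
    rw [hperp y hy, hperp y hy]
    refine and_congr_right fun _ => and_congr_right fun _ => ⟨fun h2 u hu => ?_, fun h2 u hu => ?_⟩
    · obtain ⟨u, rfl⟩ := surjective_chartInvDeriv hy.1 u
      rw [h1]
      exact h2 u ((hperp y hy u).2 hu)
    · rw [← h1]
      exact h2 _ ((hperp y hy u).1 hu)
  -- Only points over `p₀` are compared: there the chart at `p₀` identifies the tangent space with
  -- the model space by the identity.
  have hrel : ∀ y ∈ Ω, P y = coord p₀ → ∀ X Y,
      leafRel c K g k π ((chrt (d := 2 * m + 2) x₀).symm y) X Y ↔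
        ∃ v w, flatRep G k' y v w ∧ fderiv ℝ P y v = X ∧ fderiv ℝ P y w = Y := by
    intro y hy hPy X Y
    have hD' : ∀ u : Euc (2 * m + 2), (leafDeriv (m := m) π ((chrt (d := 2 * m + 2) x₀).symm y)
        (chartInvDeriv x₀ y u) : Euc (2 * m + 1)) = fderiv ℝ P y u := by
      intro u
      have h1 := hD y hy u
      rw [hPy] at h1
      exact h1.trans (chartInvDeriv_coord p₀ _)
    constructor
    · rintro ⟨v, w, hvw, hX, hY⟩
      obtain ⟨v, rfl⟩ := surjective_chartInvDeriv hy.1 v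
      obtain ⟨w, rfl⟩ := surjective_chartInvDeriv hy.1 w
      exact ⟨v, w, (hrep y hy v w).2 hvw, (hD' v).symm.trans hX, (hD' w).symm.trans hY⟩
    · rintro ⟨v, w, hvw, hX, hY⟩
      exact ⟨_, _, (hrep y hy v w).1 hvw, (hD' v).trans hX, (hD' w).trans hY⟩
  have hy₀ : coord x₀ ∈ Ω := coord_mem_chartDom hx₀'
  have hPy₀ : P (coord x₀) = coord p₀ := by
    rw [hP, chartRep, symm_coord]
    rfl
  obtain ⟨N, s, O, hN, hPN, hs, hs₀, hsN, hO, hy₀O, hOΩ, hloc⟩ := hkΩ.exists_section hGΩ hPc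
    (fun y hy v => by
      rw [← hsmul y hy, ← h.leaf.ker_deriv _ hy.2.1, ← chartInvDeriv_eq_zero (hPt y hy)]
      exact ⟨fun h1 => (hD y hy v).trans h1, fun h1 => (hD y hy v).symm.trans h1⟩)
    (fun y hy w => by
      obtain ⟨v, hv⟩ := h.leaf.surjective_deriv _ hy.2.1
        (chartInvDeriv p₀ (P y) w : Euc (2 * m + 1))
      obtain ⟨v, rfl⟩ := surjective_chartInvDeriv hy.1 v
      exact ⟨v, hDi y hy _ _ ((hD y hy v).symm.trans hv)⟩)
    (fun y hy v hv => by
      by_cases h1 : chartInvDeriv x₀ y v ∈ K ((chrt (d := 2 * m + 2) x₀).symm y)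
      · exact Or.inr ((hsmul y hy v).1 h1)
      · exact Or.inl (h.twisting.optical.pos_of_not_mem h.metric ((hperp y hy v).1 hv) h1))
    (fun y hy v w hvw => h.isometry_rep hy.2.1 ((hrep y hy v w).1 hvw))
    (fun y hy => by
      obtain ⟨v, hv, hvK, -⟩ := h.twisting.exists_not_mem h.metric hU'o hk' hy.2
      have hr := h.twisting.isTwistRep_twistMap h.metric hU'o hk' hy.2 hv
      obtain ⟨v', rfl⟩ := surjective_chartInvDeriv hy.1 v
      obtain ⟨w', hw'⟩ := surjective_chartInvDeriv hy.1
        (twistMap g k ((chrt (d := 2 * m + 2) x₀).symm y) (chartInvDeriv x₀ y v'))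
      rw [← hw'] at hr
      exact ⟨v', w', (hrep y hy _ _).2 hr, fun r hr' => hvK ((hsmul y hy _).2 ⟨r, hr'⟩)⟩)
    hy₀
  refine ⟨(chrt (d := 2 * m + 1) p₀).source ∩ chrt (d := 2 * m + 1) p₀ ⁻¹' N,
    fun p => (chrt (d := 2 * m + 2) x₀).symm (s (chrt (d := 2 * m + 1) p₀ p)),
    isOpen_extChartAt_preimage' p₀ hN, ⟨mem_extChartAt_source p₀, ?_⟩, fun p hp => ?_, ?_,
    fun p hp => ⟨(hsN _ hp.2).1.2.1, ?_⟩,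
    (chrt (d := 2 * m + 2) x₀).source ∩ chrt (d := 2 * m + 2) x₀ ⁻¹' O,
    isOpen_extChartAt_preimage' x₀ hO, ⟨mem_extChartAt_source x₀, hy₀O⟩, fun x hx hxp X Y => ?_⟩
  · rw [hPy₀] at hPN
    exact hPN
  · have h1 : ContMDiffAt 𝓘(ℝ, Euc (2 * m + 1)) 𝓘(ℝ, Euc (2 * m + 2)) ∞ s
        (chrt (d := 2 * m + 1) p₀ p) :=
      contMDiffAt_iff_contDiffAt.2 (hs.contDiffAt (hN.mem_nhds hp.2))
    exact ((contMDiffAt_chrt_symm (hsN _ hp.2).1.1).comp p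
      (h1.comp p (contMDiffAt_chrt hp.1))).contMDiffWithinAt
  · have h1 : (chrt (d := 2 * m + 1) p₀) p₀ = P (coord x₀) := hPy₀.symm
    dsimp only
    rw [h1, hs₀, symm_coord]
  · have h1 := (hsN _ hp.2).2
    exact (chrt p₀).injOn (hsN _ hp.2).1.2.2 hp.1 h1
  · have hxs : (chrt (d := 2 * m + 2) x₀).symm (chrt (d := 2 * m + 2) x₀ x) = x :=
      (chrt x₀).left_inv hx.1
    have hPx : P (chrt (d := 2 * m + 2) x₀ x) = coord p₀ := by
      rw [hP, chartRep, hxs, hxp]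
      rfl
    have h1 := hrel _ (hOΩ hx.2) hPx X Y
    have h2 := hrel _ hy₀ hPy₀ X Y
    rw [hxs] at h1
    rw [symm_coord] at h2
    rw [h1, h2]
    exact hloc _ hx.2 (hPx.trans hPy₀.symm) X Y

/-- The induced endomorphism is the same at all points of a leaf. -/
theorem leafRel_iff {x x' : M} (hx : x ∈ U) (hx' : x' ∈ U) (hxx : π x = π x')
    (X Y : Euc (2 * m + 1)) : leafRel c K g k π x X Y ↔ leafRel c K g k π x' X Y := by
  have hc : IsPreconnected (U ∩ π ⁻¹' {π x'}) := (h.leaf.fibres (π x')).isPreconnected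
  -- Local constancy propagates along the fibre because it is connected.
  refine hc.induction₂' (fun a b => leafRel c K g k π a X Y ↔ leafRel c K g k π b X Y) ?_
    (fun a b d _ _ _ h1 h2 => h1.trans h2) ⟨hx, hxx⟩ ⟨hx', rfl⟩
  rintro a ⟨ha, hap⟩
  obtain ⟨-, -, -, -, -, -, -, O, hO, haO, hloc⟩ := h.exists_section ha
  filter_upwards [inter_mem_nhdsWithin _ (hO.mem_nhds haO)] with b hb
  have h1 := hloc b hb.2 (hb.1.2.trans hap.symm) X Y
  exact ⟨h1.symm, h1⟩

end IsUnitLeafSpace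

end LeafDescent

/-! ### Lie brackets against the exterior derivative. -/

section Bracket

variable {d : ℕ} {M : Type*} [TopologicalSpace M] [ChartedSpace (Euc d) M]

theorem vf_congr (X : ∀ x : M, Tan d x) {x y : M} (h : x = y) : (X x : Euc d) = X y := by
  subst h; rfl

variable [IsManifold 𝓘(ℝ, Euc d) ∞ M]

theorem mlieBracket_eq_lieBracket (X Y : ∀ x : M, Tan d x) (x : M) :
    (VectorField.mlieBracket 𝓘(ℝ, Euc d) X Y x : Euc d) =
      VectorField.lieBracket ℝ (vfInChart X x) (vfInChart Y x) (coord x) := by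
  have h1 : ∀ Z : ∀ x : M, Tan d x, VectorField.mpullbackWithin 𝓘(ℝ, Euc d) 𝓘(ℝ, Euc d)
      (extChartAt 𝓘(ℝ, Euc d) x).symm Z (range 𝓘(ℝ, Euc d)) = fun y => vfInChart Z x y := by
    intro Z
    funext y
    rw [VectorField.mpullbackWithin, ModelWithCorners.range_eq_univ, mfderivWithin_univ]
    rfl
  rw [VectorField.mlieBracket, VectorField.mlieBracketWithin, h1, h1, preimage_univ, univ_inter,
    ModelWithCorners.range_eq_univ, VectorField.lieBracketWithin_univ]
  have h2 := mfderiv_chrt_inverse (mem_extChartAt_target (I := 𝓘(ℝ, Euc d)) x)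
    (VectorField.lieBracket ℝ (vfInChart X x) (vfInChart Y x) (coord x))
  have h3 := chartInvDeriv_coord x
    (VectorField.lieBracket ℝ (vfInChart X x) (vfInChart Y x) (coord x))
  have h4 : (chrt (d := d) x).symm (chrt (d := d) x x) = x := symm_coord x
  rw [h4] at h2
  exact h2.trans h3

/-- `θ([X, Y]) = -dθ(X, Y)` for sections `X`, `Y` of the kernel of `θ`. -/
theorem form_mlieBracket {θ : ∀ x : M, Tan d x →L[ℝ] ℝ} {V : Set M} (hV : IsOpen V)
    (hθ : SmoothOneForm θ V) {X Y : ∀ x : M, Tan d x} (hX : SmoothVF X V) (hY : SmoothVF Y V)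
    (hX0 : ∀ x ∈ V, θ x (X x) = 0) (hY0 : ∀ x ∈ V, θ x (Y x) = 0) {x : M} (hx : x ∈ V) :
    θ x (VectorField.mlieBracket 𝓘(ℝ, Euc d) X Y x) = -extDer θ x (X x) (Y x) := by
  have hnb := (isOpen_chartDom (d := d) x hV).mem_nhds (coord_mem_chartDom hx)
  have hd : DifferentiableAt ℝ (formInChart θ x) (coord x) :=
    ((contDiffOn_formInChart hV hθ x).contDiffAt hnb).differentiableAt (by simp)
  -- Differentiating `θ(Z) = 0` replaces `θ(DZ u)` by `-(Dθ u)(Z)`, which turns `θ` of the bracket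
  -- into `-dθ`.
  have hZ : ∀ Z : ∀ x : M, Tan d x, SmoothVF Z V → (∀ x ∈ V, θ x (Z x) = 0) → ∀ u : Euc d,
      formInChart θ x (coord x) (fderiv ℝ (vfInChart Z x) (coord x) u) =
        -fderiv ℝ (formInChart θ x) (coord x) u (Z x) := by
    intro Z hZ hZ0 u
    have h1 : DifferentiableAt ℝ (vfInChart Z x) (coord x) :=
      ((contDiffOn_vfInChart hV hZ x).contDiffAt hnb).differentiableAt (by simp)
    have h2 : (fun y => formInChart θ x y (vfInChart Z x y)) =ᶠ[𝓝 (coord x)] fun _ => 0 := by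
      filter_upwards [hnb] with y hy
      rw [formInChart_apply, chartInvDeriv_vfInChart Z hy.1]
      exact hZ0 _ hy.2
    have h3 := (hd.hasFDerivAt.clm_apply h1.hasFDerivAt).unique
      ((hasFDerivAt_const (0 : ℝ) (coord x)).congr_of_eventuallyEq h2)
    have h4 := congrArg (fun A : Euc d →L[ℝ] ℝ => A u) h3
    simp only [add_apply, ContinuousLinearMap.comp_apply, ContinuousLinearMap.flip_apply,
      zero_apply] at h4
    rw [vfInChart_coord] at h4
    exact eq_neg_of_add_eq_zero_left h4
  have h5 : ∀ w : Euc d, formInChart θ x (coord x) w = θ x w := fun w =>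
    (congrArg (fun v : Euc d => θ ((chrt (d := d) x).symm (coord x)) v)
      (chartInvDeriv_coord x w)).trans (form_congr θ (symm_coord x) w)
  have h6 : θ x (VectorField.mlieBracket 𝓘(ℝ, Euc d) X Y x) =
      formInChart θ x (coord x)
        (VectorField.lieBracket ℝ (vfInChart X x) (vfInChart Y x) (coord x)) :=
    (congrArg (fun w : Euc d => θ x w) (mlieBracket_eq_lieBracket X Y x)).trans (h5 _).symm
  rw [h6, VectorField.lieBracket_eq]
  dsimp only
  rw [map_sub, vfInChart_coord, vfInChart_coord]
  have h7 := hZ X hX hX0 (Y x)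
  have h8 := hZ Y hY hY0 (X x)
  refine (congrArg₂ (fun a b : ℝ => a - b) h8 h7).trans ?_
  rw [extDer]
  ring

end Bracket

/-! ### Pullback of forms, and transport of vector fields through sections. -/

section Pullback

variable {d e : ℕ} {M : Type*} [TopologicalSpace M] [ChartedSpace (Euc d) M]
  {N : Type*} [TopologicalSpace N] [ChartedSpace (Euc e) N]
  [IsManifold 𝓘(ℝ, Euc d) ∞ M] [IsManifold 𝓘(ℝ, Euc e) ∞ N]

theorem smoothOneForm_pullFormM {f : M → N} {α : ∀ p : N, Tan e p →L[ℝ] ℝ} {V : Set M} {V' : Set N}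
    (hV : IsOpen V) (hV' : IsOpen V') (hf : ContMDiffOn 𝓘(ℝ, Euc d) 𝓘(ℝ, Euc e) ∞ f V)
    (hfV : ∀ x ∈ V, f x ∈ V') (hα : SmoothOneForm α V') :
    SmoothOneForm (pullFormM (d := d) f α) V := by
  refine smoothOneForm_of_chart fun x hx => ?_
  have hxt : coord x ∈ (chrt (d := d) x).target := mem_extChartAt_target x
  have hs : f ((chrt (d := d) x).symm (coord x)) ∈ (chrt (d := e) (f x)).source := by
    rw [symm_coord]; exact mem_extChartAt_source (f x)
  have h1 := eventually_formInChart_pullFormM (p₀ := f x) α hV (coord_mem_chartDom hx) hf hs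
  have hfc : ContMDiffAt 𝓘(ℝ, Euc d) 𝓘(ℝ, Euc e) ∞ f ((chrt (d := d) x).symm (coord x)) := by
    rw [symm_coord]; exact hf.contMDiffAt (hV.mem_nhds hx)
  have h2 := contDiffAt_chartRep hxt hfc hs
  have h3 : chartRep f x (f x) (coord (d := d) x) = coord (d := e) (f x) := by
    rw [chartRep, symm_coord]; rfl
  have h4 : ContDiffAt ℝ ∞ (formInChart α (f x)) (coord (f x)) :=
    (contDiffOn_formInChart hV' hα (f x)).contDiffAt
      ((isOpen_chartDom (f x) hV').mem_nhds (coord_mem_chartDom (hfV x hx)))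
  rw [← h3] at h4
  exact ((h4.comp (coord x) h2).clm_comp (h2.fderiv_right (by simp))).congr_of_eventuallyEq h1

omit [IsManifold 𝓘(ℝ, Euc d) ∞ M] [IsManifold 𝓘(ℝ, Euc e) ∞ N] in
theorem diffAt_comp_of_leftInverse {f : M → N} {s : N → M} {V : Set N} (hV : IsOpen V) {p : N}
    (hp : p ∈ V) (hs : ContMDiffAt 𝓘(ℝ, Euc e) 𝓘(ℝ, Euc d) ∞ s p)
    (hf : ContMDiffAt 𝓘(ℝ, Euc d) 𝓘(ℝ, Euc e) ∞ f (s p)) (hfs : ∀ q ∈ V, f (s q) = q)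
    (u : Tan e p) : (diffAt (d := d) (e := e) f (s p) (diffAt s p u) : Euc e) = u := by
  have h1 := (hf.mdifferentiableAt (by simp)).hasMFDerivAt.comp p
    (hs.mdifferentiableAt (by simp)).hasMFDerivAt
  have h2 : (f ∘ s) =ᶠ[𝓝 p] id := by
    filter_upwards [hV.mem_nhds hp] with q hq using hfs q hq
  have h3 := hasMFDerivAt_unique h1 ((hasMFDerivAt_id p).congr_of_eventuallyEq h2)
  exact congrArg (fun A : Euc e →L[ℝ] Euc e => A u) h3

/-- The image of a smooth vector field along a section of `f` under the differential of `f`. -/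
theorem smoothVF_push {f : M → N} {s : N → M} {U W : Set M} {V : Set N} (hU : IsOpen U)
    (hf : ContMDiffOn 𝓘(ℝ, Euc d) 𝓘(ℝ, Euc e) ∞ f U)
    (hs : ContMDiffOn 𝓘(ℝ, Euc e) 𝓘(ℝ, Euc d) ∞ s V) (hsU : ∀ p ∈ V, s p ∈ U)
    (hsW : ∀ p ∈ V, s p ∈ W) (hfs : ∀ p ∈ V, f (s p) = p) {Z : ∀ x : M, Tan d x}
    (hZ : SmoothVF Z W) {Y : ∀ p : N, Tan e p}
    (hY : ∀ p ∈ V, (Y p : Euc e) = diffAt f (s p) (Z (s p))) : SmoothVF Y V := by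
  have h1 := hf.contMDiffOn_tangentMapWithin (m := ∞) (by simp) hU.uniqueMDiffOn
  have h2 : ContMDiffOn 𝓘(ℝ, Euc e) 𝓘(ℝ, Euc d).tangent ∞
      (fun p => (⟨s p, Z (s p)⟩ : TangentBundle 𝓘(ℝ, Euc d) M)) V := hZ.comp hs hsW
  refine (h1.comp h2 hsU).congr fun p hp => ?_
  have h3 : mfderivWithin 𝓘(ℝ, Euc d) 𝓘(ℝ, Euc e) f U (s p) =
      mfderiv 𝓘(ℝ, Euc d) 𝓘(ℝ, Euc e) f (s p) :=
    mfderivWithin_of_isOpen hU (hsU p hp)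
  have h4 : ∀ (q : N) (v : Tan e q) (w : Tan e p), q = p → (v : Euc e) = w →
      (⟨p, w⟩ : TangentBundle 𝓘(ℝ, Euc e) N) = ⟨q, v⟩ := by
    intro q v w hq hv
    subst hq
    exact congrArg (Bundle.TotalSpace.mk _) hv.symm
  refine h4 (f (s p)) _ (Y p) (hfs p hp) ?_
  refine Eq.trans ?_ (hY p hp).symm
  exact congrArg (fun A : Euc d →L[ℝ] Euc e => A (Z (s p))) h3

/-- Extension of the image of a vector field under the differential of a section `s` of `f`. -/
theorem exists_lift {f : M → N} {s : N → M} {U : Set M} {V : Set N} (hU : IsOpen U) (hV : IsOpen V)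
    (hf : ContMDiffOn 𝓘(ℝ, Euc d) 𝓘(ℝ, Euc e) ∞ f U)
    (hs : ContMDiffOn 𝓘(ℝ, Euc e) 𝓘(ℝ, Euc d) ∞ s V) (hsU : ∀ p ∈ V, s p ∈ U)
    (hfs : ∀ p ∈ V, f (s p) = p) {X : ∀ p : N, Tan e p} (hX : SmoothVF X V) {p₀ : N}
    (hp₀ : p₀ ∈ V) : ∃ (W : Set M) (Z : ∀ x : M, Tan d x) (V' : Set N), IsOpen W ∧ W ⊆ U ∧
      SmoothVF Z W ∧ IsOpen V' ∧ p₀ ∈ V' ∧ V' ⊆ V ∧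
      ∀ p ∈ V', s p ∈ W ∧ Z (s p) = diffAt s p (X p) := by
  set x₀ := s p₀ with hx₀
  set V' := V ∩ s ⁻¹' (chrt (d := d) x₀).source ∩ (chrt (d := e) p₀).source with hV'
  have hV'o : IsOpen V' := (hs.continuousOn.isOpen_inter_preimage hV
    (isOpen_extChartAt_source x₀)).inter (isOpen_extChartAt_source p₀)
  set W := (U ∩ f ⁻¹' V') ∩ (chrt (d := d) x₀).source with hW
  have hWo : IsOpen W := (hf.continuousOn.isOpen_inter_preimage hU hV'o).inter
    (isOpen_extChartAt_source x₀)
  set σ : Euc e → Euc d := chartRep s p₀ x₀ with hσ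
  set P : Euc d → Euc e := chartRep f x₀ p₀ with hP
  have hPV : ∀ y ∈ chartDom (d := d) x₀ W, P y ∈ chartDom (d := e) p₀ V' := fun y hy =>
    chrt_mem_chartDom hy.2.1.2.2 hy.2.1.2
  have hPc : ContDiffOn ℝ ∞ P (chartDom x₀ W) := fun y hy =>
    (contDiffAt_chartRep hy.1 (hf.contMDiffAt (hU.mem_nhds hy.2.1.1))
      hy.2.1.2.2).contDiffWithinAt
  have hσs : ∀ z ∈ chartDom (d := e) p₀ V', ContMDiffAt 𝓘(ℝ, Euc e) 𝓘(ℝ, Euc d) ∞ s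
      ((chrt (d := e) p₀).symm z) := fun z hz => hs.contMDiffAt (hV.mem_nhds hz.2.1.1)
  have hσc : ContDiffOn ℝ ∞ σ (chartDom p₀ V') := fun z hz =>
    (contDiffAt_chartRep hz.1 (hσs z hz) hz.2.1.2).contDiffWithinAt
  have hXc : ContDiffOn ℝ ∞ (vfInChart X p₀) (chartDom p₀ V') :=
    contDiffOn_vfInChart hV'o (hX.mono fun p hp => hp.1.1) p₀
  have hc : ContDiffOn ℝ ∞ (fun z => fderiv ℝ σ z (vfInChart X p₀ z)) (chartDom p₀ V') :=
    (hσc.fderiv_of_isOpen (isOpen_chartDom p₀ hV'o) (by simp)).clm_apply hXc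
  -- The field `ds(X)` is only defined on the image of `s`. It is extended by `y ↦ dσ(X(P y))`,
  -- constant along the fibres of `P`; on the image of `s` this is correct because `P ∘ σ` is the
  -- identity.
  refine ⟨W, chartVF x₀ fun y => fderiv ℝ σ (P y) (vfInChart X p₀ (P y)), V', hWo,
    fun x hx => hx.1.1, smoothVF_chartVF hWo (fun x hx => hx.2) (hc.comp hPc hPV), hV'o,
    ⟨⟨hp₀, mem_extChartAt_source x₀⟩, mem_extChartAt_source p₀⟩, fun p hp => hp.1.1,
    fun p hp => ⟨⟨⟨hsU p hp.1.1, ?_⟩, hp.1.2⟩, ?_⟩⟩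
  · rw [mem_preimage, hfs p hp.1.1]
    exact hp
  · set z := chrt (d := e) p₀ p with hz
    have hzd : z ∈ chartDom (d := e) p₀ V' := chrt_mem_chartDom hp.2 hp
    have hzp : (chrt (d := e) p₀).symm z = p := (chrt p₀).left_inv hp.2
    have hσz : σ z = chrt (d := d) x₀ (s p) := by rw [hσ, chartRep, hzp]
    have hyp : (chrt (d := d) x₀).symm (σ z) = s p := by
      rw [hσz]
      exact (chrt x₀).left_inv hp.1.2
    have hyt : σ z ∈ (chrt (d := d) x₀).target := by
      rw [hσz]
      exact (chrt x₀).map_source hp.1.2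
    have hPz : P (σ z) = z := by rw [hP, chartRep, hyp, hfs p hp.1.1]
    have h1 := chartVF_symm hyt fun y => fderiv ℝ σ (P y) (vfInChart X p₀ (P y))
    rw [hPz] at h1
    have h2 := diffAt_chartInvDeriv hzd.1 (hσs z hzd) hzd.2.1.2 (vfInChart X p₀ z)
    rw [chartInvDeriv_vfInChart X hzd.1] at h2
    have h3 := (vf_congr (chartVF x₀ fun y => fderiv ℝ σ (P y) (vfInChart X p₀ (P y)))
      hyp).symm.trans (h1.trans h2.symm)
    have h4 : ∀ q, q = p → (diffAt (d := e) (e := d) s q (X q) : Euc d) = diffAt s p (X p) := by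
      intro q hq
      subst hq
      rfl
    exact h3.trans (h4 _ hzp)

end Pullback

/-! ### Smooth frames of the kernel of a 1-form. -/

section KernelFrame

variable {r : ℕ} {B : Type*} [TopologicalSpace B] [ChartedSpace (Euc (r + 1)) B]
  [IsManifold 𝓘(ℝ, Euc (r + 1)) ∞ B]

/-- The kernel of a non-vanishing smooth `1`-form has a smooth local frame. -/
theorem exists_kernel_frame {θ : ∀ p : B, Tan (r + 1) p →L[ℝ] ℝ} {V : Set B} (hV : IsOpen V)
    (hθ : SmoothOneForm θ V) {p₀ : B} (hp₀ : p₀ ∈ V) (h0 : ∃ n, θ p₀ n ≠ 0) :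
    ∃ W : Set B, IsOpen W ∧ p₀ ∈ W ∧ W ⊆ V ∧ ∃ X : Fin r → ∀ p : B, Tan (r + 1) p,
      (∀ i, SmoothVF (X i) W) ∧ ∀ p ∈ W, LinearIndependent ℝ (fun i => X i p) ∧
        ∀ v : Tan (r + 1) p, v ∈ Submodule.span ℝ (range fun i => X i p) ↔ θ p v = 0 := by
  set α := formInChart θ p₀ with hα
  have hαc : ContDiffOn ℝ ∞ α (chartDom p₀ V) := contDiffOn_formInChart hV hθ p₀
  have hz₀ : coord p₀ ∈ chartDom (d := r + 1) p₀ V := coord_mem_chartDom hp₀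
  obtain ⟨n, hn⟩ : ∃ n, α (coord p₀) n ≠ 0 := by
    obtain ⟨n, hn⟩ := h0
    refine ⟨n, fun h => hn ?_⟩
    have h1 : α (coord p₀) n = θ p₀ n :=
      (congrArg (fun v : Euc (r + 1) => θ ((chrt (d := r + 1) p₀).symm (coord p₀)) v)
        (chartInvDeriv_coord p₀ n)).trans (form_congr θ (symm_coord p₀) n)
    exact h1.symm.trans h
  have hrank : ∀ A : Euc (r + 1) →L[ℝ] ℝ, A n ≠ 0 →
      Module.finrank ℝ (LinearMap.ker A.toLinearMap) = r := by
    intro A hA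
    have h1 := A.toLinearMap.finrank_range_add_finrank_ker
    have h2 : LinearMap.range A.toLinearMap = ⊤ :=
      LinearMap.range_eq_top.2 (LinearMap.surjective (f := A.toLinearMap) (fun h => hA (by
        have h3 := congrArg (fun B : Euc (r + 1) →ₗ[ℝ] ℝ => B n) h
        exact h3)))
    rw [h2] at h1
    simp at h1
    omega
  let b := Module.finBasisOfFinrankEq ℝ _ (hrank _ hn)
  obtain ⟨Ω, hΩ, hΩα⟩ : ∃ Ω, Ω = chartDom (d := r + 1) p₀ V ∩ (fun z => α z n) ⁻¹' {0}ᶜ ∧ IsOpen Ω :=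
    ⟨_, rfl, (hαc.clm_apply contDiffOn_const).continuousOn.isOpen_inter_preimage
      (isOpen_chartDom p₀ hV) isOpen_compl_singleton⟩
  -- A basis of the kernel at `p₀` is projected to the neighbouring kernels along the transversal
  -- vector `n`.
  set X' : Fin r → Euc (r + 1) → Euc (r + 1) := fun i z =>
    (b i : Euc (r + 1)) - (α z (b i) / α z n) • n with hX'
  have hΩn : ∀ z ∈ Ω, α z n ≠ 0 := fun z hz => by
    rw [hΩ] at hz
    exact hz.2
  have hΩV : Ω ⊆ chartDom (d := r + 1) p₀ V := by
    rw [hΩ]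
    exact inter_subset_left
  have hX'c : ∀ i, ContDiffOn ℝ ∞ (X' i) Ω := fun i => by
    have h1 : ContDiffOn ℝ ∞ (fun z => α z (b i) / α z n) Ω :=
      ((hαc.mono hΩV).clm_apply contDiffOn_const).div
        ((hαc.mono hΩV).clm_apply contDiffOn_const) hΩn
    exact contDiffOn_const.sub (h1.smul contDiffOn_const)
  have hker : ∀ z ∈ Ω, ∀ i, α z (X' i z) = 0 := by
    intro z hz i
    rw [hX']
    dsimp only
    rw [map_sub, map_smul, smul_eq_mul, div_mul_cancel₀ _ (hΩn z hz), sub_self]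
  have hbker : ∀ i, α (coord p₀) (b i : Euc (r + 1)) = 0 := fun i => (b i).2
  have hli : ∀ z ∈ Ω, LinearIndependent ℝ fun i => X' i z := by
    intro z hz
    have hb : LinearIndependent ℝ fun i => (b i : Euc (r + 1)) :=
      b.linearIndependent.map' (Submodule.subtype _) (Submodule.ker_subtype _)
    rw [Fintype.linearIndependent_iff] at hb ⊢
    intro a ha i
    refine hb a ?_ i
    have h1 : ∑ i, a i • X' i z =
        (∑ i, a i • (b i : Euc (r + 1))) - (∑ i, a i * (α z (b i) / α z n)) • n := by
      rw [Finset.sum_smul, ← Finset.sum_sub_distrib]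
      refine Finset.sum_congr rfl fun i _ => ?_
      rw [hX', smul_sub, smul_smul]
    -- A linear relation puts `∑ a_i b_i` on the line of `n`, which meets the kernel at `p₀` only in
    -- zero.
    rw [h1, sub_eq_zero] at ha
    have h2 := congrArg (α (coord p₀)) ha
    rw [map_sum, map_smul] at h2
    have h3 : ∑ i, α (coord p₀) (a i • (b i : Euc (r + 1))) = 0 :=
      Finset.sum_eq_zero fun i _ => by rw [map_smul, hbker, smul_zero]
    rw [h3, smul_eq_mul] at h2
    rw [ha, (mul_eq_zero.1 h2.symm).resolve_right hn, zero_smul]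
  have hspan : ∀ z ∈ Ω, Submodule.span ℝ (range fun i => X' i z) =
      LinearMap.ker (α z).toLinearMap := by
    intro z hz
    refine Submodule.eq_of_le_of_finrank_eq (Submodule.span_le.2 ?_) ?_
    · rintro _ ⟨i, rfl⟩
      exact hker z hz i
    · rw [finrank_span_eq_card (hli z hz), hrank _ (hΩn z hz), Fintype.card_fin]
  set W := (chrt (d := r + 1) p₀).source ∩ chrt (d := r + 1) p₀ ⁻¹' Ω with hW
  have hWo : IsOpen W := isOpen_extChartAt_preimage' p₀ hΩα
  refine ⟨W, hWo, ⟨mem_extChartAt_source p₀, ?_⟩, fun p hp => ?_, fun i => chartVF p₀ (X' i),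
    fun i => ?_, fun p hp => ?_⟩
  · rw [mem_preimage, hΩ]
    exact ⟨hz₀, hn⟩
  · have h1 := (hΩV hp.2).2
    rwa [mem_preimage, (chrt p₀).left_inv hp.1] at h1
  · refine smoothVF_chartVF hWo inter_subset_left ((hX'c i).mono fun z hz => ?_)
    have h1 := hz.2.2
    rwa [mem_preimage, (chrt p₀).right_inv hz.1] at h1
  · obtain ⟨z, hz, rfl⟩ : ∃ z ∈ Ω, p = (chrt (d := r + 1) p₀).symm z :=
      ⟨_, hp.2, ((chrt p₀).left_inv hp.1).symm⟩
    have hzt := (hΩV hz).1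
    have hXz : (fun i => chartVF p₀ (X' i) ((chrt (d := r + 1) p₀).symm z)) =
        (chartInvDeriv p₀ z) ∘ fun i => X' i z := funext fun i => chartVF_symm hzt (X' i)
    have hinj : LinearMap.ker (chartInvDeriv p₀ z).toLinearMap = ⊥ :=
      LinearMap.ker_eq_bot'.2 fun u hu => (chartInvDeriv_eq_zero hzt).1 hu
    rw [hXz]
    refine ⟨(hli z hz).map' (chartInvDeriv p₀ z).toLinearMap hinj, fun v => ?_⟩
    obtain ⟨u, rfl⟩ := surjective_chartInvDeriv hzt v
    have h1 : Submodule.span ℝ (range ((chartInvDeriv p₀ z) ∘ fun i => X' i z)) =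
        (Submodule.span ℝ (range fun i => X' i z)).map (chartInvDeriv p₀ z).toLinearMap := by
      rw [Submodule.map_span, range_comp]
      rfl
    rw [h1, hspan z hz]
    constructor
    · rintro ⟨u', hu', hu⟩
      have h2 : chartInvDeriv p₀ z (u' - u) = 0 := by
        rw [map_sub]
        exact sub_eq_zero.2 hu
      rw [chartInvDeriv_eq_zero hzt, sub_eq_zero] at h2
      subst h2
      exact hu'
    · intro hu
      exact ⟨u, hu, rfl⟩

end KernelFrame

/-! ### Sign rules for `extDer`. -/

section ExtDer

variable {d : ℕ} {M : Type*} [TopologicalSpace M] [ChartedSpace (Euc d) M]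

theorem extDer_neg_left (α : ∀ x : M, Tan d x →L[ℝ] ℝ) (x : M) (u v : Tan d x) :
    extDer α x (-u) v = -extDer α x u v := by
  let D : Euc d →L[ℝ] Euc d →L[ℝ] ℝ := fderiv ℝ (formInChart α x) (coord x)
  have h : ∀ a b : Euc d, D (-a) b - D b (-a) = -(D a b - D b a) := fun a b => by
    rw [map_neg, map_neg, neg_apply]
    ring
  exact h u v

theorem extDer_neg_right (α : ∀ x : M, Tan d x →L[ℝ] ℝ) (x : M) (u v : Tan d x) :
    extDer α x u (-v) = -extDer α x u v := by
  let D : Euc d →L[ℝ] Euc d →L[ℝ] ℝ := fderiv ℝ (formInChart α x) (coord x)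
  have h : ∀ a b : Euc d, D a (-b) - D (-b) a = -(D a b - D b a) := fun a b => by
    rw [map_neg, map_neg, neg_apply]
    ring
  exact h u v

end ExtDer

/-! ### The contact almost CR structure of a leaf space. -/

section LeafCR

variable {m : ℕ} {M : Type*} [TopologicalSpace M] [ChartedSpace (Euc (2 * m + 2)) M]
  [IsManifold 𝓘(ℝ, Euc (2 * m + 2)) ∞ M] {c : ConformalStructure (2 * m + 2) M}
  {K : ∀ x : M, Submodule ℝ (Tan (2 * m + 2) x)}
  {B : Type*} [TopologicalSpace B] [ChartedSpace (Euc (2 * m + 1)) B]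
  [IsManifold 𝓘(ℝ, Euc (2 * m + 1)) ∞ B] {U : Set M} {π : M → B}

/-- The graph of the endomorphism that the twist induces on the leaf space. -/
def leafGraph (c : ConformalStructure (2 * m + 2) M)
    (K : ∀ x : M, Submodule ℝ (Tan (2 * m + 2) x)) (U : Set M)
    (g : LorentzMetric (2 * m + 2) M) (k : ∀ x : M, Tan (2 * m + 2) x) (π : M → B) (p : B)
    (X Y : Euc (2 * m + 1)) : Prop :=
  ∃ x ∈ U, π x = p ∧ leafRel c K g k π x X Y

namespace IsUnitLeafSpace

variable {g : LorentzMetric (2 * m + 2) M} {k : ∀ x : M, Tan (2 * m + 2) x}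
  (h : IsUnitLeafSpace (B := B) c K U π g k)
include h

omit [IsManifold 𝓘(ℝ, Euc (2 * m + 1)) ∞ B] in
theorem rep_iff {x : M} (hx : x ∈ U) {v w : Tan (2 * m + 2) x} :
    IsTwistRep c K g k x v w ↔ v ∈ perp c K x ∧ w - twistMap g k x v ∈ K x := by
  constructor
  · intro hvw
    have h1 := h.twisting.isTwistRep_twistMap h.metric h.leaf.isOpen h.field hx hvw.1
    exact ⟨hvw.1, h.twisting.optical.sub_mem_of_forall h.metric hvw.2.1 h1.2.1 fun u hu => by
      rw [hvw.2.2 u hu, h1.2.2 u hu]⟩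
  · rintro ⟨hv, hw⟩
    have h1 := h.twisting.isTwistRep_twistMap h.metric h.leaf.isOpen h.field hx hv
    refine ⟨hv, ?_, fun u hu => ?_⟩
    · have h2 := (perp c K x).add_mem (h.twisting.optical.le_perp x hw) h1.2.1
      rwa [sub_add_cancel] at h2
    · rw [metric_congr h.metric hw hu, h1.2.2 u hu]

omit [IsManifold 𝓘(ℝ, Euc (2 * m + 1)) ∞ B] in
theorem rep_congr {x : M} (hx : x ∈ U) {v w v' w' : Tan (2 * m + 2) x}
    (hvw : IsTwistRep c K g k x v w) (hv : v' - v ∈ K x) (hw : w' - w ∈ K x) :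
    IsTwistRep c K g k x v' w' := by
  rw [h.rep_iff hx] at hvw ⊢
  constructor
  · have h1 := (perp c K x).add_mem (h.twisting.optical.le_perp x hv) hvw.1
    rwa [sub_add_cancel] at h1
  · have h1 := h.twisting.twistMap_mem h.metric h.leaf.isOpen h.field hx hv
    have h2 := (K x).sub_mem ((K x).add_mem hw hvw.2) h1
    rw [map_sub] at h2
    convert h2 using 1
    abel

omit [IsManifold 𝓘(ℝ, Euc (2 * m + 1)) ∞ B] in
theorem rep_add {x : M} (hx : x ∈ U) {v w v' w' : Tan (2 * m + 2) x}
    (hvw : IsTwistRep c K g k x v w) (hvw' : IsTwistRep c K g k x v' w') :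
    IsTwistRep c K g k x (v + v') (w + w') := by
  rw [h.rep_iff hx] at hvw hvw' ⊢
  refine ⟨(perp c K x).add_mem hvw.1 hvw'.1, ?_⟩
  have h2 := (K x).add_mem hvw.2 hvw'.2
  rw [map_add]
  convert h2 using 1
  abel

omit [IsManifold 𝓘(ℝ, Euc (2 * m + 1)) ∞ B] in
theorem rep_smul {x : M} (hx : x ∈ U) {v w : Tan (2 * m + 2) x} (r : ℝ)
    (hvw : IsTwistRep c K g k x v w) : IsTwistRep c K g k x (r • v) (r • w) := by
  rw [h.rep_iff hx] at hvw ⊢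
  refine ⟨(perp c K x).smul_mem r hvw.1, ?_⟩
  rw [map_smul, ← smul_sub]
  exact (K x).smul_mem r hvw.2

-- This is `J² = -1` for representatives; the isometry of the twist enters through `screenEndo_sq`.
omit [IsManifold 𝓘(ℝ, Euc (2 * m + 1)) ∞ B] in
theorem rep_neg {x : M} (hx : x ∈ U) {v w : Tan (2 * m + 2) x}
    (hvw : IsTwistRep c K g k x v w) : IsTwistRep c K g k x w (-v) := by
  have h0 := (h.rep_iff hx).1 hvw
  refine (h.rep_iff hx).2 ⟨hvw.2.1, ?_⟩
  have h1 := h.twisting.screenEndo_sq h.metric h.leaf.isOpen h.field hx (h.isometry x hx)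
    (Submodule.Quotient.mk ⟨v, hvw.1⟩)
  rw [h.twisting.screenEndo_mk, h.twisting.screenEndo_mk, ← Submodule.Quotient.mk_neg,
    screen_mk_eq] at h1
  have h2 := h.twisting.twistMap_mem h.metric h.leaf.isOpen h.field hx h0.2
  rw [map_sub] at h2
  have h3 := (K x).sub_mem ((K x).neg_mem h1) h2
  convert h3 using 1
  change -v - twistMap g k x w = -(twistMap g k x (twistMap g k x v) - (-v)) -
    (twistMap g k x w - twistMap g k x (twistMap g k x v))
  abel

omit [IsManifold 𝓘(ℝ, Euc (2 * m + 1)) ∞ B] in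
theorem exists_mem (p : B) : ∃ x ∈ U, π x = p := by
  obtain ⟨x, hx, hp⟩ := (h.leaf.fibres p).nonempty
  exact ⟨x, hx, hp⟩

theorem leafGraph_iff {x : M} (hx : x ∈ U) (X Y : Euc (2 * m + 1)) :
    leafGraph c K U g k π (π x) X Y ↔ leafRel c K g k π x X Y := by
  constructor
  · rintro ⟨x', hx', hp, h1⟩
    exact (h.leafRel_iff hx' hx hp X Y).1 h1
  · intro h1
    exact ⟨x, hx, rfl, h1⟩

theorem leafGraph_add {p : B} {X Y X' Y' : Euc (2 * m + 1)}
    (h1 : leafGraph c K U g k π p X Y) (h2 : leafGraph c K U g k π p X' Y') :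
    leafGraph c K U g k π p (X + X') (Y + Y') := by
  obtain ⟨x, hx, rfl⟩ := h.exists_mem p
  rw [h.leafGraph_iff hx] at h1 h2 ⊢
  obtain ⟨v, w, hvw, rfl, rfl⟩ := h1
  obtain ⟨v', w', hvw', rfl, rfl⟩ := h2
  exact ⟨_, _, h.rep_add hx hvw hvw', map_add _ _ _, map_add _ _ _⟩

theorem leafGraph_smul {p : B} {X Y : Euc (2 * m + 1)} (r : ℝ)
    (h1 : leafGraph c K U g k π p X Y) : leafGraph c K U g k π p (r • X) (r • Y) := by
  obtain ⟨x, hx, rfl⟩ := h.exists_mem p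
  rw [h.leafGraph_iff hx] at h1 ⊢
  obtain ⟨v, w, hvw, rfl, rfl⟩ := h1
  exact ⟨_, _, h.rep_smul hx r hvw, map_smul _ _ _, map_smul _ _ _⟩

theorem leafGraph_neg {p : B} {X Y : Euc (2 * m + 1)}
    (h1 : leafGraph c K U g k π p X Y) : leafGraph c K U g k π p Y (-X) := by
  obtain ⟨x, hx, rfl⟩ := h.exists_mem p
  rw [h.leafGraph_iff hx] at h1 ⊢
  obtain ⟨v, w, hvw, rfl, rfl⟩ := h1
  exact ⟨_, _, h.rep_neg hx hvw, rfl, map_neg _ _⟩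

theorem leafGraph_zero (p : B) : leafGraph c K U g k π p 0 0 := by
  obtain ⟨x, hx, rfl⟩ := h.exists_mem p
  refine (h.leafGraph_iff hx 0 0).2 ⟨0, 0, (h.rep_iff hx).2 ⟨zero_mem _, ?_⟩, map_zero _,
    map_zero _⟩
  rw [map_zero, sub_zero]
  exact zero_mem _

/-- By linearity the first entry can be taken zero. Its lifts then lie in `K`, which the twist map
preserves, and `K` is killed by the differential of `π`. -/
theorem leafGraph_unique {p : B} {X Y Y' : Euc (2 * m + 1)}
    (h1 : leafGraph c K U g k π p X Y) (h2 : leafGraph c K U g k π p X Y') : Y = Y' := by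
  have h3 := h.leafGraph_add h1 (h.leafGraph_smul (-1) h2)
  obtain ⟨x, hx, rfl⟩ := h.exists_mem p
  rw [h.leafGraph_iff hx] at h3
  obtain ⟨v, w, hvw, hv, hw⟩ := h3
  have h0 : X + (-1 : ℝ) • X = 0 := by simp
  have h4 : v ∈ K x := (h.leaf.ker_deriv x hx v).1 (hv.trans h0)
  have h5 := (K x).add_mem ((h.rep_iff hx).1 hvw).2
    (h.twisting.twistMap_mem h.metric h.leaf.isOpen h.field hx h4)
  rw [sub_add_cancel] at h5
  have h6 : Y + (-1 : ℝ) • Y' = 0 := hw.symm.trans ((h.leaf.ker_deriv x hx w).2 h5)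
  rw [neg_one_smul, ← sub_eq_add_neg] at h6
  exact sub_eq_zero.1 h6

/-- The contact distribution of the leaf space. -/
def leafH (p : B) : Submodule ℝ (Tan (2 * m + 1) p) where
  carrier := {X | ∃ Y, leafGraph c K U g k π p X Y}
  add_mem' := fun ⟨_, h1⟩ ⟨_, h2⟩ => ⟨_, h.leafGraph_add h1 h2⟩
  zero_mem' := ⟨0, h.leafGraph_zero p⟩
  smul_mem' := fun r _ ⟨_, h1⟩ => ⟨_, h.leafGraph_smul r h1⟩

theorem mem_leafH_left {p : B} {X Y : Tan (2 * m + 1) p} (h1 : leafGraph c K U g k π p X Y) :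
    X ∈ h.leafH p := ⟨Y, h1⟩

theorem mem_leafH_right {p : B} {X Y : Tan (2 * m + 1) p} (h1 : leafGraph c K U g k π p X Y) :
    Y ∈ h.leafH p := ⟨_, h.leafGraph_neg h1⟩

theorem leafGraph_neg_tan {p : B} {X Y : Tan (2 * m + 1) p} (h1 : leafGraph c K U g k π p X Y) :
    leafGraph c K U g k π p Y (-X : Tan (2 * m + 1) p) := h.leafGraph_neg h1

/-- The complex structure of the contact distribution of the leaf space. -/
def leafJ (p : B) : h.leafH p →ₗ[ℝ] h.leafH p where
  toFun X := ⟨X.2.choose, h.mem_leafH_right X.2.choose_spec⟩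
  map_add' X Y := Subtype.ext (h.leafGraph_unique (X + Y).2.choose_spec
    (h.leafGraph_add X.2.choose_spec Y.2.choose_spec))
  map_smul' r X := Subtype.ext (h.leafGraph_unique (r • X).2.choose_spec
    (h.leafGraph_smul r X.2.choose_spec))

theorem leafGraph_leafJ {p : B} (X : h.leafH p) :
    leafGraph c K U g k π p (X : Tan (2 * m + 1) p) (h.leafJ p X : Tan (2 * m + 1) p) :=
  X.2.choose_spec

theorem mem_leafH_iff {x : M} (hx : x ∈ U) (Y : Tan (2 * m + 1) (π x)) :
    Y ∈ h.leafH (π x) ↔ ∃ v ∈ perp c K x, leafDeriv (m := m) π x v = Y := by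
  constructor
  · rintro ⟨Y', hY'⟩
    obtain ⟨v, w, hvw, hv, -⟩ := (h.leafGraph_iff hx _ _).1 hY'
    exact ⟨v, hvw.1, hv⟩
  · rintro ⟨v, hv, rfl⟩
    exact ⟨_, (h.leafGraph_iff hx _ _).2 ⟨v, _,
      h.twisting.isTwistRep_twistMap h.metric h.leaf.isOpen h.field hx hv, rfl, rfl⟩⟩

end IsUnitLeafSpace

/-- A smooth local section of the projection to the leaf space. -/
structure IsLeafSection (U : Set M) (π : M → B) (N : Set B) (s : B → M) : Prop where
  isOpen : IsOpen N
  smooth : ContMDiffOn 𝓘(ℝ, Euc (2 * m + 1)) 𝓘(ℝ, Euc (2 * m + 2)) ∞ s N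
  mem : ∀ p ∈ N, s p ∈ U
  right_inv : ∀ p ∈ N, π (s p) = p

namespace IsUnitLeafSpace

variable {g : LorentzMetric (2 * m + 2) M} {k : ∀ x : M, Tan (2 * m + 2) x}
  (h : IsUnitLeafSpace (B := B) c K U π g k) {N : Set B} {s : B → M}
  (hs : IsLeafSection (m := m) U π N s)
include h

theorem exists_leafSection (p : B) :
    ∃ (N : Set B) (s : B → M), p ∈ N ∧ IsLeafSection (m := m) U π N s := by
  obtain ⟨x, hx, rfl⟩ := h.exists_mem p
  obtain ⟨N, s, hN, hp, hs, -, hsN, -⟩ := h.exists_section hx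
  exact ⟨N, s, hp, hN, hs, fun p hp => (hsN p hp).1, fun p hp => (hsN p hp).2⟩

include hs

omit [IsManifold 𝓘(ℝ, Euc (2 * m + 1)) ∞ B] in
theorem leafDeriv_section {p : B} (hp : p ∈ N) (X : Tan (2 * m + 1) p) :
    (leafDeriv (m := m) π (s p) (diffAt s p X) : Euc (2 * m + 1)) = X :=
  diffAt_comp_of_leftInverse hs.isOpen hp (hs.smooth.contMDiffAt (hs.isOpen.mem_nhds hp))
    (h.leaf.smooth.contMDiffAt (h.leaf.isOpen.mem_nhds (hs.mem p hp))) hs.right_inv X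

omit [IsManifold 𝓘(ℝ, Euc (2 * m + 1)) ∞ B] in
theorem section_sub_mem {p : B} (hp : p ∈ N) {X : Tan (2 * m + 1) p} {v : Tan (2 * m + 2) (s p)}
    (hv : (leafDeriv (m := m) π (s p) v : Euc (2 * m + 1)) = X) :
    diffAt s p X - v ∈ K (s p) := by
  refine (h.leaf.ker_deriv _ (hs.mem p hp) _).1 ?_
  rw [map_sub]
  exact sub_eq_zero.2 ((h.leafDeriv_section hs hp X).trans hv.symm)

theorem leafGraph_section {p : B} (hp : p ∈ N) (X Y : Tan (2 * m + 1) p) :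
    leafGraph c K U g k π p X Y ↔ IsTwistRep c K g k (s p) (diffAt s p X) (diffAt s p Y) := by
  have h1 := h.leafGraph_iff (hs.mem p hp) X Y
  rw [hs.right_inv p hp] at h1
  rw [h1]
  constructor
  · rintro ⟨v, w, hvw, hv, hw⟩
    exact h.rep_congr (hs.mem p hp) hvw (h.section_sub_mem hs hp hv) (h.section_sub_mem hs hp hw)
  · intro hvw
    exact ⟨_, _, hvw, h.leafDeriv_section hs hp X, h.leafDeriv_section hs hp Y⟩

theorem mem_leafH_section {p : B} (hp : p ∈ N) (X : Tan (2 * m + 1) p) :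
    X ∈ h.leafH p ↔ diffAt s p X ∈ perp c K (s p) := by
  constructor
  · rintro ⟨Y, hY⟩
    exact ((h.leafGraph_section hs hp X Y).1 hY).1
  · intro hX
    have hr := h.twisting.isTwistRep_twistMap h.metric h.leaf.isOpen h.field (hs.mem p hp) hX
    let Y : Tan (2 * m + 1) p := (leafDeriv (m := m) π (s p)
      (twistMap g k (s p) (diffAt s p X)) : Euc (2 * m + 1))
    refine ⟨Y, (h.leafGraph_section hs hp X Y).2 (h.rep_congr (hs.mem p hp) hr ?_
      (h.section_sub_mem hs hp rfl))⟩
    rw [sub_self]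
    exact zero_mem _

omit h hs in
/-- The contact form defined by a section. -/
def contactForm (g : LorentzMetric (2 * m + 2) M) (k : ∀ x : M, Tan (2 * m + 2) x) (s : B → M)
    (p : B) : Tan (2 * m + 1) p →L[ℝ] ℝ :=
  pullFormM (d := 2 * m + 1) s (lowerVF g k) p

theorem smooth_contactForm : SmoothOneForm (contactForm g k s) N :=
  smoothOneForm_pullFormM hs.isOpen h.leaf.isOpen hs.smooth hs.mem
    (smoothOneForm_lowerVF g h.leaf.isOpen h.field.1)

theorem contactForm_eq_zero_iff {p : B} (hp : p ∈ N) (X : Tan (2 * m + 1) p) :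
    contactForm g k s p X = 0 ↔ X ∈ h.leafH p := by
  rw [h.mem_leafH_section hs hp, h.twisting.optical.mem_perp_iff h.metric
    (h.field.2 _ (hs.mem p hp)).1 (h.field.2 _ (hs.mem p hp)).2]
  rfl

/-- Exterior differentiation commutes with pullback by the section; the factor 2 undoes the
convention `(dκ)_{ab} = ∇_[a κ_b]` in `twist`. -/
theorem extDer_contactForm {p : B} (hp : p ∈ N) (X Y : Tan (2 * m + 1) p) :
    extDer (contactForm g k s) p X Y = 2 * twist g k (s p) (diffAt s p X) (diffAt s p Y) := by
  rw [twist, ← extDer_pullFormM hs.isOpen h.leaf.isOpen hs.smooth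
    (smoothOneForm_lowerVF g h.leaf.isOpen h.field.1) hp (hs.mem p hp)]
  change extDer (pullFormM (d := 2 * m + 1) s (lowerVF g k)) p X Y = _
  ring

theorem extDer_contactForm_graph {p : B} (hp : p ∈ N) {X Y Z : Tan (2 * m + 1) p}
    (hXY : leafGraph c K U g k π p X Y) (hZ : Z ∈ h.leafH p) :
    extDer (contactForm g k s) p X Z = 2 * g.val (s p) (diffAt s p Y) (diffAt s p Z) := by
  rw [h.extDer_contactForm hs hp, ((h.leafGraph_section hs hp X Y).1 hXY).2.2 _
    ((h.mem_leafH_section hs hp Z).1 hZ)]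

/-- With `Y = JX`, the value is `2 g(JX, JX) = 2 g(X, X)` on lifts, and the lift of a non-zero `X`
is not in `K`. -/
theorem extDer_contactForm_pos {p : B} (hp : p ∈ N) {X Y : Tan (2 * m + 1) p}
    (hXY : leafGraph c K U g k π p X Y) (hX : X ≠ 0) :
    0 < extDer (contactForm g k s) p X Y := by
  have hr := (h.leafGraph_section hs hp X Y).1 hXY
  rw [h.extDer_contactForm_graph hs hp hXY (h.mem_leafH_right hXY),
    h.isometry_rep (hs.mem p hp) hr]
  refine mul_pos two_pos (h.twisting.optical.pos_of_not_mem h.metric hr.1 fun h1 => hX ?_)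
  exact (h.leafDeriv_section hs hp X).symm.trans ((h.leaf.ker_deriv _ (hs.mem p hp) _).2 h1)

/-- `dθ` is of type (1,1): `dθ(JX, ·) = -2 g(X, ·)` on lifts, and `g` is symmetric. This is the
algebraic content of partial integrability. -/
theorem extDer_contactForm_invariant {p : B} (hp : p ∈ N) {X Y X' Y' : Tan (2 * m + 1) p}
    (hXY : leafGraph c K U g k π p X Y) (hXY' : leafGraph c K U g k π p X' Y') :
    extDer (contactForm g k s) p Y Y' = extDer (contactForm g k s) p X X' := by
  rw [extDer_swap _ p X X',
    h.extDer_contactForm_graph hs hp hXY' (h.mem_leafH_left hXY),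
    h.extDer_contactForm_graph hs hp (h.leafGraph_neg_tan hXY) (h.mem_leafH_right hXY'),
    map_neg, map_neg, neg_apply, g.symm]
  ring

/-- Modulo `K` every vector at `s p` is the lift of its projection, so a vanishing contact form
would make `k` orthogonal to everything. -/
theorem exists_contactForm_ne_zero {p : B} (hp : p ∈ N) : ∃ n, contactForm g k s p n ≠ 0 := by
  by_contra! h1
  have hsU := hs.mem p hp
  obtain ⟨n, hn⟩ := (g.isLorentzForm (s p)).exists_pairing_ne_zero (h.field.2 _ hsU).2
  refine hn ?_
  have h2 : n ∈ perp c K (s p) := by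
    let X : Tan (2 * m + 1) p := (leafDeriv (m := m) π (s p) n : Euc (2 * m + 1))
    have h3 := h.twisting.optical.le_perp _ (h.section_sub_mem hs hp (X := X) (v := n) rfl)
    have h4 := (h.mem_leafH_section hs hp X).1 ((h.contactForm_eq_zero_iff hs hp X).1 (h1 X))
    have h5 := (perp c K (s p)).sub_mem h4 h3
    rwa [sub_sub_cancel] at h5
  exact h2 g h.metric _ (h.field.2 _ hsU).1

theorem isContactForm : IsContactForm h.leafH (contactForm g k s) N := by
  refine ⟨h.smooth_contactForm hs, fun p hp =>
    ⟨fun X => (h.contactForm_eq_zero_iff hs hp X).symm, fun X hX hX0 => ?_⟩⟩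
  obtain ⟨Y, hY⟩ := hX
  by_contra h0
  exact (h.extDer_contactForm_pos hs hp hY h0).ne' (hX0 Y (h.mem_leafH_right hY))

omit hs

theorem isDistribution_leafH : IsDistribution (2 * m) h.leafH := by
  intro p₀
  obtain ⟨N, s, hp₀, hs⟩ := h.exists_leafSection p₀
  obtain ⟨W, hW, hpW, hWN, X, hX, hXW⟩ := exists_kernel_frame hs.isOpen (h.smooth_contactForm hs)
    hp₀ (h.exists_contactForm_ne_zero hs hp₀)
  refine ⟨W, hW, hpW, X, hX, fun p hp => ⟨(hXW p hp).1, ?_⟩⟩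
  ext v
  rw [(hXW p hp).2, h.contactForm_eq_zero_iff hs (hWN hp)]

/-- Locally `Y` is obtained from `X` by lifting along a section, applying the smooth `twistMap` and
projecting back. -/
theorem smooth_leafJ {V : Set B} {X Y : ∀ p : B, Tan (2 * m + 1) p} (hV : IsOpen V)
    (hX : SmoothVF X V) (hXY : ∀ p ∈ V, leafGraph c K U g k π p (X p) (Y p)) : SmoothVF Y V := by
  intro p₀ hp₀
  obtain ⟨N, s, hpN, hs⟩ := h.exists_leafSection p₀
  obtain ⟨W, Z, V', hW, hWU, hZ, hV', hpV', hV'V, hZs⟩ := exists_lift h.leaf.isOpen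
    (hV.inter hs.isOpen) h.leaf.smooth (hs.smooth.mono inter_subset_right)
    (fun p hp => hs.mem p hp.2) (fun p hp => hs.right_inv p hp.2) (hX.mono inter_subset_left)
    ⟨hp₀, hpN⟩
  have h1 : SmoothVF Y V' := by
    refine smoothVF_push h.leaf.isOpen h.leaf.smooth (hs.smooth.mono fun p hp => (hV'V hp).2)
      (fun p hp => hs.mem p (hV'V hp).2) (fun p hp => (hZs p hp).1)
      (fun p hp => hs.right_inv p (hV'V hp).2)
      (smoothVF_twistMap g hW (h.field.1.mono hWU) hZ) fun p hp => ?_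
    have hpN' := (hV'V hp).2
    have h2 := ((h.rep_iff (hs.mem p hpN')).1 ((h.leafGraph_section hs hpN' _ _).1
      (hXY p (hV'V hp).1))).2
    rw [← h.leaf.ker_deriv _ (hs.mem p hpN'), map_sub, sub_eq_zero] at h2
    refine (h.leafDeriv_section hs hpN' (Y p)).symm.trans (h2.trans ?_)
    rw [(hZs p hp).2]
    rfl
  exact (h1.contMDiffAt (hV'.mem_nhds hpV')).contMDiffWithinAt

/-- The almost CR structure that the twist induces on the leaf space. -/
def almostCR : AlmostCR m B where
  H := h.leafH
  J := h.leafJ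
  distribution := h.isDistribution_leafH
  sq p X := Subtype.ext (h.leafGraph_unique (h.leafGraph_leafJ (h.leafJ p X))
    (h.leafGraph_neg (h.leafGraph_leafJ X)))
  smooth V X Y hV hX hXY := h.smooth_leafJ hV hX fun p hp => by
    obtain ⟨h1, h2⟩ := hXY p hp
    rw [h2]
    exact h.leafGraph_leafJ ⟨X p, h1⟩

theorem isTwistInduced_almostCR : IsTwistInduced c K U π h.almostCR := by
  refine ⟨k, h.field, fun x hx => ⟨h.mem_leafH_iff hx,
    h.twisting.screenEndo h.metric h.leaf.isOpen h.field hx,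
    h.twisting.isTwistEndo_screenEndo h.metric h.leaf.isOpen h.field hx, fun v w hvw => ?_⟩⟩
  have h1 := ((h.twisting.isTwistEndo_screenEndo h.metric h.leaf.isOpen h.field hx).eq_iff
    h.twisting.optical h.metric v w).1 hvw
  have h2 := (h.leafGraph_iff hx _ _).2 ⟨_, _, h1, rfl, rfl⟩
  exact ⟨h.mem_leafH_left h2, h.leafGraph_unique (h.leafGraph_leafJ ⟨_, h.mem_leafH_left h2⟩) h2⟩

theorem isContact_almostCR : h.almostCR.IsContact := by
  intro p₀
  obtain ⟨N, s, hp₀, hs⟩ := h.exists_leafSection p₀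
  exact ⟨N, hs.isOpen, hp₀, _, h.isContactForm hs⟩

theorem isPositive_almostCR : h.almostCR.IsPositive := by
  intro p₀
  obtain ⟨N, s, hp₀, hs⟩ := h.exists_leafSection p₀
  refine ⟨N, hs.isOpen, hp₀, _, h.isContactForm hs, fun p hp X hX =>
    h.extDer_contactForm_pos hs hp (h.leafGraph_leafJ X) fun h0 => hX (Subtype.ext h0)⟩

theorem leafGraph_of_mem_holo {p : B} {X Y : Tan (2 * m + 1) p}
    (hXY : cvec X Y ∈ h.almostCR.holo p) : leafGraph c K U g k π p X (-Y : Tan (2 * m + 1) p) := by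
  obtain ⟨Z, hZ⟩ := hXY
  obtain ⟨rfl, rfl⟩ := cvec_inj.1 hZ
  rw [neg_neg]
  exact h.leafGraph_leafJ Z

/-- Since `θ([Z,Z']) = -dθ(Z,Z')` on sections of the contact distribution, `θ` of the real and
imaginary parts of the bracket are differences of values of `dθ` that agree by invariance under `J`.
-/
theorem isPartiallyIntegrable_almostCR : h.almostCR.IsPartiallyIntegrable := by
  intro V X Y X' Y' hV hX hY hX' hY' hXY hXY' p hp
  obtain ⟨N, s, hpN, hs⟩ := h.exists_leafSection p
  have hVN : IsOpen (V ∩ N) := hV.inter hs.isOpen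
  have hG : ∀ q ∈ V, leafGraph c K U g k π q (X q) (-Y q : Tan (2 * m + 1) q) := fun q hq =>
    h.leafGraph_of_mem_holo (hXY q hq)
  have hG' : ∀ q ∈ V, leafGraph c K U g k π q (X' q) (-Y' q : Tan (2 * m + 1) q) := fun q hq =>
    h.leafGraph_of_mem_holo (hXY' q hq)
  have hn : ∀ {q : B} {Z : Tan (2 * m + 1) q}, -Z ∈ h.leafH q → Z ∈ h.leafH q := fun hZ =>
    (Submodule.neg_mem_iff _).1 hZ
  have hbr : ∀ Z Z' : ∀ p : B, Tan (2 * m + 1) p, SmoothVF Z V → SmoothVF Z' V →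
      (∀ q ∈ V, Z q ∈ h.leafH q) → (∀ q ∈ V, Z' q ∈ h.leafH q) →
      contactForm g k s p (VectorField.mlieBracket 𝓘(ℝ, Euc (2 * m + 1)) Z Z' p) =
        -extDer (contactForm g k s) p (Z p) (Z' p) := fun Z Z' hZ hZ' hZH hZH' =>
    form_mlieBracket hVN ((h.smooth_contactForm hs).mono inter_subset_right)
      (hZ.mono inter_subset_left) (hZ'.mono inter_subset_left)
      (fun q hq => (h.contactForm_eq_zero_iff hs hq.2 _).2 (hZH q hq.1))
      (fun q hq => (h.contactForm_eq_zero_iff hs hq.2 _).2 (hZH' q hq.1)) ⟨hp, hpN⟩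
  have hXH : ∀ q ∈ V, X q ∈ h.leafH q := fun q hq => h.mem_leafH_left (hG q hq)
  have hXH' : ∀ q ∈ V, X' q ∈ h.leafH q := fun q hq => h.mem_leafH_left (hG' q hq)
  have hYH : ∀ q ∈ V, Y q ∈ h.leafH q := fun q hq => hn (h.mem_leafH_right (hG q hq))
  have hYH' : ∀ q ∈ V, Y' q ∈ h.leafH q := fun q hq => hn (h.mem_leafH_right (hG' q hq))
  rw [cvec_mem_baseChange]
  constructor
  · refine (h.contactForm_eq_zero_iff hs hpN _).1 ?_
    rw [map_sub, hbr X X' hX hX' hXH hXH', hbr Y Y' hY hY' hYH hYH',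
      ← h.extDer_contactForm_invariant hs hpN (hG p hp) (hG' p hp), extDer_neg_left, extDer_neg_right, neg_neg,
      sub_self]
  · refine (h.contactForm_eq_zero_iff hs hpN _).1 ?_
    have h1 := h.leafGraph_neg_tan (hG' p hp)
    have h2 := h.extDer_contactForm_invariant hs hpN (hG p hp) h1
    rw [extDer_neg_left, extDer_neg_right, extDer_neg_right, neg_neg] at h2
    rw [map_add, hbr X Y' hX hY' hXH hYH', hbr Y X' hY hX' hYH hXH', h2]
    ring

end IsUnitLeafSpace

end LeafCR

/-! ### The remaining implications. -/

section Equivalence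

variable {m : ℕ} {M : Type*} [TopologicalSpace M] [ChartedSpace (Euc (2 * m + 2)) M]
  [IsManifold 𝓘(ℝ, Euc (2 * m + 2)) ∞ M] {c : ConformalStructure (2 * m + 2) M}
  {K : ∀ x : M, Submodule ℝ (Tan (2 * m + 2) x)}

theorem IsTwistingOptical.twistInducesCR (hK : IsTwistingOptical c K)
    (h : TwistInducesAlmostRobinson c K m) : TwistInducesCR c K := by
  refine ⟨fun x => ?_, fun B _ _ _ _ U π hL => ?_⟩
  · obtain ⟨U, π, hx, hL⟩ := hK.optical.exists_leafSpace x
    exact ⟨Euc (2 * m + 1), _, TopologicalSpace.t2Space_of_metrizableSpace, _, inferInstance, U,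
      π, hx, hL⟩
  · obtain ⟨k, J, -, hk, hJ, -⟩ := h
    obtain ⟨g, hg⟩ := c.nonempty
    have hkU : IsOpticalField K k U :=
      ⟨hk.1.mono (subset_univ U), fun x _ => hk.2 x (mem_univ x)⟩
    -- The global optical field is restricted to `U`; its complex structure provides the isometry
    -- that pins the scale along the leaves.
    have hU : IsUnitLeafSpace c K U π g k := ⟨hK, hL, hg, hkU, fun x hx v hv =>
      (hJ x).1.isometry hK.optical (hJ x).2 hg
        (hK.isTwistRep_twistMap hg hL.isOpen hkU hx hv)⟩
    exact ⟨hU.almostCR, hU.isTwistInduced_almostCR, hU.isContact_almostCR,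
      hU.isPartiallyIntegrable_almostCR, hU.isPositive_almostCR⟩

/-- The differential of `π` is injective on `K^⊥/K` and intertwines the two endomorphisms, so the
square of the twist endomorphism is `-1` upstairs because it is downstairs. -/
theorem IsTwistingOptical.weylCondition_of_twistInducesCR (hK : IsTwistingOptical c K)
    (hm : 1 < m) (h : TwistInducesCR c K) : WeylCondition c K := by
  refine hK.weylCondition_of_endo (by omega) fun x => ?_
  obtain ⟨B, _, _, _, _, U, π, hx, hL⟩ := h.1 x
  obtain ⟨S, ⟨k, hk, hS⟩, -⟩ := h.2 B U π hL
  obtain ⟨-, J, hJ, hJS⟩ := hS x hx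
  refine ⟨U, hL.isOpen, hx, k, hk, J, hJ, fun s => ?_⟩
  obtain ⟨v, rfl⟩ := Submodule.Quotient.mk_surjective _ s
  obtain ⟨w, hw⟩ := Submodule.Quotient.mk_surjective _ (J (Submodule.Quotient.mk v))
  obtain ⟨u, hu⟩ := Submodule.Quotient.mk_surjective _ (J (Submodule.Quotient.mk w))
  obtain ⟨h1, h2⟩ := hJS v w hw.symm
  obtain ⟨h3, h4⟩ := hJS w u hu.symm
  have h5 : S.J (π x) ⟨leafDeriv (m := m) π x v, h1⟩ = ⟨leafDeriv (m := m) π x w, h3⟩ :=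
    Subtype.ext h2
  have h6 := S.sq (π x) ⟨leafDeriv (m := m) π x v, h1⟩
  rw [h5] at h6
  have h7 : leafDeriv (m := m) π x u = -leafDeriv (m := m) π x v :=
    h4.symm.trans (congrArg Subtype.val h6)
  rw [← hw, ← hu, ← Submodule.Quotient.mk_neg, screen_mk_eq]
  refine (hL.ker_deriv x hx _).1 ?_
  have h8 : leafDeriv (m := m) π x ((u : Tan (2 * m + 2) x) + v) = 0 := by
    rw [map_add, h7, neg_add_cancel]
  convert h8 using 2
  exact sub_neg_eq_add (u : Tan (2 * m + 2) x) v

end Equivalence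

end OpticalGeom

end

theorem mainTheorem2 (m : ℕ) (hm : 1 < m) (M : Type*) [TopologicalSpace M] [T2Space M]
    [SecondCountableTopology M] [ChartedSpace (OpticalGeom.Euc (2 * m + 2)) M]
    [IsManifold (modelWithCornersSelf ℝ (OpticalGeom.Euc (2 * m + 2))) ∞ M]
    (c : OpticalGeom.ConformalStructure (2 * m + 2) M) (hc : c.TimeOrientable)
    (K : ∀ x : M, Submodule ℝ (OpticalGeom.Tan (2 * m + 2) x))
    (hK : OpticalGeom.IsOptical c K)
    (hgeo : OpticalGeom.IsGeodesic c K)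
    (hshear : OpticalGeom.IsNonShearing c K)
    (htwist : OpticalGeom.IsTwisting c K) :
    List.TFAE [
      OpticalGeom.WeylCondition c K,
      OpticalGeom.TwistInducesAlmostRobinson c K m,
      OpticalGeom.TwistInducesCR c K] := by
  have h : OpticalGeom.IsTwistingOptical c K := ⟨hK, hgeo, hshear, htwist⟩
  tfae_have 1 → 2 := fun hW => by
    obtain ⟨g, hg⟩ := c.nonempty
    obtain ⟨k, hk, hF⟩ := h.exists_unit_twist (by omega) hc hW hg
    exact h.twistInducesAlmostRobinson hg hk hF
  tfae_have 2 → 3 := h.twistInducesCR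
  tfae_have 3 → 1 := h.weylCondition_of_twistInducesCR hm
  tfae_finish
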